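/- Let $a_0>0$, $\ell\in\mathbb R$, $\ell\neq 1$, $m\in\mathbb C$, and let $a(t)=a_0t^{\ell}$ for $t>0$. Consider the spatially flat FLRW spacetime $\{(t,x): t>0,\ x\in\mathbb R^3\}$ with metric $dt^2-a(t)^2\,(dx_1^2+dx_2^2+dx_3^2)$ and the Dirac operator $$\mathscr D=i\gamma^0\partial_t+\frac{i}{a(t)}\sum_{k=1}^3\gamma^k\partial_{x_k}+i\,\frac{3\dot a(t)}{2a(t)}\gamma^0-m\,t^{-1}\,\mathbb I_4,$$ where $\gamma^0=\begin{pmatrix}\mathbb I_2&0\\0&-\mathbb I_2\end{pmatrix}$, $\gamma^k=\begin{pmatrix}0&\sigma^k\\-\sigma^k&0\end{pmatrix}$ and $\sigma^1,\sigma^2,\sigma^3$ are the Pauli matrices. Let $\varepsilon>0$. We say that the Cauchy problem $$\mathscr D\Psi(x,t)=0\quad(t>\varepsilon),\qquad \Psi(x,\varepsilon)=\Phi(x),\qquad x\in\mathbb R^3,$$ obeys Huygens' principle if, for every initial spinor $\Phi\in C_0^\infty(\mathbb R^3;\mathbb C^4)$, the smooth solution $\Psi$ vanishes at every point $(x,t)$,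 $t>\varepsilon$, that cannot be reached by a null geodesic from any point $(y,\varepsilon)$ with $y\in\operatorname{supp}\Phi$. Then the Cauchy problem obeys Huygens' principle if and only if $m=0$ or $m=i(\ell-1)$ or $m=-i(\ell-1)$. -/

import Mathlib

open scoped ContDiff

noncomputable section

namespace FLRW

/-- Space `ℝ³` with Cartesian coordinates. -/
abbrev Space : Type := EuclideanSpace ℝ (Fin 3)

/-- Four-component spinors. -/
abbrev Spinor : Type := Fin 4 → ℂ

/-- The scale factor `a(t) = a₀ t ^ ℓ` (used for `t > 0` only). -/
def scaleFactor (a₀ ℓ t : ℝ) : ℝ := a₀ * t ^ ℓ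

/-! ### Geometry: metric, Christoffel symbols, null geodesics -/

/-- Spacetime coordinates `(t, x₁, x₂, x₃)` of the event at time `t` and place `x`. -/
def event (t : ℝ) (x : Space) : Fin 4 → ℝ := ![t, x 0, x 1, x 2]

/-- The metric tensor `diag (1, -a(t)², -a(t)², -a(t)²)`, with `t = p 0`. -/
def metric (a : ℝ → ℝ) (p : Fin 4 → ℝ) : Matrix (Fin 4) (Fin 4) ℝ :=
  Matrix.diagonal ![1, -(a (p 0)) ^ 2, -(a (p 0)) ^ 2, -(a (p 0)) ^ 2]

/-- The coordinate derivative `∂_μ f`. -/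
def partialDeriv (μ : Fin 4) (f : (Fin 4 → ℝ) → ℝ) (p : Fin 4 → ℝ) : ℝ :=
  fderiv ℝ f p (Pi.single μ 1)

/-- The Christoffel symbols `Γ^κ_{μν}` of a (pseudo-Riemannian) metric `g`. -/
def christoffel (g : (Fin 4 → ℝ) → Matrix (Fin 4) (Fin 4) ℝ) (p : Fin 4 → ℝ)
    (κ μ ν : Fin 4) : ℝ :=
  (1 / 2) * ∑ τ, (g p)⁻¹ κ τ *
    (partialDeriv μ (fun q => g q τ ν) p + partialDeriv ν (fun q => g q τ μ) p
      - partialDeriv τ (fun q => g q μ ν) p)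

/-- On the parameter set `I`, the curve `γ` with velocity `v` is an affinely parametrized null
geodesic of the metric `g`, staying in the spacetime `{t > 0}`. -/
structure IsNullGeodesicOn (g : (Fin 4 → ℝ) → Matrix (Fin 4) (Fin 4) ℝ) (I : Set ℝ)
    (γ v : ℝ → Fin 4 → ℝ) : Prop where
  mem_spacetime : ∀ s ∈ I, 0 < γ s 0
  velocity : ∀ s ∈ I, HasDerivAt γ (v s) s
  geodesic : ∀ s ∈ I,
    HasDerivAt v (fun κ => -∑ μ, ∑ ν, christoffel g (γ s) κ μ ν * v s μ * v s ν) s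
  velocity_ne_zero : ∀ s ∈ I, v s ≠ 0
  null : ∀ s ∈ I, ∑ μ, ∑ ν, g (γ s) μ ν * v s μ * v s ν = 0

/-- The event `q` can be reached from the event `p` by a null geodesic. -/
def NullReachable (g : (Fin 4 → ℝ) → Matrix (Fin 4) (Fin 4) ℝ) (p q : Fin 4 → ℝ) : Prop :=
  ∃ γ v : ℝ → Fin 4 → ℝ, IsNullGeodesicOn g (Set.Icc 0 1) γ v ∧ γ 0 = p ∧ γ 1 = q

/-! ### The Dirac operator and its Cauchy problem -/

/-- The gamma matrices: `γ⁰ = diag (𝕀₂, -𝕀₂)` and `γᵏ` with off-diagonal blocks `σᵏ`, `-σᵏ`,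
where `σ¹, σ², σ³` are the Pauli matrices. -/
def gamma : Fin 4 → Matrix (Fin 4) (Fin 4) ℂ :=
  ![!![1, 0, 0, 0; 0, 1, 0, 0; 0, 0, -1, 0; 0, 0, 0, -1],
    !![0, 0, 0, 1; 0, 0, 1, 0; 0, -1, 0, 0; -1, 0, 0, 0],
    !![0, 0, 0, -Complex.I; 0, 0, Complex.I, 0; 0, Complex.I, 0, 0; -Complex.I, 0, 0, 0],
    !![0, 0, 1, 0; 0, 0, 0, -1; -1, 0, 0, 0; 0, 1, 0, 0]]

/-- The time derivative of a spinor field on `ℝ³ × ℝ`. -/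
def timeDeriv (Ψ : Space × ℝ → Spinor) (p : Space × ℝ) : Spinor :=
  fderiv ℝ Ψ p (0, 1)

/-- The spatial derivative `∂_{x_k}` of a spinor field on `ℝ³ × ℝ`. -/
def spaceDeriv (k : Fin 3) (Ψ : Space × ℝ → Spinor) (p : Space × ℝ) : Spinor :=
  fderiv ℝ Ψ p (EuclideanSpace.single k 1, 0)

open Matrix in
/-- The Dirac operator
`i γ⁰ ∂_t + (i / a) ∑ₖ γᵏ ∂_{x_k} + i (3 a' / (2 a)) γ⁰ - m t⁻¹ 𝕀₄`. -/
def diracOp (a : ℝ → ℝ) (m : ℂ) (Ψ : Space × ℝ → Spinor) (p : Space × ℝ) : Spinor :=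
  Complex.I • (gamma 0 *ᵥ timeDeriv Ψ p)
    + ∑ k : Fin 3, (Complex.I / (a p.2 : ℂ)) • (gamma k.succ *ᵥ spaceDeriv k Ψ p)
    + (Complex.I * (3 * ((deriv a p.2 : ℝ) : ℂ) / (2 * (a p.2 : ℂ)))) • (gamma 0 *ᵥ Ψ p)
    - (m * (p.2 : ℂ)⁻¹) • Ψ p

/-- `Ψ` is a (smooth) solution for `t > ε` of the source-free Cauchy problem with initial
spinor `Φ` at the time `t = ε`. -/
structure IsCauchySolution (a : ℝ → ℝ) (m : ℂ) (ε : ℝ) (Φ : Space → Spinor)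
    (Ψ : Space × ℝ → Spinor) : Prop where
  smooth : ContDiffOn ℝ ∞ Ψ {p | ε ≤ p.2}
  dirac : ∀ (x : Space) (t : ℝ), ε < t → diracOp a m Ψ (x, t) = 0
  initial : ∀ x : Space, Ψ (x, ε) = Φ x

/-- Huygens' principle for the Cauchy problem with initial time `ε`: for all smooth compactly
supported initial spinors, the solution vanishes at all events that cannot be reached from the
support of the initial spinor (at time `ε`) by a null geodesic. -/
def HuygensPrinciple (a : ℝ → ℝ) (m : ℂ) (ε : ℝ) : Prop :=
  ∀ Φ : Space → Spinor, ContDiff ℝ ∞ Φ → HasCompactSupport Φ →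
    ∀ Ψ : Space × ℝ → Spinor, IsCauchySolution a m ε Φ Ψ →
      ∀ (x : Space) (t : ℝ), ε < t →
        (∀ y ∈ tsupport Φ, ¬ NullReachable (metric a) (event ε y) (event t x)) →
          Ψ (x, t) = 0

end FLRW

end

/-! In the conformal time `τ = t^(1-ℓ) / (a₀ (1-ℓ))`, and after multiplication by `t^(3ℓ/2)`, the
Dirac equation becomes `∂_τ ψ + ∑ αⱼ ∂ⱼ ψ = (ν/τ) γ⁰ ψ` on flat space, with `ν = i m / (ℓ-1)`. Null
geodesics become straight lines of speed one, so reachability means `‖x - y‖ = τ - τ₀`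
(`NullReachable.norm_sub_eq`, `nullReachable_of_norm_sub_eq`). The claim is that waves stay on the
sharp light cone exactly when `ν ∈ {0, 1, -1}`.

Sufficiency is a duality argument. For radial weights `A`, `L` the integral of `A ψᵢ + L (∑ xⱼ αⱼ
ψ)ᵢ` is conserved once `A`, `L` solve an adjoint system (`hasDerivAt_integral_pairDensity`). For the
three values of `ν` such weights can be built from spherical means of a one-variable profile: they
live in a `δ`-neighbourhood of the backward cone of `(0, τ₁)` and shrink to a bump at the origin at
time `τ₁` (`integral_bump_eq_zero`). If `ψ` vanishes initially near that cone, its averages around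
the origin vanish at time `τ₁`, and so does `ψ (0, τ₁)` (`eq_zero_of_cone`).

Necessity is tested on initial data `h e₀`, where `h` is a bump of mass one and width `δ`. Solutions
exist by Fourier superposition (`exists_log_solution`), and Huygens' principle confines them to a
shell of width `δ` around the cone. The moments of `ψ₀` and `(∑ xⱼ αⱼ ψ)₀` against powers of `‖x‖² -
(τ - τ₀)²` obey a closed linear system of five equations. On the shell the squared weight is
`O(δ²)`, while the energy estimate bounds the `L¹` norm by `O(δ^(-3/2))`; hence the second-power
moment tends to zero with `δ` (`eq_of_shell`). The limiting solution of the moment system starts at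
`(1, 0, 0, 0, 0)`, and its last component can vanish identically only for the three values of `ν`
(`eq_of_moment_system`). -/

open scoped ContDiff

noncomputable section

namespace FLRW

open Matrix

/-! ### The matrices `αⱼ = γ⁰ γʲ` -/

/-- The Hermitian Dirac matrices `αⱼ = γ⁰ γʲ`. -/
def alpha (j : Fin 3) : Matrix (Fin 4) (Fin 4) ℂ := gamma 0 * gamma j.succ

/-- The diagonal entries of `γ⁰`. -/
def sgn : Fin 4 → ℝ := ![1, 1, -1, -1]

lemma gamma_zero_eq : gamma 0 = Matrix.diagonal (fun i => (sgn i : ℂ)) := by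
  ext i j
  fin_cases i <;> fin_cases j <;> simp [gamma, sgn, Matrix.diagonal]

lemma gamma_zero_mul_self : gamma 0 * gamma 0 = 1 := by
  rw [gamma_zero_eq, Matrix.diagonal_mul_diagonal, ← Matrix.diagonal_one]
  congr 1
  funext i
  fin_cases i <;> simp [sgn]

lemma alpha_zero : alpha 0 = !![0, 0, 0, 1; 0, 0, 1, 0; 0, 1, 0, 0; 1, 0, 0, 0] := by
  ext i j
  fin_cases i <;> fin_cases j <;> simp [alpha, gamma]

lemma alpha_one : alpha 1 = !![0, 0, 0, -Complex.I; 0, 0, Complex.I, 0;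
    0, -Complex.I, 0, 0; Complex.I, 0, 0, 0] := by
  ext i j
  fin_cases i <;> fin_cases j <;> simp [alpha, gamma]

lemma alpha_two : alpha 2 = !![0, 0, 1, 0; 0, 0, 0, -1; 1, 0, 0, 0; 0, -1, 0, 0] := by
  ext i j
  fin_cases i <;> fin_cases j <;> simp [alpha, gamma]

lemma alpha_mul_self (j : Fin 3) : alpha j * alpha j = 1 := by
  fin_cases j <;> (ext i k; fin_cases i <;> fin_cases k <;>
    simp [alpha_zero, alpha_one, alpha_two])

lemma alpha_mul_alpha {j k : Fin 3} (h : j ≠ k) : alpha j * alpha k = -(alpha k * alpha j) := by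
  fin_cases j <;> fin_cases k <;> first
    | exact absurd rfl h
    | (ext i l; fin_cases i <;> fin_cases l <;> simp [alpha_zero, alpha_one, alpha_two])

lemma alpha_mul_gamma_zero (j : Fin 3) : alpha j * gamma 0 = -(gamma 0 * alpha j) := by
  fin_cases j <;> (ext i k; fin_cases i <;> fin_cases k <;>
    simp [alpha_zero, alpha_one, alpha_two, gamma_zero_eq, sgn])

lemma alpha_conjTranspose (j : Fin 3) : (alpha j)ᴴ = alpha j := by
  fin_cases j <;> (ext i k; fin_cases i <;> fin_cases k <;>
    simp [alpha_zero, alpha_one, alpha_two])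

lemma gamma_zero_mulVec (v : Spinor) (i : Fin 4) : (gamma 0 *ᵥ v) i = (sgn i : ℂ) * v i := by
  rw [gamma_zero_eq, Matrix.mulVec_diagonal]

end FLRW

/-! ### Reachability by null geodesics as an equation in conformal time -/

namespace FLRW

/-! ### Null geodesics -/

/-- The conformal time `t ^ (1 - ℓ) / (a₀ (1 - ℓ))`, a primitive of `1 / a`. -/
def conformalTime (a₀ ℓ t : ℝ) : ℝ := t ^ (1 - ℓ) / (a₀ * (1 - ℓ))

lemma scaleFactor_pos {a₀ ℓ t : ℝ} (ha₀ : 0 < a₀) (ht : 0 < t) : 0 < scaleFactor a₀ ℓ t :=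
  mul_pos ha₀ (Real.rpow_pos_of_pos ht _)

lemma hasDerivAt_scaleFactor (a₀ ℓ : ℝ) {t : ℝ} (ht : 0 < t) :
    HasDerivAt (scaleFactor a₀ ℓ) (ℓ * scaleFactor a₀ ℓ t / t) t := by
  have h := (Real.hasDerivAt_rpow_const (x := t) (p := ℓ) (Or.inl ht.ne')).const_mul a₀
  refine h.congr_deriv ?_
  rw [Real.rpow_sub_one ht.ne', scaleFactor]
  field_simp

lemma hasDerivAt_conformalTime {a₀ ℓ t : ℝ} (ha₀ : 0 < a₀) (hℓ : ℓ ≠ 1) (ht : 0 < t) :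
    HasDerivAt (conformalTime a₀ ℓ) (1 / scaleFactor a₀ ℓ t) t := by
  have h1 : 1 - ℓ ≠ 0 := sub_ne_zero.2 hℓ.symm
  have h := (Real.hasDerivAt_rpow_const (x := t) (p := 1 - ℓ) (Or.inl ht.ne')).div_const
    (a₀ * (1 - ℓ))
  refine h.congr_deriv ?_
  rw [show 1 - ℓ - 1 = -ℓ by ring, Real.rpow_neg ht.le, scaleFactor]
  have := (Real.rpow_pos_of_pos ht ℓ).ne'
  field_simp

lemma conformalTime_lt {a₀ ℓ s t : ℝ} (ha₀ : 0 < a₀) (hℓ : ℓ ≠ 1) (hs : 0 < s) (hst : s < t) :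
    conformalTime a₀ ℓ s < conformalTime a₀ ℓ t := by
  have hmono : StrictMonoOn (conformalTime a₀ ℓ) (Set.Ioi 0) := by
    refine strictMonoOn_of_deriv_pos (convex_Ioi 0) (fun u hu => ?_) (fun u hu => ?_)
    · exact (hasDerivAt_conformalTime ha₀ hℓ hu).continuousAt.continuousWithinAt
    · rw [interior_Ioi] at hu
      rw [(hasDerivAt_conformalTime ha₀ hℓ hu).deriv]
      exact one_div_pos.2 (scaleFactor_pos ha₀ hu)
  exact hmono hs (hs.trans hst) hst

lemma metric_inv {a : ℝ → ℝ} {p : Fin 4 → ℝ} (ha : a (p 0) ≠ 0) :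
    (metric a p)⁻¹ = Matrix.diagonal ![1, -((a (p 0)) ^ 2)⁻¹, -((a (p 0)) ^ 2)⁻¹,
      -((a (p 0)) ^ 2)⁻¹] := by
  refine Matrix.inv_eq_right_inv ?_
  rw [metric, Matrix.diagonal_mul_diagonal, ← Matrix.diagonal_one]
  congr 1
  funext i
  fin_cases i <;> simp [ha]

lemma partialDeriv_metric {a : ℝ → ℝ} {p : Fin 4 → ℝ} {a' : ℝ} (ha' : HasDerivAt a a' (p 0))
    (μ κ ν : Fin 4) :
    partialDeriv μ (fun q => metric a q κ ν) p =
      if μ = 0 ∧ κ = ν ∧ κ ≠ 0 then -(2 * a (p 0) * a') else 0 := by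
  have hproj : HasFDerivAt (fun q : Fin 4 → ℝ => q 0)
      (ContinuousLinearMap.proj (R := ℝ) (φ := fun _ : Fin 4 => ℝ) 0) p :=
    (ContinuousLinearMap.proj (R := ℝ) (φ := fun _ : Fin 4 => ℝ) 0).hasFDerivAt
  have h2 := ((ha'.comp_hasFDerivAt p hproj).pow 2).neg
  unfold partialDeriv
  by_cases hκν : κ = ν
  · subst hκν
    by_cases hκ : κ = 0
    · subst hκ
      have : (fun q => metric a q 0 0) = fun _ => (1 : ℝ) := by
        funext q; simp [metric]
      rw [this]; simp
    · have : (fun q => metric a q κ κ) = fun q => -(a (q 0)) ^ 2 := by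
        funext q
        fin_cases κ <;> simp_all [metric]
      rw [this]
      have h3 : fderiv ℝ (fun q : Fin 4 → ℝ => -(a (q 0)) ^ 2) p = _ := h2.fderiv
      rw [h3]
      fin_cases μ <;> simp [hκ]
  · have : (fun q => metric a q κ ν) = fun _ => (0 : ℝ) := by
      funext q; simp [metric, hκν]
    rw [this]; simp [hκν]

/-- The only nonzero Christoffel symbols are `Γ⁰ₖₖ = a a'` and `Γᵏ₀ₖ = Γᵏₖ₀ = a'/a`. -/
lemma geodesic_acceleration {a : ℝ → ℝ} {p : Fin 4 → ℝ} {a' : ℝ} (ha : a (p 0) ≠ 0)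
    (ha' : HasDerivAt a a' (p 0)) (v : Fin 4 → ℝ) :
    (fun κ => -∑ μ, ∑ ν, christoffel (metric a) p κ μ ν * v μ * v ν) =
      ![-(a (p 0) * a' * (v 1 ^ 2 + v 2 ^ 2 + v 3 ^ 2)), -(2 * (a' / a (p 0)) * v 0 * v 1),
        -(2 * (a' / a (p 0)) * v 0 * v 2), -(2 * (a' / a (p 0)) * v 0 * v 3)] := by
  funext κ
  simp only [christoffel, partialDeriv_metric ha', metric_inv ha]
  fin_cases κ <;> simp [Fin.sum_univ_four, Matrix.diagonal_apply] <;> field_simp <;> ring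

lemma metric_sum (a : ℝ → ℝ) (p v : Fin 4 → ℝ) :
    ∑ μ, ∑ ν, metric a p μ ν * v μ * v ν =
      v 0 ^ 2 - a (p 0) ^ 2 * (v 1 ^ 2 + v 2 ^ 2 + v 3 ^ 2) := by
  simp [Fin.sum_univ_four, metric, Matrix.diagonal_apply]
  ring

lemma eq_of_hasDerivAt_zero {f : ℝ → ℝ} (h : ∀ s ∈ Set.Icc (0 : ℝ) 1, HasDerivAt f 0 s) :
    ∀ s ∈ Set.Icc (0 : ℝ) 1, f s = f 0 := by
  refine constant_of_has_deriv_right_zero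
    (fun s hs => (h s hs).continuousAt.continuousWithinAt)
    (fun s hs => (h s ⟨hs.1, hs.2.le⟩).hasDerivWithinAt)

/-- Translation invariance conserves `a² vᵏ`, and along null curves `a v⁰` is conserved as well.
Their quotient is the constant velocity of the curve with respect to conformal time, and the null
condition makes it a unit vector. -/
lemma NullReachable.norm_sub_eq {a₀ ℓ ε t : ℝ} (ha₀ : 0 < a₀) (hℓ : ℓ ≠ 1) (hε : 0 < ε)
    (ht : ε < t) {x y : Space}
    (h : NullReachable (metric (scaleFactor a₀ ℓ)) (event ε y) (event t x)) :
    ‖x - y‖ = conformalTime a₀ ℓ t - conformalTime a₀ ℓ ε := by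
  obtain ⟨γ, v, hγ, h0, h1⟩ := h
  set a := scaleFactor a₀ ℓ with ha
  have hapos : ∀ s ∈ Set.Icc (0 : ℝ) 1, 0 < a (γ s 0) := fun s hs =>
    scaleFactor_pos ha₀ (hγ.mem_spacetime s hs)
  have hγd : ∀ s ∈ Set.Icc (0 : ℝ) 1, ∀ i, HasDerivAt (fun u => γ u i) (v s i) s := fun s hs i =>
    (hasDerivAt_pi.1 (hγ.velocity s hs)) i
  have had : ∀ s ∈ Set.Icc (0 : ℝ) 1,
      HasDerivAt (fun u => a (γ u 0)) (deriv a (γ s 0) * v s 0) s := fun s hs => by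
    have h := hasDerivAt_scaleFactor a₀ ℓ (hγ.mem_spacetime s hs)
    rw [← ha] at h
    have h' : HasDerivAt a (deriv a (γ s 0)) (γ s 0) := h.deriv ▸ h
    exact HasDerivAt.comp (h := fun u => γ u 0) (h₂ := a) s h' (hγd s hs 0)
  have hvd : ∀ s ∈ Set.Icc (0 : ℝ) 1, HasDerivAt v
      ![-(a (γ s 0) * deriv a (γ s 0) * (v s 1 ^ 2 + v s 2 ^ 2 + v s 3 ^ 2)),
        -(2 * (deriv a (γ s 0) / a (γ s 0)) * v s 0 * v s 1),
        -(2 * (deriv a (γ s 0) / a (γ s 0)) * v s 0 * v s 2),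
        -(2 * (deriv a (γ s 0) / a (γ s 0)) * v s 0 * v s 3)] s := fun s hs => by
    have h := hasDerivAt_scaleFactor a₀ ℓ (hγ.mem_spacetime s hs)
    rw [← ha] at h
    rw [← geodesic_acceleration (hapos s hs).ne' (h.deriv ▸ h)]
    exact hγ.geodesic s hs
  have hnull : ∀ s ∈ Set.Icc (0 : ℝ) 1,
      v s 0 ^ 2 = a (γ s 0) ^ 2 * (v s 1 ^ 2 + v s 2 ^ 2 + v s 3 ^ 2) := fun s hs => by
    have := hγ.null s hs
    rw [metric_sum] at this
    linarith
  have hm0 : (0 : ℝ) ∈ Set.Icc (0 : ℝ) 1 := by simp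
  have hm1 : (1 : ℝ) ∈ Set.Icc (0 : ℝ) 1 := by simp
  -- The derivative of `a v⁰` is `a'` times the null form, hence zero.
  have hE := eq_of_hasDerivAt_zero (f := fun s => a (γ s 0) * v s 0) (fun s hs => by
    refine ((had s hs).mul (hasDerivAt_pi.1 (hvd s hs) 0)).congr_deriv ?_
    have := hnull s hs
    simp only [Matrix.cons_val_zero]
    linear_combination deriv a (γ s 0) * this)
  have hC : ∀ k : Fin 3, ∀ s ∈ Set.Icc (0 : ℝ) 1,
      a (γ s 0) ^ 2 * v s k.succ = a (γ 0 0) ^ 2 * v 0 k.succ := fun k => by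
    refine eq_of_hasDerivAt_zero (f := fun s => a (γ s 0) ^ 2 * v s k.succ) (fun s hs => ?_)
    refine (((had s hs).pow 2).mul (hasDerivAt_pi.1 (hvd s hs) k.succ)).congr_deriv ?_
    have := (hapos s hs).ne'
    fin_cases k <;> simp <;> field_simp <;> ring
  set e := a (γ 0 0) * v 0 0 with he
  -- If `e` vanished, so would `v⁰`, and the null condition would annihilate the whole velocity.
  have he0 : e ≠ 0 := by
    intro h
    have hv0 : v 0 0 = 0 := by
      rcases mul_eq_zero.1 h with h | h
      · exact absurd h (hapos 0 hm0).ne'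
      · exact h
    have h2 := hnull 0 hm0
    rw [hv0] at h2
    have h3 : v 0 1 ^ 2 + v 0 2 ^ 2 + v 0 3 ^ 2 = 0 := by
      have := pow_pos (hapos 0 hm0) 2
      rcases mul_eq_zero.1 (by linarith : a (γ 0 0) ^ 2 * (v 0 1 ^ 2 + v 0 2 ^ 2 + v 0 3 ^ 2) = 0)
        with h | h
      · exact absurd h this.ne'
      · exact h
    apply hγ.velocity_ne_zero 0 hm0
    funext i
    fin_cases i
    · exact hv0
    all_goals
      simp only [Pi.zero_apply]
      refine pow_eq_zero_iff two_ne_zero |>.1 ?_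
      simp only [Fin.reduceFinMk]
      nlinarith [sq_nonneg (v 0 1), sq_nonneg (v 0 2), sq_nonneg (v 0 3)]
  have hX : ∀ k : Fin 3, γ 1 k.succ - γ 0 k.succ =
      a (γ 0 0) ^ 2 * v 0 k.succ / e *
        (conformalTime a₀ ℓ (γ 1 0) - conformalTime a₀ ℓ (γ 0 0)) := fun k => by
    -- Conformal time grows at the rate `v⁰/a = e/a²` and `xᵏ` at the rate `const/a²`, so the two
    -- are affinely related.
    have := eq_of_hasDerivAt_zero (f := fun s => γ s k.succ -
      a (γ 0 0) ^ 2 * v 0 k.succ / e * conformalTime a₀ ℓ (γ s 0)) (fun s hs => by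
        refine ((hγd s hs k.succ).sub (((hasDerivAt_conformalTime ha₀ hℓ
          (hγ.mem_spacetime s hs)).comp s (hγd s hs 0)).const_mul _)).congr_deriv ?_
        have h1 := hC k s hs
        have h2 : a (γ s 0) * v s 0 = e := hE s hs
        have h3 := (hapos s hs).ne'
        rw [← ha, ← h1, ← h2]
        have h4 : v s 0 ≠ 0 := by
          intro h; rw [h, mul_zero] at h2; exact he0 h2.symm
        field_simp
        ring) 1 hm1
    linear_combination this
  rw [h0, h1] at hX
  rw [h0] at he
  have hx : ∀ k : Fin 3, x k - y k = a ε ^ 2 * v 0 k.succ / e *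
      (conformalTime a₀ ℓ t - conformalTime a₀ ℓ ε) := fun k => by
    have := hX k
    fin_cases k <;> simpa [event] using this
  have hpos : 0 < conformalTime a₀ ℓ t - conformalTime a₀ ℓ ε :=
    sub_pos.2 (conformalTime_lt ha₀ hℓ hε ht)
  have hn := hnull 0 hm0
  rw [h0] at hn
  have hsq : ‖x - y‖ ^ 2 = (conformalTime a₀ ℓ t - conformalTime a₀ ℓ ε) ^ 2 := by
    rw [EuclideanSpace.norm_sq_eq, Fin.sum_univ_three]
    simp only [PiLp.sub_apply, hx, Real.norm_eq_abs, sq_abs]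
    simp only [event, Matrix.cons_val_zero] at hn he
    simp only [Fin.succ_zero_eq_one, Fin.succ_one_eq_two, show Fin.succ (2 : Fin 3) = 3 from rfl]
    have he2 : e ^ 2 = a ε ^ 4 * (v 0 1 ^ 2 + v 0 2 ^ 2 + v 0 3 ^ 2) := by
      rw [he, mul_pow, hn]; ring
    field_simp
    linear_combination -he2
  exact (pow_left_inj₀ (norm_nonneg _) hpos.le two_ne_zero).1 hsq

/-- A null geodesic must satisfy `a(θ) θ' = e`. For a power law this says that `θ^(ℓ+1)` is affine
in the parameter, or `log θ` when `ℓ = -1`. -/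
lemma exists_affine_time {a₀ ℓ ε t : ℝ} (ha₀ : 0 < a₀) (hε : 0 < ε) (ht : ε < t) :
    ∃ (θ : ℝ → ℝ) (e : ℝ), e ≠ 0 ∧ θ 0 = ε ∧ θ 1 = t ∧ ∀ s ∈ Set.Icc (0 : ℝ) 1,
      0 < θ s ∧ HasDerivAt θ (e / scaleFactor a₀ ℓ (θ s)) s := by
  have ht0 : 0 < t := hε.trans ht
  by_cases hp : ℓ + 1 = 0
  · have hℓ : ℓ = -1 := by linarith
    subst hℓ
    have hlog : 0 < Real.log (t / ε) := Real.log_pos ((one_lt_div hε).2 ht)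
    refine ⟨fun s => ε * Real.exp (s * Real.log (t / ε)), a₀ * Real.log (t / ε),
      (mul_pos ha₀ hlog).ne', by simp, ?_, fun s _ => ⟨by positivity, ?_⟩⟩
    · simp only [one_mul]
      rw [Real.exp_log (by positivity)]
      field_simp
    · have h := (((hasDerivAt_id s).mul_const (Real.log (t / ε))).exp).const_mul ε
      refine h.congr_deriv ?_
      have : 0 < ε * Real.exp (s * Real.log (t / ε)) := by positivity
      rw [scaleFactor, Real.rpow_neg_one]
      simp only [id, one_mul]
      field_simp
  · set p := ℓ + 1 with hpdef
    have hεp := Real.rpow_pos_of_pos hε p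
    have htp := Real.rpow_pos_of_pos ht0 p
    have hne : t ^ p - ε ^ p ≠ 0 := by
      intro h
      have h2 : t = ε := (Real.rpow_left_inj ht0.le hε.le hp).1 (by linarith)
      exact ht.ne' h2
    have hB : ∀ s ∈ Set.Icc (0 : ℝ) 1, 0 < ε ^ p + s * (t ^ p - ε ^ p) := by
      intro s hs
      rcases hs.1.eq_or_lt with h | h
      · simp [← h, hεp]
      · nlinarith [mul_pos h htp, mul_nonneg (sub_nonneg.2 hs.2) hεp.le]
    refine ⟨fun s => (ε ^ p + s * (t ^ p - ε ^ p)) ^ (1 / p), a₀ * (t ^ p - ε ^ p) / p,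
      div_ne_zero (mul_ne_zero ha₀.ne' hne) hp, ?_, ?_, fun s hs => ⟨?_, ?_⟩⟩
    · simp only [zero_mul, add_zero]
      rw [← Real.rpow_mul hε.le, mul_one_div_cancel hp, Real.rpow_one]
    · simp only [one_mul, add_sub_cancel]
      rw [← Real.rpow_mul ht0.le, mul_one_div_cancel hp, Real.rpow_one]
    · exact Real.rpow_pos_of_pos (hB s hs) _
    · have h0 := hB s hs
      have h := (((hasDerivAt_id s).mul_const (t ^ p - ε ^ p)).const_add (ε ^ p)).rpow_const
        (p := 1 / p) (Or.inl h0.ne')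
      refine h.congr_deriv ?_
      simp only [id, one_mul]
      rw [scaleFactor, ← Real.rpow_mul h0.le]
      have : 1 / p - 1 = -(1 / p * ℓ) := by
        field_simp; rw [hpdef]; ring
      rw [this, Real.rpow_neg h0.le]
      have := (Real.rpow_pos_of_pos h0 (1 / p * ℓ)).ne'
      field_simp

/-- The geodesic runs along the straight segment from `y` to `x`, with elapsed conformal time as arc
length and the affine parameter of `exists_affine_time`. -/
lemma nullReachable_of_norm_sub_eq {a₀ ℓ ε t : ℝ} (ha₀ : 0 < a₀) (hℓ : ℓ ≠ 1) (hε : 0 < ε)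
    (ht : ε < t) {x y : Space}
    (h : ‖x - y‖ = conformalTime a₀ ℓ t - conformalTime a₀ ℓ ε) :
    NullReachable (metric (scaleFactor a₀ ℓ)) (event ε y) (event t x) := by
  obtain ⟨θ, e, he, hθ0, hθ1, hθ⟩ := exists_affine_time (ℓ := ℓ) ha₀ hε ht
  set a := scaleFactor a₀ ℓ with ha
  set D := conformalTime a₀ ℓ t - conformalTime a₀ ℓ ε with hD
  have hDpos : 0 < D := sub_pos.2 (conformalTime_lt ha₀ hℓ hε ht)
  set n : Fin 3 → ℝ := fun k => (x k - y k) / D with hn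
  have hn1 : n 0 ^ 2 + n 1 ^ 2 + n 2 ^ 2 = 1 := by
    have : ‖x - y‖ ^ 2 = D ^ 2 := by rw [h]
    rw [EuclideanSpace.norm_sq_eq, Fin.sum_univ_three] at this
    simp only [PiLp.sub_apply, Real.norm_eq_abs, sq_abs] at this
    simp only [hn]
    field_simp
    linarith
  set c := fun s => conformalTime a₀ ℓ (θ s) - conformalTime a₀ ℓ ε with hc
  refine ⟨fun s => ![θ s, y 0 + c s * n 0, y 1 + c s * n 1, y 2 + c s * n 2],
    fun s => ![e / a (θ s), e / a (θ s) ^ 2 * n 0, e / a (θ s) ^ 2 * n 1, e / a (θ s) ^ 2 * n 2],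
    ⟨fun s hs => (hθ s hs).1, fun s hs => ?_, fun s hs => ?_, fun s hs => ?_, fun s hs => ?_⟩,
    ?_, ?_⟩
  · have hap : a (θ s) ≠ 0 := (scaleFactor_pos ha₀ (hθ s hs).1).ne'
    have hcd : HasDerivAt c (e / a (θ s) ^ 2) s := by
      refine (((hasDerivAt_conformalTime ha₀ hℓ (hθ s hs).1).comp s (hθ s hs).2).sub_const
        _).congr_deriv ?_
      rw [← ha]
      field_simp
    refine hasDerivAt_pi.2 fun i => ?_
    fin_cases i
    · exact (hθ s hs).2
    · exact (hcd.mul_const (n 0)).const_add (y 0)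
    · exact (hcd.mul_const (n 1)).const_add (y 1)
    · exact (hcd.mul_const (n 2)).const_add (y 2)
  · have hap : a (θ s) ≠ 0 := (scaleFactor_pos ha₀ (hθ s hs).1).ne'
    have h1 := hasDerivAt_scaleFactor a₀ ℓ (hθ s hs).1
    rw [← ha] at h1
    have h2 : HasDerivAt (fun u => a (θ u)) (ℓ * a (θ s) / θ s * (e / a (θ s))) s :=
      h1.comp s (hθ s hs).2
    rw [geodesic_acceleration (a' := ℓ * a (θ s) / θ s) hap h1]
    have hv : ∀ k, HasDerivAt (fun s => e / a (θ s) ^ 2 * n k)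
        (-(2 * (ℓ * a (θ s) / θ s / a (θ s)) * (e / a (θ s)) * (e / a (θ s) ^ 2 * n k))) s := by
      intro k
      refine (((hasDerivAt_const s e).div (h2.fun_pow 2) (pow_ne_zero 2 hap)).mul_const
        (n k)).congr_deriv ?_
      have := (hθ s hs).1.ne'
      field_simp
      ring
    refine hasDerivAt_pi.2 fun i => ?_
    fin_cases i
    · refine ((hasDerivAt_const s e).div h2 hap).congr_deriv ?_
      simp only [Matrix.cons_val]
      have := (hθ s hs).1.ne'
      have h3 : (e / a (θ s) ^ 2 * n 0) ^ 2 + (e / a (θ s) ^ 2 * n 1) ^ 2 +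
        (e / a (θ s) ^ 2 * n 2) ^ 2 = (e / a (θ s) ^ 2) ^ 2 := by
          linear_combination (e / a (θ s) ^ 2) ^ 2 * hn1
      simp only [Fin.zero_eta, Matrix.cons_val_zero, h3]
      field_simp
      ring
    · exact hv 0
    · exact hv 1
    · exact hv 2
  · intro h0
    have hap : a (θ s) ≠ 0 := (scaleFactor_pos ha₀ (hθ s hs).1).ne'
    have := congrFun h0 0
    simp only [Matrix.cons_val_zero, Pi.zero_apply] at this
    exact div_ne_zero he hap this
  · have hap : a (θ s) ≠ 0 := (scaleFactor_pos ha₀ (hθ s hs).1).ne'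
    rw [metric_sum]
    simp only [Matrix.cons_val]
    field_simp
    linear_combination (-e ^ 2) * hn1
  · have hc0 : c 0 = 0 := by simp [hc, hθ0]
    simp [event, hθ0, hc0]
  · have hc1 : c 1 = D := by simp [hc, hθ1, hD]
    simp only [event, hθ1, hc1, hn]
    have : ∀ k, y k + D * ((x k - y k) / D) = x k := fun k => by field_simp; ring
    simp [this]

end FLRW

/-! ### Integral identities for solutions in conformal time -/

namespace FLRW

open MeasureTheory Set Filter Topology Matrix

/-! ### Conservation laws for compactly supported densities -/

lemma isOpen_slab (a b : ℝ) : IsOpen ((univ : Set Space) ×ˢ Ioo a b) := isOpen_univ.prod isOpen_Ioo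

lemma hasFDerivAt_of_slab {F : Type*} [NormedAddCommGroup F] [NormedSpace ℝ F]
    {a b : ℝ} {f : Space × ℝ → F} (hf : ContDiffOn ℝ 1 f (univ ×ˢ Ioo a b)) {x : Space} {τ : ℝ}
    (hτ : τ ∈ Ioo a b) : HasFDerivAt f (fderiv ℝ f (x, τ)) (x, τ) :=
  ((hf.differentiableOn one_ne_zero).differentiableAt
    ((isOpen_slab a b).mem_nhds ⟨mem_univ _, hτ⟩)).hasFDerivAt

lemma continuous_slice {F : Type*} [TopologicalSpace F] {s : Set ℝ} {f : Space × ℝ → F}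
    (hf : ContinuousOn f (univ ×ˢ s)) {τ : ℝ} (hτ : τ ∈ s) : Continuous fun x => f (x, τ) := by
  rw [← continuousOn_univ]
  exact hf.comp (by fun_prop) fun x _ => ⟨mem_univ _, hτ⟩

lemma hasCompactSupport_of_norm {F : Type*} [Zero F] {R : ℝ} {f : Space → F}
    (h : ∀ x, R < ‖x‖ → f x = 0) : HasCompactSupport f :=
  HasCompactSupport.intro (isCompact_closedBall (0 : Space) R) fun x hx =>
    h x (by simpa using hx)

lemma fderiv_eq_zero_of_slab {a b R : ℝ} {f : Space × ℝ → ℂ}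
    (hf0 : ∀ x, ∀ τ ∈ Ioo a b, R < ‖x‖ → f (x, τ) = 0) {x : Space} {τ : ℝ} (hτ : τ ∈ Ioo a b)
    (hx : R < ‖x‖) : fderiv ℝ f (x, τ) = 0 := by
  have hopen : IsOpen ({y : Space | R < ‖y‖} ×ˢ Ioo a b) :=
    (isOpen_lt continuous_const continuous_norm).prod isOpen_Ioo
  have : f =ᶠ[𝓝 (x, τ)] fun _ => (0 : ℂ) := by
    filter_upwards [hopen.mem_nhds (Set.mk_mem_prod hx hτ)] with p hp
    exact hf0 p.1 p.2 hp.2 hp.1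
  rw [this.fderiv_eq]
  simp

lemma integrable_fderiv_slab {a b R : ℝ} {f : Space × ℝ → ℂ}
    (hf : ContDiffOn ℝ 1 f (univ ×ˢ Ioo a b))
    (hf0 : ∀ x, ∀ τ ∈ Ioo a b, R < ‖x‖ → f (x, τ) = 0) {τ : ℝ} (hτ : τ ∈ Ioo a b)
    (w : Space × ℝ) : Integrable fun x => fderiv ℝ f (x, τ) w := by
  have hc : Continuous fun x => fderiv ℝ f (x, τ) w :=
    (continuous_slice (hf.continuousOn_fderiv_of_isOpen (isOpen_slab a b) le_rfl) hτ).clm_apply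
      continuous_const
  refine hc.integrable_of_hasCompactSupport (hasCompactSupport_of_norm (R := R) fun x hx => ?_)
  rw [fderiv_eq_zero_of_slab hf0 hτ hx]
  simp

lemma integral_spaceDeriv_eq_zero {a b R : ℝ} {f : Space × ℝ → ℂ}
    (hf : ContDiffOn ℝ 1 f (univ ×ˢ Ioo a b))
    (hf0 : ∀ x, ∀ τ ∈ Ioo a b, R < ‖x‖ → f (x, τ) = 0) {τ : ℝ} (hτ : τ ∈ Ioo a b) (w : Space) :
    ∫ x, fderiv ℝ f (x, τ) (w, 0) = 0 := by
  have hd : ∀ x, HasFDerivAt (fun y => f (y, τ))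
      ((fderiv ℝ f (x, τ)).comp (ContinuousLinearMap.inl ℝ Space ℝ)) x := fun x => by
    have h1 : HasFDerivAt (fun y : Space => (y, τ)) (ContinuousLinearMap.inl ℝ Space ℝ) x :=
      hasFDerivAt_prodMk_left x τ
    exact (hasFDerivAt_of_slab hf hτ).comp x h1
  have hi := integrable_fderiv_slab hf hf0 hτ (w, 0)
  have hfi : Integrable fun x => f (x, τ) :=
    (continuous_slice hf.continuousOn hτ).integrable_of_hasCompactSupport
      (hasCompactSupport_of_norm (R := R) fun x hx => hf0 x τ hτ hx)
  have key := integral_mul_fderiv_eq_neg_fderiv_mul_of_integrable (μ := (volume : Measure Space))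
    (f := fun _ : Space => (1 : ℂ)) (g := fun y => f (y, τ)) (v := w) (by simp)
    (by simpa [(hd _).fderiv] using hi) (by simpa using hfi) (fun _ _ => differentiableAt_const _)
    (fun x _ => (hd x).differentiableAt)
  simpa [(hd _).fderiv] using key

/-- The time derivative of the integral of a density `f` may be corrected by the divergence of a
compactly supported current `g`. -/
lemma hasDerivAt_integral_of_current {a b R : ℝ} {f : Space × ℝ → ℂ} {g : Fin 3 → Space × ℝ → ℂ}
    (hf : ContDiffOn ℝ 1 f (univ ×ˢ Ioo a b)) (hg : ∀ j, ContDiffOn ℝ 1 (g j) (univ ×ˢ Ioo a b))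
    (hf0 : ∀ x, ∀ τ ∈ Ioo a b, R < ‖x‖ → f (x, τ) = 0)
    (hg0 : ∀ j x, ∀ τ ∈ Ioo a b, R < ‖x‖ → g j (x, τ) = 0) {τ : ℝ} (hτ : τ ∈ Ioo a b) :
    HasDerivAt (fun s => ∫ x, f (x, s))
      (∫ x, (fderiv ℝ f (x, τ) (0, 1) +
        ∑ j, fderiv ℝ (g j) (x, τ) (EuclideanSpace.single j 1, 0))) τ := by
  have hsum : ∫ x, (fderiv ℝ f (x, τ) (0, 1) +
      ∑ j, fderiv ℝ (g j) (x, τ) (EuclideanSpace.single j 1, 0)) =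
      ∫ x, fderiv ℝ f (x, τ) (0, 1) := by
    rw [integral_add (integrable_fderiv_slab hf hf0 hτ _)
      (integrable_finsetSum _ fun j _ => integrable_fderiv_slab (hg j) (hg0 j) hτ _),
      integral_finsetSum _ fun j _ => integrable_fderiv_slab (hg j) (hg0 j) hτ _]
    simp [integral_spaceDeriv_eq_zero (hg _) (hg0 _) hτ]
  rw [hsum]
  -- Domination: on a compact time window the derivative is bounded on the ball of radius `R` and
  -- vanishes outside it.
  obtain ⟨r, hr, hrI⟩ := Metric.nhds_basis_closedBall.mem_iff.1 (isOpen_Ioo.mem_nhds hτ)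
  have hcont : ContinuousOn (fun p => fderiv ℝ f p (0, 1)) (univ ×ˢ Ioo a b) :=
    (hf.continuousOn_fderiv_of_isOpen (isOpen_slab a b) le_rfl).clm_apply continuousOn_const
  obtain ⟨M, hM⟩ := ((isCompact_closedBall (0 : Space) R).prod
    (isCompact_closedBall τ r)).exists_bound_of_continuousOn
    (hcont.mono (prod_mono (subset_univ _) hrI))
  refine (hasDerivAt_integral_of_dominated_loc_of_deriv_le (μ := (volume : Measure Space))
    (F := fun s x => f (x, s)) (F' := fun s x => fderiv ℝ f (x, s) (0, 1))
    (bound := (Metric.closedBall (0 : Space) R).indicator fun _ => M)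
    (Metric.closedBall_mem_nhds τ hr) ?_ ?_ ?_ ?_ ?_ ?_).2
  · filter_upwards [isOpen_Ioo.mem_nhds hτ] with s hs
    exact (continuous_slice hf.continuousOn hs).aestronglyMeasurable
  · exact (continuous_slice hf.continuousOn hτ).integrable_of_hasCompactSupport
      (hasCompactSupport_of_norm (R := R) fun x hx => hf0 x τ hτ hx)
  · exact (continuous_slice hcont hτ).aestronglyMeasurable
  · refine Eventually.of_forall fun x s hs => ?_
    by_cases hx : ‖x‖ ≤ R
    · have hx' : x ∈ Metric.closedBall (0 : Space) R := by simpa using hx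
      rw [indicator_of_mem hx']
      exact hM (x, s) ⟨hx', hs⟩
    · have hx' : x ∉ Metric.closedBall (0 : Space) R := by simpa using hx
      rw [indicator_of_notMem hx', fderiv_eq_zero_of_slab hf0 (hrI hs) (not_le.1 hx)]
      simp
  · exact (integrable_indicator_iff Metric.isClosed_closedBall.measurableSet).2
      (integrableOn_const (by exact measure_closedBall_lt_top.ne))
  · refine Eventually.of_forall fun x s hs => ?_
    have h1 : HasDerivAt (fun u : ℝ => (x, u)) ((0 : Space), (1 : ℝ)) s :=
      (hasDerivAt_const s x).prodMk (hasDerivAt_id s)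
    exact (hasFDerivAt_of_slab hf (hrI hs)).comp_hasDerivAt s h1

/-- Integrals of densities that are continuous up to the boundary are continuous in time. -/
lemma continuousOn_integral_slab {a b R : ℝ} {f : Space × ℝ → ℂ}
    (hf : ContinuousOn f (univ ×ˢ Icc a b))
    (hf0 : ∀ x, ∀ τ ∈ Icc a b, R < ‖x‖ → f (x, τ) = 0) :
    ContinuousOn (fun s => ∫ x, f (x, s)) (Icc a b) := by
  obtain ⟨M, hM⟩ := ((isCompact_closedBall (0 : Space) R).prod
    (isCompact_Icc (a := a) (b := b))).exists_bound_of_continuousOn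
    (hf.mono (prod_mono (subset_univ _) subset_rfl))
  refine continuousOn_of_dominated (bound := (Metric.closedBall (0 : Space) R).indicator
    fun _ => M) (fun s hs => (continuous_slice hf hs).aestronglyMeasurable)
    (fun s hs => Eventually.of_forall fun x => ?_) ?_ (Eventually.of_forall fun x => ?_)
  · by_cases hx : ‖x‖ ≤ R
    · have hx' : x ∈ Metric.closedBall (0 : Space) R := by simpa using hx
      rw [indicator_of_mem hx']
      exact hM (x, s) ⟨hx', hs⟩
    · have hx' : x ∉ Metric.closedBall (0 : Space) R := by simpa using hx
      rw [indicator_of_notMem hx', hf0 x s hs (not_le.1 hx)]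
      simp
  · exact (integrable_indicator_iff Metric.isClosed_closedBall.measurableSet).2
      (integrableOn_const (by exact measure_closedBall_lt_top.ne))
  · exact hf.comp (by fun_prop) fun s hs => ⟨mem_univ _, hs⟩

end FLRW

namespace FLRW

open MeasureTheory Set Filter Topology Matrix

/-! ### The Dirac equation in conformal time -/

/-- Solutions on `[τ₀, τ₁]` of the Dirac equation in conformal time,
`∂_τ ψ + ∑ⱼ αⱼ ∂ⱼ ψ = (ν / τ) γ⁰ ψ`. -/
structure IsConformalSolution (ν : ℂ) (τ₀ τ₁ : ℝ) (ψ : Space × ℝ → Spinor) : Prop where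
  continuousOn : ContinuousOn ψ (univ ×ˢ Icc τ₀ τ₁)
  contDiffOn : ContDiffOn ℝ 1 ψ (univ ×ˢ Ioo τ₀ τ₁)
  dirac : ∀ x, ∀ τ ∈ Ioo τ₀ τ₁, timeDeriv ψ (x, τ) + ∑ j, alpha j *ᵥ spaceDeriv j ψ (x, τ) =
    (ν / τ) • (gamma 0 *ᵥ ψ (x, τ))

/-- The `i`-th row of a matrix, as a real-linear functional on spinors. -/
def rowCLM (A : Matrix (Fin 4) (Fin 4) ℂ) (i : Fin 4) : Spinor →L[ℝ] ℂ :=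
  LinearMap.toContinuousLinearMap
    (((LinearMap.proj (R := ℂ) (φ := fun _ : Fin 4 => ℂ) i).comp A.mulVecLin).restrictScalars ℝ)

@[simp]
lemma rowCLM_apply (A : Matrix (Fin 4) (Fin 4) ℂ) (i : Fin 4) (v : Spinor) :
    rowCLM A i v = (A *ᵥ v) i := rfl

/-- A function on `ℝ³ × ℝ` with spatial gradient `fr • x` and time derivative `ft`. -/
def HasRadialDerivAt (f : Space × ℝ → ℝ) (fr ft : ℝ) (p : Space × ℝ) : Prop :=
  HasFDerivAt f (fr • (innerSL ℝ p.1).comp (ContinuousLinearMap.fst ℝ Space ℝ) +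
    ft • ContinuousLinearMap.snd ℝ Space ℝ) p

lemma HasRadialDerivAt.fderiv_space {f : Space × ℝ → ℝ} {fr ft : ℝ} {p : Space × ℝ}
    (h : HasRadialDerivAt f fr ft p) (k : Fin 3) :
    fderiv ℝ f p (EuclideanSpace.single k 1, 0) = fr * p.1 k := by
  rw [HasFDerivAt.fderiv h]
  simp [EuclideanSpace.inner_single_right]

lemma HasRadialDerivAt.fderiv_time {f : Space × ℝ → ℝ} {fr ft : ℝ} {p : Space × ℝ}
    (h : HasRadialDerivAt f fr ft p) : fderiv ℝ f p (0, 1) = ft := by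
  rw [HasFDerivAt.fderiv h]
  simp

/-- The matrix `∑ⱼ xⱼ αⱼ` applied to a spinor. -/
def xAlpha (x : Space) (v : Spinor) : Spinor := ∑ j, x j • (alpha j *ᵥ v)

lemma xAlpha_apply (x : Space) (v : Spinor) (i : Fin 4) :
    xAlpha x v i = ∑ j, x j • rowCLM (alpha j) i v := by
  simp [xAlpha]

/-- The density `A ψᵢ + L (∑ⱼ xⱼ αⱼ ψ)ᵢ`. -/
def pairDensity (ψ : Space × ℝ → Spinor) (i : Fin 4) (A L : Space × ℝ → ℝ) (p : Space × ℝ) : ℂ :=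
  A p • ψ p i + L p • xAlpha p.1 (ψ p) i

/-- The current belonging to `pairDensity`. -/
def pairCurrent (ψ : Space × ℝ → Spinor) (i : Fin 4) (A L : Space × ℝ → ℝ) (k : Fin 3)
    (p : Space × ℝ) : ℂ :=
  A p • rowCLM (alpha k) i (ψ p) + L p • ∑ j, p.1 j • rowCLM (alpha j * alpha k) i (ψ p)

lemma contDiffOn_row {n : WithTop ℕ∞} {s : Set (Space × ℝ)} {ψ : Space × ℝ → Spinor}
    (hψ : ContDiffOn ℝ n ψ s) (M : Matrix (Fin 4) (Fin 4) ℂ) (i : Fin 4) :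
    ContDiffOn ℝ n (fun p => rowCLM M i (ψ p)) s :=
  (rowCLM M i).contDiff.comp_contDiffOn hψ

lemma contDiff_coord {n : WithTop ℕ∞} (j : Fin 3) :
    ContDiff ℝ n fun p : Space × ℝ => p.1 j :=
  (EuclideanSpace.proj (𝕜 := ℝ) j).contDiff.comp contDiff_fst

lemma hasFDerivAt_coord (j : Fin 3) (p : Space × ℝ) :
    HasFDerivAt (fun p : Space × ℝ => p.1 j) ((EuclideanSpace.proj (𝕜 := ℝ) j).comp
      (ContinuousLinearMap.fst ℝ Space ℝ)) p :=
  ((EuclideanSpace.proj (𝕜 := ℝ) j).comp (ContinuousLinearMap.fst ℝ Space ℝ)).hasFDerivAt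

lemma pairDensity_eq (ψ : Space × ℝ → Spinor) (i : Fin 4) (A L : Space × ℝ → ℝ) :
    pairDensity ψ i A L = fun p => A p • rowCLM 1 i (ψ p) +
      L p • ∑ j, p.1 j • rowCLM (alpha j * 1) i (ψ p) := by
  funext p
  simp [pairDensity, xAlpha_apply]

lemma contDiffOn_pair {s : Set (Space × ℝ)} {ψ : Space × ℝ → Spinor} {A L : Space × ℝ → ℝ}
    (hψ : ContDiffOn ℝ 1 ψ s) (hA : ContDiffOn ℝ 1 A s) (hL : ContDiffOn ℝ 1 L s)
    (M : Matrix (Fin 4) (Fin 4) ℂ) (i : Fin 4) :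
    ContDiffOn ℝ 1 (fun p => A p • rowCLM M i (ψ p) +
      L p • ∑ j, p.1 j • rowCLM (alpha j * M) i (ψ p)) s :=
  (hA.smul (contDiffOn_row hψ M i)).add (hL.smul (ContDiffOn.sum fun j _ =>
    (contDiff_coord j).contDiffOn.smul (contDiffOn_row hψ _ i)))

lemma fderiv_pair {ψ : Space × ℝ → Spinor} {A L : Space × ℝ → ℝ} {p : Space × ℝ}
    (hψ : DifferentiableAt ℝ ψ p) (hA : DifferentiableAt ℝ A p) (hL : DifferentiableAt ℝ L p)
    (M : Matrix (Fin 4) (Fin 4) ℂ) (i : Fin 4) (w : Space × ℝ) :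
    fderiv ℝ (fun p => A p • rowCLM M i (ψ p) +
      L p • ∑ j, p.1 j • rowCLM (alpha j * M) i (ψ p)) p w =
      A p • rowCLM M i (fderiv ℝ ψ p w) + fderiv ℝ A p w • rowCLM M i (ψ p) +
      (L p • ∑ j, (p.1 j • rowCLM (alpha j * M) i (fderiv ℝ ψ p w) +
        w.1 j • rowCLM (alpha j * M) i (ψ p)) +
      fderiv ℝ L p w • ∑ j, p.1 j • rowCLM (alpha j * M) i (ψ p)) := by
  have hr : ∀ N : Matrix (Fin 4) (Fin 4) ℂ, HasFDerivAt (fun p => rowCLM N i (ψ p))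
      ((rowCLM N i).comp (fderiv ℝ ψ p)) p := fun N =>
    (rowCLM N i).hasFDerivAt.comp p hψ.hasFDerivAt
  have h := (hA.hasFDerivAt.smul (hr M)).add (hL.hasFDerivAt.smul
    (HasFDerivAt.fun_sum (u := Finset.univ) fun j _ =>
      (hasFDerivAt_coord j p).smul (hr (alpha j * M))))
  have h' : fderiv ℝ (fun p => A p • rowCLM M i (ψ p) +
      L p • ∑ j, p.1 j • rowCLM (alpha j * M) i (ψ p)) p = _ := h.fderiv
  rw [h']
  simp

/-- Contracting the equation with `A eᵢ + L eᵢ ∑ xⱼ αⱼ` and adding the divergence of `pairCurrent`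
removes all derivatives of `ψ`. The terms `3 L` and `‖x‖² Lr` come from `αⱼ² = 1`, the mixed
products cancel by anticommutation, and the mass term in front of `L` changes sign because `γ⁰`
anticommutes with `αⱼ`. The alternative in `h0` covers both uses: weights concentrated near a cone,
and polynomial weights against compactly supported `ψ`. -/
lemma hasDerivAt_integral_pairDensity {ν : ℂ} {τ₀ τ₁ R : ℝ} {ψ : Space × ℝ → Spinor}
    (hψ : IsConformalSolution ν τ₀ τ₁ ψ) (i : Fin 4) {A Ar At L Lr Lt : Space × ℝ → ℝ}
    (hA : ContDiffOn ℝ 1 A (univ ×ˢ Ioo τ₀ τ₁)) (hL : ContDiffOn ℝ 1 L (univ ×ˢ Ioo τ₀ τ₁))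
    (hA' : ∀ x, ∀ τ ∈ Ioo τ₀ τ₁, HasRadialDerivAt A (Ar (x, τ)) (At (x, τ)) (x, τ))
    (hL' : ∀ x, ∀ τ ∈ Ioo τ₀ τ₁, HasRadialDerivAt L (Lr (x, τ)) (Lt (x, τ)) (x, τ))
    (h0 : ∀ x, ∀ τ ∈ Ioo τ₀ τ₁, R < ‖x‖ → ψ (x, τ) = 0 ∨ A (x, τ) = 0 ∧ L (x, τ) = 0)
    {τ : ℝ} (hτ : τ ∈ Ioo τ₀ τ₁) :
    HasDerivAt (fun s => ∫ x, pairDensity ψ i A L (x, s))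
      (∫ x, (((At (x, τ) + 3 * L (x, τ) + ‖x‖ ^ 2 * Lr (x, τ) : ℝ) +
          sgn i * ν / τ * A (x, τ)) * ψ (x, τ) i +
        ((Lt (x, τ) + Ar (x, τ) : ℝ) - sgn i * ν / τ * L (x, τ)) * xAlpha x (ψ (x, τ)) i)) τ := by
  have key := hasDerivAt_integral_of_current (R := R) (f := pairDensity ψ i A L)
    (g := pairCurrent ψ i A L) (a := τ₀) (b := τ₁)
    (by rw [pairDensity_eq]; exact contDiffOn_pair hψ.contDiffOn hA hL 1 i)
    (fun k => contDiffOn_pair hψ.contDiffOn hA hL (alpha k) i)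
    (fun x s hs hx => by
      rcases h0 x s hs hx with h | h
      · simp [pairDensity, xAlpha, h]
      · simp [pairDensity, h.1, h.2])
    (fun k x s hs hx => by
      rcases h0 x s hs hx with h | h
      · simp [pairCurrent, h]
      · simp [pairCurrent, h.1, h.2]) hτ
  refine key.congr_deriv (integral_congr_ae (Eventually.of_forall fun x => ?_))
  have hψd : DifferentiableAt ℝ ψ (x, τ) := (hasFDerivAt_of_slab hψ.contDiffOn hτ).differentiableAt
  have hAd := (hA' x τ hτ).differentiableAt
  have hLd := (hL' x τ hτ).differentiableAt
  simp only
  rw [pairDensity_eq, fderiv_pair hψd hAd hLd 1 i]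
  have hc : ∀ k, fderiv ℝ (pairCurrent ψ i A L k) (x, τ) (EuclideanSpace.single k 1, 0) = _ :=
    fun k => fderiv_pair hψd hAd hLd (alpha k) i (EuclideanSpace.single k 1, 0)
  simp only [hc, (hA' x τ hτ).fderiv_space, (hA' x τ hτ).fderiv_time, (hL' x τ hτ).fderiv_space,
    (hL' x τ hτ).fderiv_time]
  have hD := hψ.dirac x τ hτ
  simp only [timeDeriv, spaceDeriv] at hD
  set v := ψ (x, τ) with hv
  set D := fderiv ℝ ψ (x, τ) with hDdef
  have e0 : D (0, 1) i + ∑ k, (alpha k *ᵥ D (EuclideanSpace.single k 1, 0)) i =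
      sgn i * ν / τ * v i := by
    have := congrFun hD i
    simp only [Pi.add_apply, Finset.sum_apply, Pi.smul_apply, gamma_zero_mulVec,
      smul_eq_mul] at this
    rw [this]; ring
  have ej : ∀ j, (alpha j *ᵥ D (0, 1)) i +
      ∑ k, ((alpha j * alpha k) *ᵥ D (EuclideanSpace.single k 1, 0)) i =
      -(sgn i * ν / τ) * (alpha j *ᵥ v) i := fun j => by
    have := congrArg (fun u => (alpha j *ᵥ u) i) hD
    simp only [Matrix.mulVec_add, Matrix.mulVec_sum, Matrix.mulVec_smul, Matrix.mulVec_mulVec,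
      alpha_mul_gamma_zero, Matrix.neg_mulVec, Pi.add_apply, Finset.sum_apply, Pi.smul_apply,
      Pi.neg_apply, smul_eq_mul] at this
    rw [this, ← Matrix.mulVec_mulVec, gamma_zero_mulVec]; ring
  have hx2 : ((‖x‖ ^ 2 : ℝ) : ℂ) = (x 0 : ℂ) ^ 2 + (x 1 : ℂ) ^ 2 + (x 2 : ℂ) ^ 2 := by
    rw [EuclideanSpace.norm_sq_eq, Fin.sum_univ_three]
    simp
  have e1 := ej 0
  have e2 := ej 1
  have e3 := ej 2
  have c01 : ((alpha 1 * alpha 0) *ᵥ v) i = -((alpha 0 * alpha 1) *ᵥ v) i := by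
    rw [alpha_mul_alpha (by decide), Matrix.neg_mulVec, Pi.neg_apply]
  have c02 : ((alpha 2 * alpha 0) *ᵥ v) i = -((alpha 0 * alpha 2) *ᵥ v) i := by
    rw [alpha_mul_alpha (by decide), Matrix.neg_mulVec, Pi.neg_apply]
  have c12 : ((alpha 2 * alpha 1) *ᵥ v) i = -((alpha 1 * alpha 2) *ᵥ v) i := by
    rw [alpha_mul_alpha (by decide), Matrix.neg_mulVec, Pi.neg_apply]
  simp only [Fin.sum_univ_three, alpha_mul_self] at e0 e1 e2 e3
  push_cast
  rw [show ((‖x‖ : ℂ)) ^ 2 = ((‖x‖ ^ 2 : ℝ) : ℂ) by push_cast; rfl, hx2]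
  simp only [xAlpha_apply, Fin.sum_univ_three, rowCLM_apply, Complex.real_smul, alpha_mul_self,
    mul_one, Matrix.one_mulVec, c01, c02, c12, PiLp.zero_apply]
  simp
  simp only [Matrix.one_mulVec] at e1 e2 e3
  linear_combination (A (x, τ) : ℂ) * e0 + (L (x, τ) : ℂ) * ((x 0 : ℂ) * e1 + (x 1 : ℂ) * e2 +
    (x 2 : ℂ) * e3)

end FLRW

namespace FLRW

open MeasureTheory Set Filter Topology Matrix

/-- The equation is imposed on the open interval only, so constancy reaches the endpoints through
continuity. -/
lemma eqOn_Icc_of_hasDerivAt_zero {E : Type*} [NormedAddCommGroup E] [NormedSpace ℝ E]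
    {a b : ℝ} (hab : a < b) {F : ℝ → E} (hc : ContinuousOn F (Icc a b))
    (hd : ∀ s ∈ Ioo a b, HasDerivAt F 0 s) : F b = F a := by
  have hm : (a + b) / 2 ∈ Ioo a b := ⟨by linarith, by linarith⟩
  have h1 : EqOn F (fun _ => F ((a + b) / 2)) (Ioo a b) := fun s hs => by
    have := (convex_Ioo a b).norm_image_sub_le_of_norm_hasDerivWithin_le (C := 0)
      (fun u hu => (hd u hu).hasDerivWithinAt) (by simp) hm hs
    simpa [sub_eq_zero] using this
  have h2 : EqOn F (fun _ => F ((a + b) / 2)) (Icc a b) :=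
    h1.of_subset_closure hc continuousOn_const Ioo_subset_Icc_self (by rw [closure_Ioo hab.ne])
  rw [h2 (right_mem_Icc.2 hab.le), h2 (left_mem_Icc.2 hab.le)]

/-! ### The energy estimate -/

/-- The density `|ψ|²`. -/
def energyDensity (ψ : Space × ℝ → Spinor) (p : Space × ℝ) : ℝ := ∑ i, ‖ψ p i‖ ^ 2

lemma continuous_energy : Continuous fun v : Spinor => ∑ i, ‖v i‖ ^ 2 := by fun_prop

lemma dotProduct_alpha (k : Fin 3) (v w : Spinor) :
    star v ⬝ᵥ (alpha k *ᵥ w) = star (alpha k *ᵥ v) ⬝ᵥ w := by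
  rw [Matrix.star_mulVec, alpha_conjTranspose, Matrix.dotProduct_mulVec]

/-- The sesquilinear form `v ↦ conj (vᵢ) (M v)ᵢ` has the expected derivative. -/
lemma fderiv_sesq {ψ : Space × ℝ → Spinor} {p : Space × ℝ}
    (hψ : DifferentiableAt ℝ ψ p) (M : Matrix (Fin 4) (Fin 4) ℂ) (w : Space × ℝ) :
    fderiv ℝ (fun p => ∑ i, starRingEnd ℂ (rowCLM 1 i (ψ p)) * rowCLM M i (ψ p)) p w =
      star (ψ p) ⬝ᵥ (M *ᵥ fderiv ℝ ψ p w) + star (fderiv ℝ ψ p w) ⬝ᵥ (M *ᵥ ψ p) := by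
  have hr : ∀ (N : Matrix (Fin 4) (Fin 4) ℂ) i, HasFDerivAt (fun p => rowCLM N i (ψ p))
      ((rowCLM N i).comp (fderiv ℝ ψ p)) p := fun N i =>
    (rowCLM N i).hasFDerivAt.comp p hψ.hasFDerivAt
  have h := HasFDerivAt.fun_sum (u := Finset.univ) fun i _ =>
    ((Complex.conjCLE.toContinuousLinearMap.hasFDerivAt (x := rowCLM 1 i (ψ p))).comp p
      (hr 1 i)).mul (hr M i)
  have h' : fderiv ℝ (fun p => ∑ i, starRingEnd ℂ (rowCLM 1 i (ψ p)) * rowCLM M i (ψ p)) p = _ :=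
    h.fderiv
  rw [h']
  simp [dotProduct, Finset.sum_add_distrib, mul_comm]

lemma energyDensity_eq (ψ : Space × ℝ → Spinor) (p : Space × ℝ) :
    (energyDensity ψ p : ℂ) =
      ∑ i, starRingEnd ℂ (rowCLM 1 i (ψ p)) * rowCLM 1 i (ψ p) := by
  simp [energyDensity, Complex.conj_mul']

lemma contDiffOn_sesq {s : Set (Space × ℝ)} {ψ : Space × ℝ → Spinor}
    (hψ : ContDiffOn ℝ 1 ψ s) (M : Matrix (Fin 4) (Fin 4) ℂ) :
    ContDiffOn ℝ 1 (fun p => ∑ i, starRingEnd ℂ (rowCLM 1 i (ψ p)) * rowCLM M i (ψ p)) s :=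
  ContDiffOn.sum fun i _ => (Complex.conjCLE.contDiff.comp_contDiffOn
    (contDiffOn_row hψ 1 i)).mul (contDiffOn_row hψ M i)

/-- Since the `αₖ` are Hermitian, the current `ψ* αₖ ψ` balances the spatial derivatives. Only the
Hermitian part of `(ν/τ) γ⁰` survives, hence `ν.re`. -/
lemma hasDerivAt_energy {ν : ℂ} {τ₀ τ₁ R : ℝ} {ψ : Space × ℝ → Spinor}
    (hψ : IsConformalSolution ν τ₀ τ₁ ψ)
    (h0 : ∀ x, ∀ τ ∈ Icc τ₀ τ₁, R < ‖x‖ → ψ (x, τ) = 0) {τ : ℝ} (hτ : τ ∈ Ioo τ₀ τ₁) :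
    HasDerivAt (fun s => ∫ x, energyDensity ψ (x, s))
      (∫ x, 2 * (ν.re / τ) * ∑ i, sgn i * ‖ψ (x, τ) i‖ ^ 2) τ := by
  have key := hasDerivAt_integral_of_current (R := R) (a := τ₀) (b := τ₁)
    (f := fun p => ∑ i, starRingEnd ℂ (rowCLM 1 i (ψ p)) * rowCLM 1 i (ψ p))
    (g := fun k p => ∑ i, starRingEnd ℂ (rowCLM 1 i (ψ p)) * rowCLM (alpha k) i (ψ p))
    (contDiffOn_sesq hψ.contDiffOn 1) (fun k => contDiffOn_sesq hψ.contDiffOn (alpha k))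
    (fun x s hs hx => by simp [h0 x s (Ioo_subset_Icc_self hs) hx])
    (fun k x s hs hx => by simp [h0 x s (Ioo_subset_Icc_self hs) hx]) hτ
  have hψd : ∀ x, DifferentiableAt ℝ ψ (x, τ) := fun x =>
    (hasFDerivAt_of_slab hψ.contDiffOn hτ).differentiableAt
  have hint : (∫ x, (fderiv ℝ (fun p => ∑ i, starRingEnd ℂ (rowCLM 1 i (ψ p)) *
      rowCLM 1 i (ψ p)) (x, τ) (0, 1) + ∑ k, fderiv ℝ (fun p => ∑ i,
      starRingEnd ℂ (rowCLM 1 i (ψ p)) * rowCLM (alpha k) i (ψ p)) (x, τ)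
        (EuclideanSpace.single k 1, 0))) =
      ((∫ x, 2 * (ν.re / τ) * ∑ i, sgn i * ‖ψ (x, τ) i‖ ^ 2 : ℝ) : ℂ) := by
    rw [← integral_complex_ofReal]
    refine integral_congr_ae (Eventually.of_forall fun x => ?_)
    simp only [fderiv_sesq (hψd x)]
    have hD := hψ.dirac x τ hτ
    simp only [timeDeriv, spaceDeriv] at hD
    have e1 := congrArg (fun u => star (ψ (x, τ)) ⬝ᵥ u) hD
    have e2 := congrArg (fun u => star u ⬝ᵥ ψ (x, τ)) hD
    simp only [dotProduct_add, dotProduct_sum, star_add, star_sum, add_dotProduct,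
      sum_dotProduct] at e1 e2
    simp only [Matrix.one_mulVec, dotProduct_alpha, Finset.sum_add_distrib] at e1 e2 ⊢
    have e3 : star (ψ (x, τ)) ⬝ᵥ ((ν / τ) • (gamma 0 *ᵥ ψ (x, τ))) =
        (ν / τ) * ((∑ i, sgn i * ‖ψ (x, τ) i‖ ^ 2 : ℝ) : ℂ) := by
      simp only [dotProduct, Pi.smul_apply, gamma_zero_mulVec, smul_eq_mul, Pi.star_apply,
        Complex.ofReal_sum, Complex.ofReal_mul, Complex.ofReal_pow, ← Complex.conj_mul',
        Finset.mul_sum]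
      refine Finset.sum_congr rfl fun i _ => ?_
      rw [Complex.star_def]; ring
    have e4 : star ((ν / τ) • (gamma 0 *ᵥ ψ (x, τ))) ⬝ᵥ ψ (x, τ) =
        starRingEnd ℂ (ν / τ) * ((∑ i, sgn i * ‖ψ (x, τ) i‖ ^ 2 : ℝ) : ℂ) := by
      simp only [dotProduct, Pi.smul_apply, gamma_zero_mulVec, smul_eq_mul, Pi.star_apply,
        Complex.ofReal_sum, Complex.ofReal_mul, Complex.ofReal_pow, ← Complex.conj_mul',
        Finset.mul_sum, Complex.star_def, map_mul, Complex.conj_ofReal]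
      refine Finset.sum_congr rfl fun i _ => ?_
      ring
    rw [e3] at e1
    rw [e4] at e2
    have e5 : ν / τ + starRingEnd ℂ (ν / τ) = ((2 * (ν.re / τ) : ℝ) : ℂ) := by
      rw [Complex.add_conj]
      simp
    rw [Complex.ofReal_mul, ← e5]
    linear_combination e1 + e2
  rw [hint] at key
  have h2 := Complex.reCLM.hasFDerivAt.comp_hasDerivAt τ key
  refine (h2.congr_deriv (by simp)).congr_of_eventuallyEq (Eventually.of_forall fun s => ?_)
  have : (∫ x, ∑ i, starRingEnd ℂ (rowCLM 1 i (ψ (x, s))) * rowCLM 1 i (ψ (x, s))) =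
      ((∫ x, energyDensity ψ (x, s) : ℝ) : ℂ) := by
    rw [← integral_complex_ofReal]
    simp only [energyDensity_eq]
  rw [Function.comp_apply, this, Complex.reCLM_apply, Complex.ofReal_re]

lemma energy_le {ν : ℂ} {τ₀ τ₁ R c : ℝ} {ψ : Space × ℝ → Spinor}
    (hψ : IsConformalSolution ν τ₀ τ₁ ψ) (hc : 0 < c) (hcτ : ∀ τ ∈ Icc τ₀ τ₁, c ≤ |τ|)
    (h0 : ∀ x, ∀ τ ∈ Icc τ₀ τ₁, R < ‖x‖ → ψ (x, τ) = 0) {τ : ℝ} (hτ : τ ∈ Icc τ₀ τ₁) :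
    ∫ x, energyDensity ψ (x, τ) ≤
      Real.exp (2 * ‖ν‖ / c * (τ - τ₀)) * ∫ x, energyDensity ψ (x, τ₀) := by
  set K := 2 * ‖ν‖ / c with hK
  set e := fun s => ∫ x, energyDensity ψ (x, s) with he
  have hcont : ContinuousOn (fun p => energyDensity ψ p) (univ ×ˢ Icc τ₀ τ₁) :=
    continuous_energy.comp_continuousOn hψ.continuousOn
  have hzero : ∀ x, ∀ s ∈ Icc τ₀ τ₁, R < ‖x‖ → energyDensity ψ (x, s) = 0 := fun x s hs hx => by
    simp [energyDensity, h0 x s hs hx]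
  have hec : ContinuousOn e (Icc τ₀ τ₁) := by
    have h1 := continuousOn_integral_slab (f := fun p => (energyDensity ψ p : ℂ)) (R := R)
      (Complex.continuous_ofReal.comp_continuousOn hcont) (fun x s hs hx => by
        simp [hzero x s hs hx])
    have h2 := Complex.continuous_re.comp_continuousOn h1
    refine h2.congr fun s _ => ?_
    simp [e, integral_complex_ofReal]
  -- Grönwall's argument with an integrating factor; the rate `K` is uniform because `γ⁰` has
  -- eigenvalues `±1` and `|τ| ≥ c`.
  have hanti : AntitoneOn (fun s => Real.exp (-(K * (s - τ₀))) * e s) (Icc τ₀ τ₁) := by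
    have hd : ∀ s ∈ Ioo τ₀ τ₁, HasDerivAt (fun s => Real.exp (-(K * (s - τ₀))) * e s) _ s :=
      fun s hs => (((((hasDerivAt_id s).sub_const τ₀).const_mul K).neg).exp).mul
        (hasDerivAt_energy hψ h0 hs)
    refine antitoneOn_of_deriv_nonpos (convex_Icc _ _) ?_ ?_ ?_
    · exact ContinuousOn.mul (by fun_prop) hec
    · rw [interior_Icc]
      exact fun s hs => (hd s hs).differentiableAt.differentiableWithinAt
    · rw [interior_Icc]
      intro s hs
      rw [(hd s hs).deriv]
      have hsI := Ioo_subset_Icc_self hs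
      have hint : Integrable fun x => energyDensity ψ (x, s) :=
        (continuous_slice hcont hsI).integrable_of_hasCompactSupport
          (hasCompactSupport_of_norm (R := R) fun x hx => hzero x s hsI hx)
      have hle : ∫ x, 2 * (ν.re / s) * ∑ i, sgn i * ‖ψ (x, s) i‖ ^ 2 ≤ K * e s := by
        rw [he, ← integral_const_mul]
        refine integral_mono ?_ (hint.const_mul K) fun x => ?_
        · have hψs : ∀ i, Continuous fun x => ψ (x, s) i := fun i =>
            (continuous_apply i).comp (continuous_slice hψ.continuousOn hsI)
          refine Continuous.integrable_of_hasCompactSupport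
            (continuous_const.mul (continuous_finsetSum _ fun i _ =>
              continuous_const.mul ((hψs i).norm.pow 2)))
            (hasCompactSupport_of_norm (R := R) fun x hx => ?_)
          simp [h0 x s hsI hx]
        · have h1 : |∑ i, sgn i * ‖ψ (x, s) i‖ ^ 2| ≤ energyDensity ψ (x, s) := by
            refine (Finset.abs_sum_le_sum_abs _ _).trans (Finset.sum_le_sum fun i _ => ?_)
            rw [abs_mul, abs_pow, abs_norm]
            have : |sgn i| = 1 := by fin_cases i <;> simp [sgn]
            rw [this, one_mul]
          have h2 : |2 * (ν.re / s)| ≤ K := by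
            rw [abs_mul, abs_div, abs_two, hK, mul_div_assoc]
            gcongr
            · exact Complex.abs_re_le_norm ν
            · exact hcτ s hsI
          calc 2 * (ν.re / s) * ∑ i, sgn i * ‖ψ (x, s) i‖ ^ 2
              ≤ |2 * (ν.re / s)| * |∑ i, sgn i * ‖ψ (x, s) i‖ ^ 2| := by
                rw [← abs_mul]; exact le_abs_self _
            _ ≤ K * energyDensity ψ (x, s) := by gcongr
      have hexp := Real.exp_pos ((-fun y => K * (id y - τ₀)) s)
      rw [mul_one, mul_assoc, ← mul_add]
      exact mul_nonpos_of_nonneg_of_nonpos hexp.le (by linarith)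
  have := hanti (left_mem_Icc.2 (hτ.1.trans hτ.2)) hτ hτ.1
  simp only [sub_self, mul_zero, neg_zero, Real.exp_zero, one_mul, Real.exp_neg] at this
  rwa [inv_mul_le_iff₀ (Real.exp_pos _)] at this

end FLRW

/-! ### Sufficiency: test functions focusing along a light cone -/

namespace FLRW

open MeasureTheory Set Filter Topology Matrix

/-! ### Radial averages -/

lemma hasFDerivAt_intervalIntegral {H : Type*} [NormedAddCommGroup H] [NormedSpace ℝ H]
    [ProperSpace H] {φ : H → ℝ → ℝ} {φ' : H → ℝ → H →L[ℝ] ℝ} (a b : ℝ)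
    (hφ : Continuous fun q : H × ℝ => φ q.1 q.2) (hφ' : Continuous fun q : H × ℝ => φ' q.1 q.2)
    (hd : ∀ p θ, HasFDerivAt (fun q => φ q θ) (φ' p θ) p) (p : H) :
    HasFDerivAt (fun q => ∫ θ in a..b, φ q θ) (∫ θ in a..b, φ' p θ) p := by
  obtain ⟨M, hM⟩ := ((isCompact_closedBall p 1).prod
    (isCompact_uIcc (a := a) (b := b))).exists_bound_of_continuousOn hφ'.continuousOn
  have hsl : ∀ q, Continuous (φ q) := fun q => hφ.comp (by fun_prop : Continuous fun θ => (q, θ))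
  refine (intervalIntegral.hasFDerivAt_integral_of_dominated_of_fderiv_le (μ := volume)
    (F := φ) (F' := φ') (bound := fun _ => M) (Metric.closedBall_mem_nhds p one_pos) ?_ ?_ ?_ ?_
    ?_ ?_)
  · exact Eventually.of_forall fun q => (hsl q).aestronglyMeasurable
  · exact (hsl p).intervalIntegrable _ _
  · exact (hφ'.comp (by fun_prop : Continuous fun θ => (p, θ))).aestronglyMeasurable
  · exact Eventually.of_forall fun θ hθ q hq => hM (q, θ) ⟨hq, uIoc_subset_uIcc hθ⟩
  · exact intervalIntegrable_const
  · exact Eventually.of_forall fun θ _ q _ => hd q θ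

/-- The weighted mean `∫_{-1}^{1} (1 - θ²)ⁿ g (s + r θ) dθ`. -/
def mean (n : ℕ) (g : ℝ → ℝ) (r s : ℝ) : ℝ :=
  ∫ θ in (-1 : ℝ)..1, (1 - θ ^ 2) ^ n * g (s + r * θ)

lemma continuous_mean (n : ℕ) {g : ℝ → ℝ} (hg : Continuous g) :
    Continuous fun p : ℝ × ℝ => mean n g p.1 p.2 := by
  unfold mean
  refine intervalIntegral.continuous_parametric_intervalIntegral_of_continuous' ?_ _ _
  fun_prop

lemma hasDerivAt_affine {g g' : ℝ → ℝ} (hd : ∀ x, HasDerivAt g (g' x) x) (r s θ : ℝ) :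
    HasDerivAt (fun θ => g (s + r * θ)) (r * g' (s + r * θ)) θ := by
  have h1 : HasDerivAt (fun θ => s + r * θ) r θ := by
    simpa using ((hasDerivAt_id θ).const_mul r).const_add s
  exact ((hd (s + r * θ)).comp θ h1).congr_deriv (by ring)

/-- The factor `(1 - θ²)ⁿ θ` is the derivative of `-(1 - θ²)ⁿ⁺¹ / (2(n+1))`, which vanishes at `±1`.
Integration by parts thus trades `θ` for an explicit factor `r`, which is what makes radial means
smooth across `x = 0`. -/
lemma integral_weight_mul (n : ℕ) {g g' : ℝ → ℝ} (hd : ∀ x, HasDerivAt g (g' x) x)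
    (hg' : Continuous g') (r s : ℝ) :
    ∫ θ in (-1 : ℝ)..1, (1 - θ ^ 2) ^ n * θ * g (s + r * θ) =
      r * (mean (n + 1) g' r s / (2 * (n + 1))) := by
  have hn : (n : ℝ) + 1 ≠ 0 := by positivity
  have hu : ∀ θ : ℝ, HasDerivAt (fun θ : ℝ => -(1 - θ ^ 2) ^ (n + 1) / (2 * (n + 1)))
      ((1 - θ ^ 2) ^ n * θ) θ := fun θ => by
    have := ((((hasDerivAt_id θ).pow 2).const_sub 1).pow (n + 1)).neg.div_const
      (2 * ((n : ℝ) + 1))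
    refine this.congr_deriv ?_
    simp
    field_simp
  have hgc : Continuous g := continuous_iff_continuousAt.2 fun x => (hd x).continuousAt
  have key := intervalIntegral.integral_deriv_mul_eq_sub (a := -1) (b := 1)
    (fun θ _ => hu θ) (fun θ _ => hasDerivAt_affine hd r s θ)
    (Continuous.intervalIntegrable (by fun_prop) _ _)
    (Continuous.intervalIntegrable (by fun_prop) _ _)
  norm_num at key
  rw [intervalIntegral.integral_add (Continuous.intervalIntegrable (by fun_prop) _ _)
    (Continuous.intervalIntegrable (by fun_prop) _ _)] at key
  have h2 : ∫ θ in (-1 : ℝ)..1, -(1 - θ ^ 2) ^ (n + 1) / (2 * ((n : ℝ) + 1)) *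
      (r * g' (s + r * θ)) = -(r * (mean (n + 1) g' r s / (2 * (n + 1)))) := by
    rw [mean, ← intervalIntegral.integral_div, ← intervalIntegral.integral_const_mul,
      ← intervalIntegral.integral_neg]
    congr 1
    funext θ
    ring
  linarith

lemma hasFDerivAt_mean (n : ℕ) {g g' g'' : ℝ → ℝ} (hd : ∀ x, HasDerivAt g (g' x) x)
    (hd' : ∀ x, HasDerivAt g' (g'' x) x) (hg'' : Continuous g'') (r s : ℝ) :
    HasFDerivAt (fun p : ℝ × ℝ => mean n g p.1 p.2)
      ((r * (mean (n + 1) g'' r s / (2 * (n + 1)))) • ContinuousLinearMap.fst ℝ ℝ ℝ +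
        mean n g' r s • ContinuousLinearMap.snd ℝ ℝ ℝ) (r, s) := by
  have hgc : Continuous g := continuous_iff_continuousAt.2 fun x => (hd x).continuousAt
  have hgc' : Continuous g' := continuous_iff_continuousAt.2 fun x => (hd' x).continuousAt
  have key := hasFDerivAt_intervalIntegral (H := ℝ × ℝ) (-1) 1
    (φ := fun p θ => (1 - θ ^ 2) ^ n * g (p.2 + p.1 * θ))
    (φ' := fun p θ => ((1 - θ ^ 2) ^ n * θ * g' (p.2 + p.1 * θ)) • ContinuousLinearMap.fst ℝ ℝ ℝ +
      ((1 - θ ^ 2) ^ n * g' (p.2 + p.1 * θ)) • ContinuousLinearMap.snd ℝ ℝ ℝ)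
    (by fun_prop) (by fun_prop) (fun p θ => by
      have h1 : HasFDerivAt (fun p : ℝ × ℝ => p.2 + p.1 * θ)
          (ContinuousLinearMap.snd ℝ ℝ ℝ + θ • ContinuousLinearMap.fst ℝ ℝ ℝ) p :=
        hasFDerivAt_snd.add (hasFDerivAt_fst.mul_const θ)
      refine (((hd _).comp_hasFDerivAt p h1).const_mul ((1 - θ ^ 2) ^ n)).congr_fderiv ?_
      ext <;> (simp; try ring)) (r, s)
  refine key.congr_fderiv ?_
  rw [intervalIntegral.integral_add (Continuous.intervalIntegrable (by fun_prop) _ _)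
    (Continuous.intervalIntegrable (by fun_prop) _ _), intervalIntegral.integral_smul_const,
    intervalIntegral.integral_smul_const, integral_weight_mul n hd' hg'']
  rfl

/-- The factor `r` in the `r`-derivative cancels the `1/‖x‖` in the gradient of the norm, so the
formula persists at the origin, where the norm itself is not differentiable. -/
lemma hasRadialDerivAt_mean (n : ℕ) {g g' g'' : ℝ → ℝ} (hd : ∀ x, HasDerivAt g (g' x) x)
    (hd' : ∀ x, HasDerivAt g' (g'' x) x) (hg'' : Continuous g'') (p : Space × ℝ) :
    HasRadialDerivAt (fun p => mean n g ‖p.1‖ p.2) (mean (n + 1) g'' ‖p.1‖ p.2 / (2 * (n + 1)))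
      (mean n g' ‖p.1‖ p.2) p := by
  have h := hasFDerivAt_mean n hd hd' hg'' ‖p.1‖ p.2
  by_cases hp : p.1 = 0
  -- At the origin the `r`-derivative vanishes, and the little-o estimate transfers along `q ↦
  -- (‖q.1‖, q.2)`, which preserves norms.
  · rw [HasRadialDerivAt, hasFDerivAt_iff_isLittleO_nhds_zero]
    rw [hasFDerivAt_iff_isLittleO_nhds_zero] at h
    have ht : Tendsto (fun q : Space × ℝ => (‖q.1‖, q.2)) (𝓝 0) (𝓝 0) := by
      have : Continuous fun q : Space × ℝ => (‖q.1‖, q.2) := by fun_prop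
      simpa only [Prod.fst_zero, Prod.snd_zero, norm_zero, Prod.mk_zero_zero] using this.tendsto 0
    have h2 := (h.comp_tendsto ht).trans_le (k := fun q : Space × ℝ => q) (fun q => by
      simp [Prod.norm_def])
    refine h2.congr_left fun q => ?_
    simp [hp]
  · have hnorm : HasFDerivAt (fun q : Space × ℝ => ‖q.1‖)
        ((1 / ‖p.1‖) • (innerSL ℝ p.1).comp (ContinuousLinearMap.fst ℝ Space ℝ)) p := by
      have hp' : ‖p.1‖ ≠ 0 := norm_ne_zero_iff.2 hp
      have h1 : HasFDerivAt (fun y : Space => ‖y‖ ^ 2) (2 • (innerSL ℝ p.1)) p.1 :=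
        (hasStrictFDerivAt_norm_sq p.1).hasFDerivAt
      have h2 := (h1.sqrt (pow_ne_zero 2 hp')).comp p
        (hasFDerivAt_fst (𝕜 := ℝ) (E := Space) (F := ℝ) (p := p))
      refine (h2.congr_of_eventuallyEq (Eventually.of_forall fun q => ?_)).congr_fderiv ?_
      · simp [Real.sqrt_sq (norm_nonneg _)]
      · ext <;> simp [Real.sqrt_sq (norm_nonneg _)]
        field_simp
    have h3 : HasFDerivAt (fun q : Space × ℝ => (‖q.1‖, q.2)) _ p :=
      hnorm.prodMk hasFDerivAt_snd
    have h4 := HasFDerivAt.comp p (f := fun q : Space × ℝ => (‖q.1‖, q.2)) h h3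
    have hp' : ‖p.1‖ ≠ 0 := norm_ne_zero_iff.2 hp
    refine HasFDerivAt.congr_fderiv h4 ?_
    ext <;> simp
    field_simp

lemma contDiff_one_of_hasRadialDerivAt {f fr ft : Space × ℝ → ℝ}
    (h : ∀ p, HasRadialDerivAt f (fr p) (ft p) p) (hr : Continuous fr) (ht : Continuous ft) :
    ContDiff ℝ 1 f := by
  rw [contDiff_one_iff_fderiv]
  refine ⟨fun p => (h p).differentiableAt, ?_⟩
  have : fderiv ℝ f = fun p => fr p • (innerSL ℝ p.1).comp (ContinuousLinearMap.fst ℝ Space ℝ) +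
      ft p • ContinuousLinearMap.snd ℝ Space ℝ := funext fun p => HasFDerivAt.fderiv (h p)
  rw [this]
  have h1 : Continuous fun p : Space × ℝ => innerSL ℝ p.1 :=
    (innerSL ℝ).continuous.comp continuous_fst
  exact (hr.smul (h1.clm_comp continuous_const)).add (ht.smul continuous_const)

/-- Integration by parts against `(1 - θ²) θ`. It turns the term `‖x‖² Lr` of the adjoint system
back into means of orders 0 and 1, so that the system closes. -/
lemma mean_two_eq {g g' g'' : ℝ → ℝ} (hd : ∀ x, HasDerivAt g (g' x) x)
    (hd' : ∀ x, HasDerivAt g' (g'' x) x) (hg'' : Continuous g'') (r s : ℝ) :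
    r ^ 2 * mean 2 g'' r s = 8 * mean 0 g r s - 12 * mean 1 g r s := by
  have h1 := integral_weight_mul 1 hd' hg'' r s
  have hgc : Continuous g := continuous_iff_continuousAt.2 fun x => (hd x).continuousAt
  have hgc' : Continuous g' := continuous_iff_continuousAt.2 fun x => (hd' x).continuousAt
  have hu : ∀ θ : ℝ, HasDerivAt (fun θ : ℝ => (1 - θ ^ 2) ^ 1 * θ) (1 - 3 * θ ^ 2) θ := fun θ => by
    have := (((hasDerivAt_id θ).pow 2).const_sub 1).mul (hasDerivAt_id θ)
    refine (this.congr_of_eventuallyEq (Eventually.of_forall fun x => ?_)).congr_deriv ?_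
    · simp
    · simp; ring
  have key := intervalIntegral.integral_deriv_mul_eq_sub (a := -1) (b := 1)
    (fun θ _ => hu θ) (fun θ _ => hasDerivAt_affine hd r s θ)
    (Continuous.intervalIntegrable (by fun_prop) _ _)
    (Continuous.intervalIntegrable (by fun_prop) _ _)
  rw [intervalIntegral.integral_add (Continuous.intervalIntegrable (by fun_prop) _ _)
    (Continuous.intervalIntegrable (by fun_prop) _ _)] at key
  norm_num at key
  have h2 : ∫ θ in (-1 : ℝ)..1, (1 - 3 * θ ^ 2) * g (s + r * θ) =
      3 * mean 1 g r s - 2 * mean 0 g r s := by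
    rw [mean, mean, ← intervalIntegral.integral_const_mul, ← intervalIntegral.integral_const_mul,
      ← intervalIntegral.integral_sub (Continuous.intervalIntegrable (by fun_prop) _ _)
      (Continuous.intervalIntegrable (by fun_prop) _ _)]
    congr 1
    funext θ
    ring
  have h3 : ∫ θ in (-1 : ℝ)..1, (1 - θ ^ 2) * θ * (r * g' (s + r * θ)) =
      r * ∫ θ in (-1 : ℝ)..1, (1 - θ ^ 2) ^ 1 * θ * g' (s + r * θ) := by
    rw [← intervalIntegral.integral_const_mul]
    congr 1
    funext θ
    ring
  rw [h3, h1, h2] at key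
  push_cast at key
  linear_combination 4 * key

/-- The mean of order 0 is the classical spherical wave `(g (s+r) - g (s-r)) / r`. With
`sq_mul_mean_one` it evaluates the means off the light cone from values of `g` alone. -/
lemma mul_mean_zero {g g' : ℝ → ℝ} (hd : ∀ x, HasDerivAt g (g' x) x) (hg' : Continuous g')
    (r s : ℝ) : r * mean 0 g' r s = g (s + r) - g (s - r) := by
  have key := intervalIntegral.integral_eq_sub_of_hasDerivAt (a := -1) (b := 1)
    (fun θ _ => hasDerivAt_affine hd r s θ) (Continuous.intervalIntegrable (by fun_prop) _ _)
  rw [mean, ← intervalIntegral.integral_const_mul]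
  simpa [sub_eq_add_neg] using key

lemma sq_mul_mean_one {g g' g'' : ℝ → ℝ} (hd : ∀ x, HasDerivAt g (g' x) x)
    (hd' : ∀ x, HasDerivAt g' (g'' x) x) (hg'' : Continuous g'') (r s : ℝ) :
    r ^ 2 * mean 1 g'' r s = 2 * (g (s + r) + g (s - r) - mean 0 g r s) := by
  have h1 := integral_weight_mul 0 hd' hg'' r s
  have hgc : Continuous g := continuous_iff_continuousAt.2 fun x => (hd x).continuousAt
  have hgc' : Continuous g' := continuous_iff_continuousAt.2 fun x => (hd' x).continuousAt
  have key := intervalIntegral.integral_deriv_mul_eq_sub (a := -1) (b := 1)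
    (fun θ _ => hasDerivAt_id θ) (fun θ _ => hasDerivAt_affine hd r s θ)
    (Continuous.intervalIntegrable (by fun_prop) _ _)
    (Continuous.intervalIntegrable (by fun_prop) _ _)
  rw [intervalIntegral.integral_add (Continuous.intervalIntegrable (by fun_prop) _ _)
    (Continuous.intervalIntegrable (by fun_prop) _ _)] at key
  have h3 : ∫ θ in (-1 : ℝ)..1, id θ * (r * g' (s + r * θ)) =
      r * ∫ θ in (-1 : ℝ)..1, (1 - θ ^ 2) ^ 0 * θ * g' (s + r * θ) := by
    rw [← intervalIntegral.integral_const_mul]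
    congr 1
    funext θ
    simp
    ring
  have h2 : ∫ θ in (-1 : ℝ)..1, 1 * g (s + r * θ) = mean 0 g r s := by simp [mean]
  rw [h3, h1, h2] at key
  simp [← sub_eq_add_neg] at key
  linear_combination 2 * key

lemma mean_eq_zero_of_support {g : ℝ → ℝ} {δ r s : ℝ} (hg : ∀ x, δ < x → g x = 0) (hr : 0 ≤ r)
    (h : r < s - δ) (n : ℕ) : mean n g r s = 0 := by
  rw [mean, ← intervalIntegral.integral_zero (a := -1) (b := 1) (μ := volume)]
  refine intervalIntegral.integral_congr fun θ hθ => ?_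
  rw [uIcc_of_le (by norm_num)] at hθ
  have : δ < s + r * θ := by nlinarith [hθ.1]
  simp [hg _ this]

lemma mean_eq_zero_of_odd {g : ℝ → ℝ} (hg : ∀ x, g (-x) = -g x) (n : ℕ) (r : ℝ) :
    mean n g r 0 = 0 := by
  have h := intervalIntegral.integral_comp_neg (a := -1) (b := 1)
    (fun θ => (1 - θ ^ 2) ^ n * g (0 + r * θ))
  have h2 : ∫ θ in (-1 : ℝ)..1, (1 - (-θ) ^ 2) ^ n * g (0 + r * -θ) = -mean n g r 0 := by
    rw [mean, ← intervalIntegral.integral_neg]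
    congr 1
    funext θ
    rw [show 0 + r * -θ = -(0 + r * θ) by ring, hg]
    ring
  rw [h2] at h
  simp only [neg_neg] at h
  change -mean n g r 0 = mean n g r 0 at h
  linarith

end FLRW

namespace FLRW

open MeasureTheory Set Filter Topology Matrix

/-! ### Profiles of radial waves -/

/-- A sequence of functions, each the derivative of the previous one, starting from an even
function which is affine for `x > δ`, and whose third member is `x b(x)`. -/
structure IsProfile (δ c d : ℝ) (b : ℝ → ℝ) (g : ℕ → ℝ → ℝ) : Prop where
  hasDerivAt : ∀ n x, HasDerivAt (g n) (g (n + 1) x) x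
  even : ∀ x, g 0 (-x) = g 0 x
  affine : ∀ x, δ < x → g 0 x = c * x + d
  third : ∀ x, g 3 x = x * b x

lemma even_of_odd_deriv {f f' : ℝ → ℝ} (hf : ∀ x, HasDerivAt f (f' x) x)
    (h : ∀ x, f' (-x) = -f' x) (x : ℝ) : f (-x) = f x := by
  have hd : ∀ y, HasDerivAt (fun y => f (-y) - f y) 0 y := fun y => by
    have h1 := ((hf (-y)).comp y (hasDerivAt_neg y)).sub (hf y)
    refine h1.congr_deriv ?_
    rw [h]; ring
  have := is_const_of_deriv_eq_zero (fun y => (hd y).differentiableAt) (fun y => (hd y).deriv) x 0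
  simp only [neg_zero, sub_self] at this
  linarith

lemma odd_of_even_deriv {f f' : ℝ → ℝ} (hf : ∀ x, HasDerivAt f (f' x) x)
    (h : ∀ x, f' (-x) = f' x) (h0 : f 0 = 0) (x : ℝ) : f (-x) = -f x := by
  have hd : ∀ y, HasDerivAt (fun y => f (-y) + f y) 0 y := fun y => by
    have h1 := ((hf (-y)).comp y (hasDerivAt_neg y)).add (hf y)
    refine h1.congr_deriv ?_
    rw [h]; ring
  have := is_const_of_deriv_eq_zero (fun y => (hd y).differentiableAt) (fun y => (hd y).deriv) x 0
  simp only [neg_zero, h0, add_zero] at this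
  linarith

lemma hasDerivAt_primitive {f : ℝ → ℝ} (hf : Continuous f) (a x : ℝ) :
    HasDerivAt (fun y => ∫ u in a..y, f u) (f x) x :=
  intervalIntegral.integral_hasDerivAt_right (hf.intervalIntegrable _ _)
    (hf.stronglyMeasurableAtFilter _ _) hf.continuousAt

lemma continuous_of_hasDerivAt {f f' : ℝ → ℝ} (hf : ∀ x, HasDerivAt f (f' x) x) : Continuous f :=
  continuous_iff_continuousAt.2 fun x => (hf x).continuousAt

lemma eq_of_deriv_eq_const {f f' : ℝ → ℝ} {δ c : ℝ} (hf : ∀ x, HasDerivAt f (f' x) x)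
    (h : ∀ x, δ < x → f' x = c) {x : ℝ} (hx : δ < x) : f x = c * x + (f (δ + 1) - c * (δ + 1)) := by
  have hd : ∀ y ∈ Ioi δ, HasDerivWithinAt (fun y => f y - c * y) 0 (Ioi δ) y := fun y hy => by
    have h1 := (hf y).sub ((hasDerivAt_id y).const_mul c)
    refine (h1.congr_deriv ?_).hasDerivWithinAt
    rw [h y hy]; simp
  have := (convex_Ioi δ).norm_image_sub_le_of_norm_hasDerivWithin_le (C := 0) hd (by simp)
    (show δ + 1 ∈ Ioi δ by simp) hx
  simp only [zero_mul, norm_le_zero_iff] at this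
  linarith

/-- The odd function `x f(x)`, with `f` an even bump, is integrated three times. The first primitive
is based at `δ`, so it vanishes beyond `δ` and, being even, below `-δ`. The next two are based at
`0`, which keeps the parities alternating at the price of the constants `c` and `d`. -/
lemma exists_isProfile {δ : ℝ} (hδ : 0 < δ) : ∃ (c d : ℝ) (b : ℝ → ℝ) (g : ℕ → ℝ → ℝ),
    IsProfile δ c d b g ∧ Continuous b ∧ (∀ x, 0 ≤ b x) ∧ b 0 = 1 ∧ ∀ x, δ ≤ |x| → b x = 0 := by
  let f : ContDiffBump (0 : ℝ) := ⟨δ / 2, δ, by positivity, by linarith⟩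
  have hf0 : ∀ x, δ ≤ |x| → f x = 0 := fun x hx => f.zero_of_le_dist (by simpa using hx)
  set G : ℝ → ℝ := fun x => x * f x with hG
  have hGs : ContDiff ℝ ∞ G := contDiff_id.mul f.contDiff
  have hGodd : ∀ x, G (-x) = -G x := fun x => by simp [hG, f.neg]
  set A : ℝ → ℝ := fun x => ∫ u in δ..x, G u with hA
  have hAd : ∀ x, HasDerivAt A (G x) x := hasDerivAt_primitive hGs.continuous δ
  have hA0 : ∀ x, δ < x → A x = 0 := fun x hx => by
    rw [hA, ← intervalIntegral.integral_zero (a := δ) (b := x) (μ := volume)]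
    refine intervalIntegral.integral_congr fun u hu => ?_
    rw [uIcc_of_le hx.le] at hu
    simp [hG, hf0 u (hu.1.trans (le_abs_self u))]
  have hAc := continuous_of_hasDerivAt hAd
  have hAeven := even_of_odd_deriv hAd hGodd
  set B : ℝ → ℝ := fun x => ∫ u in (0 : ℝ)..x, A u with hB
  have hBd : ∀ x, HasDerivAt B (A x) x := hasDerivAt_primitive hAc 0
  have hBc := continuous_of_hasDerivAt hBd
  have hBodd := odd_of_even_deriv hBd hAeven (by simp [hB])
  have hB0 : ∀ x, δ < x → B x = B (δ + 1) := fun x hx => by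
    have := eq_of_deriv_eq_const hBd hA0 hx
    linarith
  set C : ℝ → ℝ := fun x => ∫ u in (0 : ℝ)..x, B u with hC
  have hCd : ∀ x, HasDerivAt C (B x) x := hasDerivAt_primitive hBc 0
  have hCeven := even_of_odd_deriv hCd hBodd
  refine ⟨B (δ + 1), C (δ + 1) - B (δ + 1) * (δ + 1), f, fun n => match n with
    | 0 => C
    | 1 => B
    | 2 => A
    | n + 3 => iteratedDeriv n G, ⟨fun n x => ?_, hCeven, fun x hx => ?_, fun x => ?_⟩,
    f.continuous, fun x => f.nonneg, f.one_of_mem_closedBall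
      (by simp only [f, Metric.mem_closedBall, dist_self]; positivity), hf0⟩
  · match n with
    | 0 => exact hCd x
    | 1 => exact hBd x
    | 2 => simpa using hAd x
    | n + 3 =>
      have : Differentiable ℝ (iteratedDeriv n G) :=
        hGs.differentiable_iteratedDeriv n (by exact_mod_cast ENat.natCast_lt_top n)
      have h2 := (this x).hasDerivAt
      rw [← iteratedDeriv_succ] at h2
      exact h2
  · exact eq_of_deriv_eq_const hCd hB0 hx
  · simp [hG]

namespace IsProfile

variable {δ c d : ℝ} {b : ℝ → ℝ} {g : ℕ → ℝ → ℝ}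

lemma continuous (h : IsProfile δ c d b g) (n : ℕ) : Continuous (g n) :=
  continuous_of_hasDerivAt (h.hasDerivAt n)

lemma neg (h : IsProfile δ c d b g) (n : ℕ) (x : ℝ) : g n (-x) = (-1) ^ n * g n x := by
  induction n generalizing x with
  | zero => simp [h.even]
  | succ n ih =>
    have h1 := (h.hasDerivAt n (-x)).comp x (hasDerivAt_neg x)
    have h2 := (h.hasDerivAt n x).const_mul ((-1) ^ n)
    have h3 : (g n ∘ Neg.neg) = fun x => (-1) ^ n * g n x := funext ih
    rw [h3] at h1
    have := h1.unique h2
    rw [pow_succ]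
    linarith

lemma odd (h : IsProfile δ c d b g) {n : ℕ} (hn : Odd n) (x : ℝ) : g n (-x) = -g n x := by
  rw [h.neg, hn.neg_one_pow]; ring

lemma deriv_eq (h : IsProfile δ c d b g) {n : ℕ} {e f : ℝ} (he : ∀ x, δ < x → g n x = e * x + f)
    (x : ℝ) (hx : δ < x) : g (n + 1) x = e := by
  have h1 := h.hasDerivAt n x
  have h2 : HasDerivAt (fun x => e * x + f) e x := by
    simpa using ((hasDerivAt_id x).const_mul e).add_const f
  refine h1.unique (h2.congr_of_eventuallyEq ?_)
  filter_upwards [lt_mem_nhds hx] with y hy using he y hy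

lemma one_eq (h : IsProfile δ c d b g) {x : ℝ} (hx : δ < x) : g 1 x = c :=
  h.deriv_eq h.affine x hx

lemma eq_zero (h : IsProfile δ c d b g) (n : ℕ) {x : ℝ} (hx : δ < x) : g (n + 2) x = 0 := by
  induction n generalizing x with
  | zero => exact h.deriv_eq (n := 1) (e := 0) (f := c) (fun y hy => by simp [h.one_eq hy]) x hx
  | succ n ih =>
    exact h.deriv_eq (n := n + 2) (e := 0) (f := 0) (fun y hy => by simp [ih hy]) x hx

lemma eq_zero_neg (h : IsProfile δ c d b g) (n : ℕ) {x : ℝ} (hx : x < -δ) : g (n + 2) x = 0 := by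
  have := h.neg (n + 2) (-x)
  rw [neg_neg, h.eq_zero n (by linarith : δ < -x)] at this
  simpa using this

lemma mean_inside (h : IsProfile δ c d b g) {r s : ℝ} (hr : 0 ≤ r) (hrs : r < s - δ) (m n : ℕ) :
    mean m (g (n + 2)) r s = 0 :=
  mean_eq_zero_of_support (fun _ hx => h.eq_zero n hx) hr hrs m

lemma mean_zero_outside (h : IsProfile δ c d b g) {r s : ℝ} (hr : 0 < r) (hs : 0 ≤ s)
    (hrs : s + δ < r) (n : ℕ) : mean 0 (g (n + 3)) r s = 0 := by
  have := mul_mean_zero (h.hasDerivAt (n + 2)) (h.continuous (n + 3)) r s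
  rw [h.eq_zero n (by linarith), h.eq_zero_neg n (by linarith), sub_zero] at this
  exact (mul_eq_zero.1 this).resolve_left hr.ne'

lemma mean_one_outside (h : IsProfile δ c d b g) {r s : ℝ} (hr : 0 < r) (hs : 0 ≤ s)
    (hrs : s + δ < r) (n : ℕ) : mean 1 (g (n + 5)) r s = 0 := by
  have := sq_mul_mean_one (h.hasDerivAt (n + 3)) (h.hasDerivAt (n + 4)) (h.continuous (n + 5)) r s
  rw [h.eq_zero (n + 1) (by linarith), h.eq_zero_neg (n + 1) (by linarith),
    h.mean_zero_outside hr hs hrs] at this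
  simpa [hr.ne'] using this

/-- Outside the cone `g 2` and all later members vanish, but `g 1` equals `±c`, which leaves a tail
of order `r⁻³`. This tail and the one of `mean_one_three_outside` are what could spoil localization
of the test functions; they have to cancel each other. -/
lemma mean_one_four_outside (h : IsProfile δ c d b g) {r s : ℝ} (hr : 0 < r) (hs : 0 ≤ s)
    (hrs : s + δ < r) : mean 1 (g 4) r s = -4 * c / r ^ 3 := by
  have h1 := sq_mul_mean_one (h.hasDerivAt 2) (h.hasDerivAt 3) (h.continuous 4) r s
  have h2 := mul_mean_zero (h.hasDerivAt 1) (h.continuous 2) r s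
  rw [h.eq_zero 0 (by linarith), h.eq_zero_neg 0 (by linarith)] at h1
  have h3 : g 1 (s - r) = -c := by
    rw [show s - r = -(r - s) by ring, h.odd odd_one, h.one_eq (by linarith)]
  rw [h.one_eq (by linarith), h3] at h2
  rw [eq_div_iff (by positivity)]
  linear_combination r * h1 - 2 * h2

lemma mean_one_three_outside (h : IsProfile δ c d b g) {r s : ℝ} (hr : 0 < r) (hs : 0 ≤ s)
    (hrs : s + δ < r) : mean 1 (g 3) r s = -4 * c * s / r ^ 3 := by
  have h1 := sq_mul_mean_one (h.hasDerivAt 1) (h.hasDerivAt 2) (h.continuous 3) r s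
  have h2 := mul_mean_zero (h.hasDerivAt 0) (h.continuous 1) r s
  have h3 : g 1 (s - r) = -c := by
    rw [show s - r = -(r - s) by ring, h.odd odd_one, h.one_eq (by linarith)]
  have h4 : g 0 (s - r) = c * (r - s) + d := by
    rw [show s - r = -(r - s) by ring, h.even, h.affine _ (by linarith)]
  rw [h.one_eq (by linarith), h3] at h1
  rw [h.affine _ (by linarith), h4] at h2
  rw [eq_div_iff (by positivity)]
  linear_combination r * h1 - 2 * h2

/-- At the focusing time the spherical wave of `g 4` collapses to the bump, because `g 3` is odd. -/
lemma mean_zero_four_start (h : IsProfile δ c d b g) {r : ℝ} (hr : r ≠ 0) :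
    mean 0 (g 4) r 0 = 2 * b r := by
  have h1 := mul_mean_zero (h.hasDerivAt 3) (h.continuous 4) r 0
  rw [zero_add, zero_sub, h.odd (by decide), h.third] at h1
  have : r * (mean 0 (g 4) r 0 - 2 * b r) = 0 := by linear_combination h1
  have := (mul_eq_zero.1 this).resolve_left hr
  linarith

end IsProfile

end FLRW

namespace FLRW

open MeasureTheory Set Filter Topology Matrix

/-! ### Explicit solutions of the adjoint equation supported near a light cone -/

namespace HasRadialDerivAt

variable {f h : Space × ℝ → ℝ} {fr ft hr ht : ℝ} {p : Space × ℝ}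

lemma add (hf : HasRadialDerivAt f fr ft p) (hh : HasRadialDerivAt h hr ht p) :
    HasRadialDerivAt (fun q => f q + h q) (fr + hr) (ft + ht) p := by
  refine (HasFDerivAt.add hf hh).congr_fderiv ?_
  rw [add_smul, add_smul]
  abel

lemma time_mul {c : ℝ → ℝ} {c' : ℝ} (hf : HasRadialDerivAt f fr ft p)
    (hc : HasDerivAt c c' p.2) :
    HasRadialDerivAt (fun q => c q.2 * f q) (c p.2 * fr) (c' * f p + c p.2 * ft) p := by
  have h1 := hc.comp_hasFDerivAt p (hasFDerivAt_snd (𝕜 := ℝ) (E := Space) (F := ℝ) (p := p))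
  refine (HasFDerivAt.mul h1 hf).congr_fderiv ?_
  ext <;> simp <;> ring

lemma reflect {T : ℝ} (hf : HasRadialDerivAt f fr ft (p.1, T - p.2)) :
    HasRadialDerivAt (fun q => f (q.1, T - q.2)) fr (-ft) p := by
  have h1 : HasFDerivAt (fun q : Space × ℝ => (q.1, T - q.2))
      ((ContinuousLinearMap.fst ℝ Space ℝ).prod (-ContinuousLinearMap.snd ℝ Space ℝ)) p :=
    hasFDerivAt_fst.prodMk (hasFDerivAt_snd.const_sub T)
  refine (HasFDerivAt.comp p (f := fun q : Space × ℝ => (q.1, T - q.2)) hf h1).congr_fderiv ?_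
  ext <;> simp

end HasRadialDerivAt

/-- The spherical wave with profile `f`, converging to the origin at the time `T`. -/
def coneMean (T : ℝ) (n : ℕ) (f : ℝ → ℝ) (p : Space × ℝ) : ℝ := mean n f ‖p.1‖ (T - p.2)

lemma hasRadialDerivAt_coneMean (T : ℝ) (n : ℕ) {f f' f'' : ℝ → ℝ}
    (hd : ∀ x, HasDerivAt f (f' x) x) (hd' : ∀ x, HasDerivAt f' (f'' x) x) (hf'' : Continuous f'')
    (p : Space × ℝ) : HasRadialDerivAt (coneMean T n f) (coneMean T (n + 1) f'' p / (2 * (n + 1)))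
      (-coneMean T n f' p) p :=
  HasRadialDerivAt.reflect (f := fun q => mean n f ‖q.1‖ q.2)
    (hasRadialDerivAt_mean n hd hd' hf'' (p.1, T - p.2))

lemma continuous_coneMean (T : ℝ) (n : ℕ) {f : ℝ → ℝ} (hf : Continuous f) :
    Continuous (coneMean T n f) :=
  (continuous_mean n hf).comp
    (by fun_prop : Continuous fun p : Space × ℝ => (‖p.1‖, T - p.2))

lemma contDiff_coneMean (T : ℝ) (n : ℕ) {f f' f'' : ℝ → ℝ}
    (hd : ∀ x, HasDerivAt f (f' x) x) (hd' : ∀ x, HasDerivAt f' (f'' x) x)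
    (hf'' : Continuous f'') : ContDiff ℝ 1 (coneMean T n f) :=
  contDiff_one_of_hasRadialDerivAt (hasRadialDerivAt_coneMean T n hd hd' hf'')
    ((continuous_coneMean T (n + 1) hf'').div_const _)
    (continuous_coneMean T n (continuous_of_hasDerivAt hd')).neg

lemma continuousOn_pairDensity {s : Set (Space × ℝ)} {ψ : Space × ℝ → Spinor}
    {A L : Space × ℝ → ℝ} (hψ : ContinuousOn ψ s) (hA : ContinuousOn A s) (hL : ContinuousOn L s)
    (i : Fin 4) : ContinuousOn (pairDensity ψ i A L) s := by
  rw [pairDensity_eq]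
  have hr : ∀ N : Matrix (Fin 4) (Fin 4) ℂ, ContinuousOn (fun p => rowCLM N i (ψ p)) s :=
    fun N => (rowCLM N i).continuous.comp_continuousOn hψ
  refine (hA.smul (hr 1)).add (hL.smul (continuousOn_finsetSum _ fun j _ => ?_))
  exact (contDiff_coord (n := 0) j).continuous.continuousOn.smul (hr _)

/-- With `K n j` the converging mean of order `n` of `g j`, the ansatz is `A = K 0 4 + p K 0 3` and
`2 L = K 1 5 + q K 1 4 + w K 1 3`. Comparing coefficients in the adjoint system gives `e1` to `e4`,
and `e5` cancels the tails of `L` outside the cone. The paired integral is then constant: it is zero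
at `τ₀`, where `ψ` vanishes near the cone, and equals `2 ∫ b ψᵢ` at `τ₁`. -/
lemma integral_bump_eq_zero {ν : ℂ} {τ₀ τ₁ δ c d μ : ℝ} {b : ℝ → ℝ} {g : ℕ → ℝ → ℝ}
    {ψ : Space × ℝ → Spinor} (h01 : τ₀ < τ₁) (hne : ∀ τ ∈ Icc τ₀ τ₁, τ ≠ 0)
    (hψ : IsConformalSolution ν τ₀ τ₁ ψ) (hδ : 0 < δ) (hg : IsProfile δ c d b g)
    (h0 : ∀ x, |‖x‖ - (τ₁ - τ₀)| ≤ δ → ψ (x, τ₀) = 0) {i : Fin 4} (hμ : sgn i * ν = μ)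
    {p q w p' q' w' : ℝ → ℝ} (hp : ∀ τ ≠ 0, HasDerivAt p (p' τ) τ)
    (hq : ∀ τ ≠ 0, HasDerivAt q (q' τ) τ) (hw : ∀ τ ≠ 0, HasDerivAt w (w' τ) τ)
    (hpc : ContDiffOn ℝ 1 p {0}ᶜ) (hqc : ContDiffOn ℝ 1 q {0}ᶜ) (hwc : ContDiffOn ℝ 1 w {0}ᶜ)
    (e1 : ∀ τ ≠ 0, q τ - p τ + μ / τ = 0) (e2 : ∀ τ ≠ 0, p' τ + w τ + μ / τ * p τ = 0)
    (e3 : ∀ τ ≠ 0, q' τ - w τ - μ / τ * q τ = 0) (e4 : ∀ τ ≠ 0, w' τ - μ / τ * w τ = 0)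
    (e5 : ∀ τ ≠ 0, q τ + w τ * (τ₁ - τ) = 0) :
    ∫ x, b ‖x‖ • ψ (x, τ₁) i = 0 := by
  set K : ℕ → ℕ → Space × ℝ → ℝ := fun n j => coneMean τ₁ n (g j) with hK
  have hKd : ∀ n j x, HasRadialDerivAt (K n j) (K (n + 1) (j + 2) x / (2 * (n + 1)))
      (-K n (j + 1) x) x := fun n j x => hasRadialDerivAt_coneMean τ₁ n (hg.hasDerivAt j)
    (hg.hasDerivAt (j + 1)) (hg.continuous (j + 2)) x
  have hKc : ∀ n j, ContDiff ℝ 1 (K n j) := fun n j => contDiff_coneMean τ₁ n (hg.hasDerivAt j)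
    (hg.hasDerivAt (j + 1)) (hg.continuous (j + 2))
  set A : Space × ℝ → ℝ := fun y => K 0 4 y + p y.2 * K 0 3 y with hA
  set L : Space × ℝ → ℝ := fun y => 1 / 2 * K 1 5 y + (q y.2 / 2 * K 1 4 y + w y.2 / 2 * K 1 3 y)
    with hL
  have htime : ∀ {f : ℝ → ℝ}, ContDiffOn ℝ 1 f {0}ᶜ →
      ContDiffOn ℝ 1 (fun y : Space × ℝ => f y.2) (univ ×ˢ Icc τ₀ τ₁) := fun hf =>
    hf.comp contDiff_snd.contDiffOn fun y hy => hne y.2 hy.2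
  have hAc : ContDiffOn ℝ 1 A (univ ×ˢ Icc τ₀ τ₁) :=
    (hKc 0 4).contDiffOn.add ((htime hpc).mul (hKc 0 3).contDiffOn)
  have hLc : ContDiffOn ℝ 1 L (univ ×ˢ Icc τ₀ τ₁) :=
    (contDiffOn_const.mul (hKc 1 5).contDiffOn).add
      ((((htime hqc).div_const 2).mul (hKc 1 4).contDiffOn).add
        (((htime hwc).div_const 2).mul (hKc 1 3).contDiffOn))
  have hvan : ∀ x, ∀ τ ∈ Icc τ₀ τ₁, δ < |‖x‖ - (τ₁ - τ)| → A (x, τ) = 0 ∧ L (x, τ) = 0 := by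
    intro x τ hτ hx
    have hs : 0 ≤ τ₁ - τ := sub_nonneg.2 hτ.2
    simp only [hA, hL, hK, coneMean]
    rcases lt_abs.1 hx with h | h
    · have hr : 0 < ‖x‖ := by linarith
      have hrs : τ₁ - τ + δ < ‖x‖ := by linarith
      rw [hg.mean_zero_outside hr hs hrs 0, hg.mean_zero_outside hr hs hrs 1,
        hg.mean_one_outside hr hs hrs 0, hg.mean_one_four_outside hr hs hrs,
        hg.mean_one_three_outside hr hs hrs]
      refine ⟨by ring, ?_⟩
      -- The tails `-4c/r³` and `-4c(τ₁-τ)/r³` enter with the coefficients `q/2` and `w/2`.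
      linear_combination (-2 * c / ‖x‖ ^ 3) * e5 τ (hne τ hτ)
    · have hrs : ‖x‖ < τ₁ - τ - δ := by linarith
      rw [hg.mean_inside (norm_nonneg x) hrs 0 1, hg.mean_inside (norm_nonneg x) hrs 0 2,
        hg.mean_inside (norm_nonneg x) hrs 1 1, hg.mean_inside (norm_nonneg x) hrs 1 2,
        hg.mean_inside (norm_nonneg x) hrs 1 3]
      simp
  have hfar : ∀ x, ∀ τ ∈ Icc τ₀ τ₁, τ₁ - τ₀ + δ < ‖x‖ → A (x, τ) = 0 ∧ L (x, τ) = 0 :=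
    fun x τ hτ hx => hvan x τ hτ (lt_of_lt_of_le (by linarith [hτ.1]) (le_abs_self _))
  have hcont : ContinuousOn (fun s => ∫ x, pairDensity ψ i A L (x, s)) (Icc τ₀ τ₁) :=
    continuousOn_integral_slab (R := τ₁ - τ₀ + δ)
      (continuousOn_pairDensity hψ.continuousOn hAc.continuousOn hLc.continuousOn i)
      (fun x τ hτ hx => by
        obtain ⟨h1, h2⟩ := hfar x τ hτ hx
        simp [pairDensity, h1, h2])
  have hder : ∀ τ ∈ Ioo τ₀ τ₁, HasDerivAt (fun s => ∫ x, pairDensity ψ i A L (x, s)) 0 τ := by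
    intro τ hτ
    have hsub : (univ : Set Space) ×ˢ Ioo τ₀ τ₁ ⊆ univ ×ˢ Icc τ₀ τ₁ :=
      prod_mono subset_rfl Ioo_subset_Icc_self
    have key := hasDerivAt_integral_pairDensity (R := τ₁ - τ₀ + δ) hψ i (A := A) (L := L)
      (Ar := fun y => K 1 6 y / 2 + p y.2 * (K 1 5 y / 2))
      (At := fun y => -K 0 5 y + (p' y.2 * K 0 3 y + p y.2 * -K 0 4 y))
      (Lr := fun y => 1 / 2 * (K 2 7 y / 4) + (q y.2 / 2 * (K 2 6 y / 4) +
        w y.2 / 2 * (K 2 5 y / 4)))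
      (Lt := fun y => (0 * K 1 5 y + 1 / 2 * -K 1 6 y) + ((q' y.2 / 2 * K 1 4 y +
        q y.2 / 2 * -K 1 5 y) + (w' y.2 / 2 * K 1 3 y + w y.2 / 2 * -K 1 4 y)))
      (hAc.mono hsub) (hLc.mono hsub)
      (fun x s hs => by
        have hs0 := hne s (Ioo_subset_Icc_self hs)
        have h1 := hKd 0 4 (x, s)
        have h2 := HasRadialDerivAt.time_mul (hKd 0 3 (x, s)) (hp s hs0)
        have h3 := HasRadialDerivAt.add h1 h2
        norm_num at h3 ⊢
        exact h3)
      (fun x s hs => by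
        have hs0 := hne s (Ioo_subset_Icc_self hs)
        have h1 := HasRadialDerivAt.time_mul (hKd 1 5 (x, s)) (hasDerivAt_const s (1 / 2 : ℝ))
        have h2 := HasRadialDerivAt.time_mul (hKd 1 4 (x, s)) ((hq s hs0).div_const 2)
        have h3 := HasRadialDerivAt.time_mul (hKd 1 3 (x, s)) ((hw s hs0).div_const 2)
        have h4 := HasRadialDerivAt.add h1 (HasRadialDerivAt.add h2 h3)
        norm_num at h4 ⊢
        exact h4)
      (fun x s hs hx => Or.inr (hfar x s (Ioo_subset_Icc_self hs) hx)) hτ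
    refine key.congr_deriv ?_
    rw [← integral_zero Space ℂ (μ := volume)]
    refine integral_congr_ae (Eventually.of_forall fun x => ?_)
    have hτ0 := hne τ (Ioo_subset_Icc_self hτ)
    have hτ0' : (τ : ℂ) ≠ 0 := Complex.ofReal_ne_zero.2 hτ0
    have m2 : ∀ j, ‖x‖ ^ 2 * K 2 (j + 2) (x, τ) = 8 * K 0 j (x, τ) - 12 * K 1 j (x, τ) :=
      fun j => mean_two_eq (hg.hasDerivAt j) (hg.hasDerivAt (j + 1)) (hg.continuous (j + 2)) _ _
    have m5 := m2 5
    have m4 := m2 4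
    have m3 := m2 3
    simp only [Nat.reduceAdd] at m5 m4 m3
    have z1 : (-K 0 5 (x, τ) + (p' τ * K 0 3 (x, τ) + p τ * -K 0 4 (x, τ))) + 3 * L (x, τ) +
        ‖x‖ ^ 2 * (1 / 2 * (K 2 7 (x, τ) / 4) + (q τ / 2 * (K 2 6 (x, τ) / 4) +
        w τ / 2 * (K 2 5 (x, τ) / 4))) + μ / τ * A (x, τ) = 0 := by
      simp only [hA, hL]
      linear_combination 1 / 8 * m5 + q τ / 8 * m4 + w τ / 8 * m3 + K 0 4 (x, τ) * e1 τ hτ0 +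
        K 0 3 (x, τ) * e2 τ hτ0
    have z2 : (0 * K 1 5 (x, τ) + 1 / 2 * -K 1 6 (x, τ)) + ((q' τ / 2 * K 1 4 (x, τ) +
        q τ / 2 * -K 1 5 (x, τ)) + (w' τ / 2 * K 1 3 (x, τ) + w τ / 2 * -K 1 4 (x, τ))) +
        (K 1 6 (x, τ) / 2 + p τ * (K 1 5 (x, τ) / 2)) - μ / τ * L (x, τ) = 0 := by
      simp only [hL]
      linear_combination K 1 4 (x, τ) / 2 * e3 τ hτ0 + K 1 3 (x, τ) / 2 * e4 τ hτ0 -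
        K 1 5 (x, τ) / 2 * e1 τ hτ0
    have z1' := congrArg (fun t : ℝ => (t : ℂ)) z1
    have z2' := congrArg (fun t : ℝ => (t : ℂ)) z2
    simp only [hμ]
    push_cast at z1' z2' ⊢
    linear_combination ψ (x, τ) i * z1' + xAlpha x (ψ (x, τ)) i * z2'
  have hfin := eqOn_Icc_of_hasDerivAt_zero h01 hcont hder
  have hstart : ∫ x, pairDensity ψ i A L (x, τ₀) = 0 := by
    rw [← integral_zero Space ℂ (μ := volume)]
    refine integral_congr_ae (Eventually.of_forall fun x => ?_)
    by_cases hx : |‖x‖ - (τ₁ - τ₀)| ≤ δ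
    · simp [pairDensity, h0 x hx, xAlpha]
    · obtain ⟨h1, h2⟩ := hvan x τ₀ (left_mem_Icc.2 h01.le) (not_le.1 hx)
      simp [pairDensity, h1, h2]
  have hend : ∫ x, pairDensity ψ i A L (x, τ₁) = ∫ x, (2 : ℝ) • (b ‖x‖ • ψ (x, τ₁) i) := by
    -- The value `2 b` was found by dividing by `r`, so the origin is discarded as a null set.
    have hae : ∀ᵐ x : Space, x ≠ 0 := by
      simp [ae_iff]
    refine integral_congr_ae ?_
    filter_upwards [hae] with x hx
    have hr : ‖x‖ ≠ 0 := norm_ne_zero_iff.2 hx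
    have hτ1 := hne τ₁ (right_mem_Icc.2 h01.le)
    -- At `τ₁` equation `e5` reduces to this; the other unwanted terms are means of odd functions
    -- centred at `0`.
    have hq1 : q τ₁ = 0 := by simpa using e5 τ₁ hτ1
    have hA1 : A (x, τ₁) = 2 * b ‖x‖ := by
      simp only [hA, hK, coneMean, sub_self]
      rw [hg.mean_zero_four_start hr, mean_eq_zero_of_odd (hg.odd (by decide))]
      ring
    have hL1 : L (x, τ₁) = 0 := by
      simp only [hL, hK, coneMean, sub_self, hq1]
      rw [mean_eq_zero_of_odd (hg.odd (n := 5) (by decide)),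
        mean_eq_zero_of_odd (hg.odd (n := 3) (by decide))]
      ring
    rw [pairDensity, hA1, hL1, zero_smul, add_zero, smul_smul]
  rw [hstart, hend, integral_smul] at hfin
  simpa using hfin

/-- By `e4`, `w` is a multiple of `|τ|^μ` on each side of `0`; `e5` then fixes `q` and `e1` fixes
`p`. The remaining condition `e2` can be met with `w = 0` for `μ = 0` and `μ = 1`, with `w = -1/(τ₁
τ)` for `μ = -1`, and for no other `μ`. -/
lemma integral_bump_eq_zero_of_mem {ν : ℂ} {τ₀ τ₁ δ c d μ : ℝ} {b : ℝ → ℝ} {g : ℕ → ℝ → ℝ}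
    {ψ : Space × ℝ → Spinor} (h01 : τ₀ < τ₁) (hne : ∀ τ ∈ Icc τ₀ τ₁, τ ≠ 0)
    (hψ : IsConformalSolution ν τ₀ τ₁ ψ) (hδ : 0 < δ) (hg : IsProfile δ c d b g)
    (h0 : ∀ x, |‖x‖ - (τ₁ - τ₀)| ≤ δ → ψ (x, τ₀) = 0) {i : Fin 4} (hμ : sgn i * ν = μ)
    (hμ3 : μ = 0 ∨ μ = 1 ∨ μ = -1) : ∫ x, b ‖x‖ • ψ (x, τ₁) i = 0 := by
  have hinv : ContDiffOn ℝ 1 (fun τ : ℝ => τ⁻¹) {0}ᶜ := contDiffOn_inv ℝ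
  have hinvd : ∀ τ : ℝ, τ ≠ 0 → HasDerivAt (fun τ : ℝ => τ⁻¹) (-(τ ^ 2)⁻¹) τ :=
    fun τ hτ => hasDerivAt_inv hτ
  have hτ1 := hne τ₁ (right_mem_Icc.2 h01.le)
  rcases hμ3 with rfl | rfl | rfl
  · refine integral_bump_eq_zero h01 hne hψ hδ hg h0 hμ (p := fun _ => 0) (q := fun _ => 0)
      (w := fun _ => 0) (p' := fun _ => 0) (q' := fun _ => 0) (w' := fun _ => 0)
      (fun _ _ => hasDerivAt_const _ _) (fun _ _ => hasDerivAt_const _ _)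
      (fun _ _ => hasDerivAt_const _ _) contDiffOn_const contDiffOn_const contDiffOn_const
      ?_ ?_ ?_ ?_ ?_ <;> simp
  · refine integral_bump_eq_zero h01 hne hψ hδ hg h0 hμ (p := fun τ => τ⁻¹) (q := fun _ => 0)
      (w := fun _ => 0) (p' := fun τ => -(τ ^ 2)⁻¹) (q' := fun _ => 0) (w' := fun _ => 0)
      hinvd (fun _ _ => hasDerivAt_const _ _) (fun _ _ => hasDerivAt_const _ _) hinv
      contDiffOn_const contDiffOn_const ?_ ?_ ?_ ?_ ?_ <;> intro τ hτ <;> simp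
    field_simp
    ring
  · refine integral_bump_eq_zero h01 hne hψ hδ hg h0 hμ (p := fun _ => -τ₁⁻¹)
      (q := fun τ => τ⁻¹ - τ₁⁻¹) (w := fun τ => -τ₁⁻¹ * τ⁻¹) (p' := fun _ => 0)
      (q' := fun τ => -(τ ^ 2)⁻¹) (w' := fun τ => -τ₁⁻¹ * -(τ ^ 2)⁻¹)
      (fun _ _ => hasDerivAt_const _ _) (fun τ hτ => (hinvd τ hτ).sub_const _)
      (fun τ hτ => (hinvd τ hτ).const_mul _) contDiffOn_const (hinv.sub contDiffOn_const)
      (contDiffOn_const.mul hinv) ?_ ?_ ?_ ?_ ?_ <;> intro τ hτ <;> simp <;> field_simp <;> ring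

/-- Huygens' principle in conformal time, at the spatial origin. -/
lemma eq_zero_of_cone {ν : ℂ} {τ₀ τ₁ δ : ℝ} {ψ : Space × ℝ → Spinor} (h01 : τ₀ < τ₁)
    (hne : ∀ τ ∈ Icc τ₀ τ₁, τ ≠ 0) (hψ : IsConformalSolution ν τ₀ τ₁ ψ)
    (hν : ν = 0 ∨ ν = 1 ∨ ν = -1) (hδ : 0 < δ)
    (h0 : ∀ x, |‖x‖ - (τ₁ - τ₀)| ≤ δ → ψ (x, τ₀) = 0) : ψ (0, τ₁) = 0 := by
  funext i
  by_contra hz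
  set z := ψ (0, τ₁) i with hzdef
  have hz' : 0 < ‖z‖ := norm_pos_iff.2 hz
  have hcont : Continuous fun x => ψ (x, τ₁) i :=
    (continuous_apply i).comp (continuous_slice hψ.continuousOn (right_mem_Icc.2 h01.le))
  obtain ⟨η, hη, hball⟩ := Metric.continuousAt_iff.1 (hcont.continuousAt (x := 0)) (‖z‖ / 2)
    (by positivity)
  -- The bump must fit both the initial gap around the cone and a ball where `ψᵢ` differs from `z`
  -- by less than `‖z‖/2`.
  set ε := min δ η with hε
  have hεpos : 0 < ε := lt_min hδ hη
  obtain ⟨c, d, b, g, hg, hbc, hb0, hb1, hbs⟩ := exists_isProfile hεpos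
  have hμ : ∃ μ : ℝ, (sgn i : ℂ) * ν = μ ∧ (μ = 0 ∨ μ = 1 ∨ μ = -1) := by
    rcases hν with rfl | rfl | rfl
    · exact ⟨0, by simp, by simp⟩
    · refine ⟨sgn i, by simp, ?_⟩
      fin_cases i <;> simp [sgn]
    · refine ⟨-sgn i, by simp, ?_⟩
      fin_cases i <;> simp [sgn]
  obtain ⟨μ, hμ, hμ3⟩ := hμ
  have hint := integral_bump_eq_zero_of_mem h01 hne hψ hεpos hg
    (fun x hx => h0 x (hx.trans (min_le_left _ _))) hμ hμ3
  have hbn : Continuous fun x : Space => b ‖x‖ := hbc.comp continuous_norm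
  have hbsupp : HasCompactSupport fun x : Space => b ‖x‖ :=
    hasCompactSupport_of_norm (R := ε) fun x hx => hbs _ (by rw [abs_norm]; exact hx.le)
  have hbi : Integrable fun x : Space => b ‖x‖ := hbn.integrable_of_hasCompactSupport hbsupp
  have hψi : Integrable fun x : Space => b ‖x‖ • ψ (x, τ₁) i :=
    (hbn.smul hcont).integrable_of_hasCompactSupport hbsupp.smul_right
  have hbpos : 0 < ∫ x : Space, b ‖x‖ :=
    hbn.integral_pos_of_hasCompactSupport_nonneg_nonzero hbsupp (fun x => hb0 _) (x := 0)
      (by simp [hb1])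
  -- As the average of `ψᵢ` vanishes, the averaged deviation from `z` is all of `z`, yet it is at
  -- most half as large.
  have hdiff : ∫ x : Space, b ‖x‖ • (z - ψ (x, τ₁) i) = (∫ x : Space, b ‖x‖) • z := by
    simp only [smul_sub]
    rw [integral_sub (hbi.smul_const z) hψi, hint, sub_zero, integral_smul_const]
  have hle : ‖∫ x : Space, b ‖x‖ • (z - ψ (x, τ₁) i)‖ ≤ ∫ x : Space, b ‖x‖ * (‖z‖ / 2) := by
    refine norm_integral_le_of_norm_le (hbi.mul_const _) (Eventually.of_forall fun x => ?_)
    rw [norm_smul, Real.norm_of_nonneg (hb0 _)]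
    by_cases hx : ‖x‖ < ε
    · have := hball (x := x) (by simpa using hx.trans_le (min_le_right _ _))
      rw [dist_eq_norm, norm_sub_rev] at this
      exact mul_le_mul_of_nonneg_left this.le (hb0 _)
    · rw [hbs _ (by rw [abs_norm]; exact not_lt.1 hx)]
      simp
  rw [hdiff, norm_smul, Real.norm_of_nonneg hbpos.le, integral_mul_const] at hle
  nlinarith [mul_pos hbpos hz']

end FLRW

/-! ### Existence of solutions by Fourier superposition -/

namespace FLRW

open MeasureTheory Set Filter Topology

/-! ### Linear differential equations depending on a parameter -/

section LinearODE

variable {P E : Type*} [NormedAddCommGroup E] [NormedSpace ℝ E]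

/-- The terms of the Picard series of `Y' = A Y`, `Y 0 = y₀`. -/
def picardTerm (A : P → ℝ → E →L[ℝ] E) (y₀ : E) : ℕ → P → ℝ → E
  | 0 => fun _ _ => y₀
  | n + 1 => fun p t => ∫ s in (0 : ℝ)..t, A p s (picardTerm A y₀ n p s)

lemma continuous_picardTerm [TopologicalSpace P] [FirstCountableTopology P]
    {A : P → ℝ → E →L[ℝ] E} (hA : Continuous fun q : P × ℝ => A q.1 q.2) (y₀ : E) (n : ℕ) :
    Continuous fun q : P × ℝ => picardTerm A y₀ n q.1 q.2 := by
  induction n with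
  | zero => exact continuous_const
  | succ n ih =>
    simp only [picardTerm]
    refine intervalIntegral.continuous_parametric_intervalIntegral_of_continuous
      (f := fun (q : P × ℝ) s => A q.1 s (picardTerm A y₀ n q.1 s)) (s := fun q => q.2) ?_
      continuous_snd
    have hm : Continuous fun z : (P × ℝ) × ℝ => (z.1.1, z.2) := by fun_prop
    exact (hA.comp hm).clm_apply (ih.comp hm)

lemma norm_picardTerm_le {A : P → ℝ → E →L[ℝ] E} (y₀ : E) {p : P} {C T : ℝ}
    (hC : ∀ s, |s| ≤ T → ‖A p s‖ ≤ C) (hC0 : 0 ≤ C) (n : ℕ) {t : ℝ} (ht : |t| ≤ T) :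
    ‖picardTerm A y₀ n p t‖ ≤ ‖y₀‖ * ((C * |t|) ^ n / n.factorial) := by
  induction n generalizing t with
  | zero => simp [picardTerm]
  | succ n ih =>
    have hsub : ∀ s ∈ uIoc 0 t, |s| ≤ |t| := fun s hs => by
      rcases le_total 0 t with h | h
      · rw [uIoc_of_le h] at hs
        rw [abs_of_pos hs.1, abs_of_nonneg h]; exact hs.2
      · rw [uIoc_of_ge h] at hs
        rw [abs_of_nonpos hs.2, abs_of_nonpos h]; linarith [hs.1]
    simp only [picardTerm]
    refine (intervalIntegral.norm_integral_le_integral_norm_uIoc).trans ?_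
    have hgi : IntegrableOn (fun s => (C * ‖y₀‖ * C ^ n / n.factorial) * |s - 0| ^ n)
        (uIoc 0 t) := by
      rw [← intervalIntegrable_iff]
      exact Continuous.intervalIntegrable (by fun_prop) _ _
    have hle := integral_mono_of_nonneg (μ := volume.restrict (uIoc 0 t))
      (f := fun s => ‖A p s (picardTerm A y₀ n p s)‖)
      (g := fun s => (C * ‖y₀‖ * C ^ n / n.factorial) * |s - 0| ^ n)
      (Eventually.of_forall fun s => norm_nonneg _) hgi
      ((ae_restrict_mem measurableSet_uIoc).mono fun s hs => by
        have hsT := (hsub s hs).trans ht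
        refine ((A p s).le_opNorm _).trans ?_
        refine (mul_le_mul (hC s hsT) (ih hsT) (norm_nonneg _) hC0).trans (le_of_eq ?_)
        simp only [sub_zero, mul_pow]; ring)
    refine hle.trans (le_of_eq ?_)
    rw [integral_const_mul, integral_pow_abs_sub_uIoc, Nat.factorial_succ]
    push_cast
    rw [sub_zero]
    field_simp
    ring

/-- Linear differential equations with continuous coefficients have global solutions, which are
jointly continuous in time and in parameters. -/
theorem exists_linear_ode [TopologicalSpace P] [FirstCountableTopology P] [LocallyCompactSpace P]
    [CompleteSpace E] {A : P → ℝ → E →L[ℝ] E} (hA : Continuous fun q : P × ℝ => A q.1 q.2)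
    (y₀ : E) : ∃ Y : P → ℝ → E, Continuous (fun q : P × ℝ => Y q.1 q.2) ∧ (∀ p, Y p 0 = y₀) ∧
      ∀ p t, HasDerivAt (Y p) (A p t (Y p t)) t := by
  have hsummable : ∀ C T : ℝ, Summable fun n : ℕ => ‖y₀‖ * ((C * T) ^ n / n.factorial) :=
    fun C T => (Real.summable_pow_div_factorial _).mul_left _
  have hbound : ∀ (K : Set P), IsCompact K → ∀ T : ℝ, ∃ C, 0 ≤ C ∧
      ∀ p ∈ K, ∀ s, |s| ≤ T → ‖A p s‖ ≤ C := fun K hK T => by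
    obtain ⟨C, hC⟩ := (hK.prod (isCompact_Icc (a := -T) (b := T))).exists_bound_of_continuousOn
      hA.continuousOn
    exact ⟨max C 0, le_max_right _ _, fun p hp s hs =>
      (hC (p, s) ⟨hp, abs_le.1 hs⟩).trans (le_max_left _ _)⟩
  have hterm : ∀ {C T : ℝ}, 0 ≤ C → ∀ p, (∀ s, |s| ≤ T → ‖A p s‖ ≤ C) → ∀ n t, |t| ≤ T →
      ‖picardTerm A y₀ n p t‖ ≤ ‖y₀‖ * ((C * T) ^ n / n.factorial) := fun hC0 p hC n t ht => by
    refine (norm_picardTerm_le y₀ hC hC0 n ht).trans ?_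
    gcongr
  refine ⟨fun p t => ∑' n, picardTerm A y₀ n p t, ?_, fun p => ?_, fun p t => ?_⟩
  · rw [continuous_iff_continuousAt]
    rintro ⟨p, t⟩
    obtain ⟨K, hK, hKp⟩ := exists_compact_mem_nhds p
    obtain ⟨C, hC0, hC⟩ := hbound K hK (|t| + 1)
    have hc := continuousOn_tsum (s := K ×ˢ Icc (-(|t| + 1)) (|t| + 1))
      (f := fun n (q : P × ℝ) => picardTerm A y₀ n q.1 q.2)
      (fun n => (continuous_picardTerm hA y₀ n).continuousOn) (hsummable C (|t| + 1))
      (fun n q hq => hterm hC0 q.1 (hC q.1 hq.1) n q.2 (abs_le.2 hq.2))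
    refine hc.continuousAt (prod_mem_nhds hKp (Icc_mem_nhds ?_ ?_))
    · linarith [neg_abs_le t]
    · linarith [le_abs_self t]
  · beta_reduce
    rw [tsum_eq_single 0]
    · rfl
    · intro n hn
      obtain ⟨m, rfl⟩ := Nat.exists_eq_succ_of_ne_zero hn
      simp [picardTerm]
  · obtain ⟨C, hC0, hC⟩ := hbound {p} isCompact_singleton (|t| + 1)
    have hCp := hC p rfl
    have hcp : Continuous (A p) := hA.comp (by fun_prop : Continuous fun s => (p, s))
    have htc : ∀ n, Continuous (picardTerm A y₀ n p) := fun n =>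
      (continuous_picardTerm hA y₀ n).comp (by fun_prop : Continuous fun s => (p, s))
    -- Term `0` is constant and term `n + 1` has derivative `A` applied to term `n`: differentiation
    -- shifts the series by one.
    set g' : ℕ → ℝ → E := fun n s => Nat.casesOn n 0 fun m => A p s (picardTerm A y₀ m p s)
      with hg'
    have hIoo : ∀ s ∈ Ioo (-(|t| + 1)) (|t| + 1), |s| ≤ |t| + 1 := fun s hs =>
      (abs_lt.2 hs).le
    have htm : t ∈ Ioo (-(|t| + 1)) (|t| + 1) := abs_lt.1 (by linarith)
    have hsum : ∀ s, |s| ≤ |t| + 1 → Summable fun n => picardTerm A y₀ n p s := fun s hs =>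
      Summable.of_norm_bounded (hsummable C (|t| + 1)) fun n => hterm hC0 p hCp n s hs
    have key := hasDerivAt_tsum_of_isPreconnected (𝕜 := ℝ) (g := fun n => picardTerm A y₀ n p)
      (g' := g') (u := fun n => Nat.casesOn n 0 fun m =>
        C * (‖y₀‖ * ((C * (|t| + 1)) ^ m / m.factorial)))
      ((summable_nat_add_iff 1).1 ((hsummable C (|t| + 1)).mul_left C))
      (isOpen_Ioo (a := -(|t| + 1)) (b := |t| + 1)) isPreconnected_Ioo
      (fun n s hs => by
        cases n with
        | zero => exact hasDerivAt_const _ _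
        | succ m =>
          have hc : Continuous fun s => A p s (picardTerm A y₀ m p s) := hcp.clm_apply (htc m)
          exact intervalIntegral.integral_hasDerivAt_right (hc.intervalIntegrable _ _)
            (hc.stronglyMeasurableAtFilter _ _) hc.continuousAt)
      (fun n s hs => by
        cases n with
        | zero => simp [hg']
        | succ m =>
          exact ((A p s).le_opNorm _).trans (mul_le_mul (hCp s (hIoo s hs))
            (hterm hC0 p hCp m s (hIoo s hs)) (norm_nonneg _) hC0))
      htm (hsum t (hIoo t htm)) htm
    refine key.congr_deriv ?_
    have hs' : Summable fun n => g' n t :=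
      (summable_nat_add_iff 1).1 ((A p t).summable (hsum t (hIoo t htm)))
    rw [hs'.tsum_eq_zero_add, (A p t).map_tsum (hsum t (hIoo t htm))]
    simp [hg']

end LinearODE

end FLRW

namespace FLRW

open MeasureTheory Set Filter Topology Matrix

/-! ### Existence of smooth solutions -/

/-- Multiplication of spinors by a matrix, as a real-linear map. -/
def mulCLM (M : Matrix (Fin 4) (Fin 4) ℂ) : Spinor →L[ℝ] Spinor :=
  LinearMap.toContinuousLinearMap (M.mulVecLin.restrictScalars ℝ)

@[simp]
lemma mulCLM_apply (M : Matrix (Fin 4) (Fin 4) ℂ) (v : Spinor) : mulCLM M v = M *ᵥ v := rfl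

/-- The symbol of the Dirac equation in logarithmic conformal time `σ = log (τ / τ₀)`. -/
def symbol (ν : ℂ) (τ₀ : ℝ) (k : Space) (σ : ℝ) : Spinor →L[ℝ] Spinor :=
  ∑ j, (Real.exp σ * τ₀ * k j) • mulCLM ((-(2 * Real.pi * Complex.I)) • alpha j) +
    mulCLM (ν • gamma 0)

lemma continuous_symbol (ν : ℂ) (τ₀ : ℝ) :
    Continuous fun q : Space × ℝ => symbol ν τ₀ q.1 q.2 := by
  unfold symbol
  refine (continuous_finsetSum _ fun j _ => ?_).add continuous_const
  exact (show Continuous fun q : Space × ℝ => Real.exp q.2 * τ₀ * q.1 j by fun_prop).smul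
    continuous_const

lemma im_dotProduct_alpha (j : Fin 3) (v : Spinor) : (star v ⬝ᵥ (alpha j *ᵥ v)).im = 0 := by
  have h : starRingEnd ℂ (star v ⬝ᵥ (alpha j *ᵥ v)) = star v ⬝ᵥ (alpha j *ᵥ v) := by
    conv_rhs => rw [dotProduct_alpha]
    rw [← Complex.star_def, ← Matrix.star_dotProduct_star]
    simp
  exact Complex.conj_eq_iff_im.1 h

/-- For real `k` the factor `-2πi` makes the wave-vector part anti-Hermitian, so it drops out of the
energy balance and nothing depends on `k`. -/
lemma re_dotProduct_symbol (ν : ℂ) (τ₀ : ℝ) (k : Space) (σ : ℝ) (v : Spinor) :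
    (star v ⬝ᵥ symbol ν τ₀ k σ v).re = ν.re * ∑ i, sgn i * ‖v i‖ ^ 2 := by
  obtain ⟨S, hS⟩ : ∃ S : ℝ, S = ∑ i, sgn i * ‖v i‖ ^ 2 := ⟨_, rfl⟩
  have h1 : star v ⬝ᵥ (gamma 0 *ᵥ v) = (S : ℂ) := by
    simp only [hS, dotProduct, gamma_zero_mulVec, Pi.star_apply, Complex.ofReal_sum,
      Complex.ofReal_mul, Complex.ofReal_pow, ← Complex.conj_mul']
    refine Finset.sum_congr rfl fun i _ => ?_
    rw [Complex.star_def]; ring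
  simp only [symbol, _root_.add_apply, FunLike.coe_sum,
    Finset.sum_apply, _root_.smul_apply, mulCLM_apply, dotProduct_add,
    dotProduct_sum, Matrix.smul_mulVec, dotProduct_smul, Complex.add_re, Complex.re_sum, h1]
  rw [← hS]
  simp [im_dotProduct_alpha]

lemma hasDerivAt_sum_norm_sq {Y : ℝ → Spinor} {Y' : Spinor} {σ : ℝ} (h : HasDerivAt Y Y' σ) :
    HasDerivAt (fun s => ∑ i, ‖Y s i‖ ^ 2) (2 * (star (Y σ) ⬝ᵥ Y').re) σ := by
  have := HasDerivAt.fun_sum (u := Finset.univ) fun i _ => ((hasDerivAt_pi.1 h) i).norm_sq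
  refine this.congr_deriv ?_
  simp only [dotProduct, Complex.re_sum, Finset.mul_sum, Complex.inner]
  refine Finset.sum_congr rfl fun i _ => ?_
  simp
  ring

/-- Uniformity in `k` is the point: the growth rate comes from `ν` alone, so superpositions converge
for every rapidly decaying amplitude. -/
lemma norm_le_of_symbol {ν : ℂ} {τ₀ : ℝ} {k : Space} {Y : ℝ → Spinor}
    (hY : ∀ σ, HasDerivAt Y (symbol ν τ₀ k σ (Y σ)) σ) (h0 : Y 0 = Pi.single 0 1) (σ : ℝ) :
    ‖Y σ‖ ≤ Real.exp (‖ν‖ * |σ|) := by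
  set N := fun s => ∑ i, ‖Y s i‖ ^ 2 with hN
  have hNd : ∀ s, HasDerivAt N (2 * (ν.re * ∑ i, sgn i * ‖Y s i‖ ^ 2)) s := fun s => by
    have := hasDerivAt_sum_norm_sq (hY s)
    rwa [re_dotProduct_symbol] at this
  have hN0 : N 0 = 1 := by simp [hN, h0, Fin.sum_univ_four]
  have hle : ∀ s, |2 * (ν.re * ∑ i, sgn i * ‖Y s i‖ ^ 2)| ≤ 2 * ‖ν‖ * N s := fun s => by
    have h1 : |∑ i, sgn i * ‖Y s i‖ ^ 2| ≤ N s := by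
      refine (Finset.abs_sum_le_sum_abs _ _).trans (Finset.sum_le_sum fun i _ => ?_)
      rw [abs_mul, abs_pow, abs_norm]
      have : |sgn i| = 1 := by fin_cases i <;> simp [sgn]
      rw [this, one_mul]
    rw [abs_mul, abs_mul, abs_two, mul_assoc]
    gcongr
    exact Complex.abs_re_le_norm ν
  have hd : ∀ c s : ℝ, HasDerivAt (fun s => Real.exp (c * s) * N s)
      (Real.exp (c * s) * (c * N s + 2 * (ν.re * ∑ i, sgn i * ‖Y s i‖ ^ 2))) s := fun c s => by
    have h1 : HasDerivAt (fun s => Real.exp (c * s)) (Real.exp (c * s) * c) s := by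
      simpa using ((hasDerivAt_id s).const_mul c).exp
    refine (h1.mul (hNd s)).congr_deriv ?_
    ring
  have hNle : N σ ≤ Real.exp (2 * ‖ν‖ * |σ|) := by
    rcases le_total 0 σ with h | h
    · have hanti : Antitone fun s => Real.exp (-(2 * ‖ν‖) * s) * N s := by
        refine antitone_of_deriv_nonpos (fun s => (hd _ s).differentiableAt) fun s => ?_
        rw [(hd _ s).deriv]
        exact mul_nonpos_of_nonneg_of_nonpos (Real.exp_pos _).le
          (by linarith [(abs_le.1 (hle s)).2])
      have := hanti h
      simp only [mul_zero, Real.exp_zero, hN0, one_mul, neg_mul, Real.exp_neg] at this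
      rw [inv_mul_le_iff₀ (Real.exp_pos _), mul_one] at this
      rwa [abs_of_nonneg h]
    · have hmono : Monotone fun s => Real.exp (2 * ‖ν‖ * s) * N s := by
        refine monotone_of_deriv_nonneg (fun s => (hd _ s).differentiableAt) fun s => ?_
        rw [(hd _ s).deriv]
        exact mul_nonneg (Real.exp_pos _).le (by linarith [(abs_le.1 (hle s)).1])
      have := hmono h
      simp only [mul_zero, Real.exp_zero, hN0, one_mul] at this
      rw [abs_of_nonpos h, mul_neg, Real.exp_neg, ← one_div, le_div_iff₀ (Real.exp_pos _)]
      linarith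
  refine (pi_norm_le_iff_of_nonneg (Real.exp_pos _).le).2 fun i => ?_
  have h1 : ‖Y σ i‖ ^ 2 ≤ N σ :=
    Finset.single_le_sum (f := fun i => ‖Y σ i‖ ^ 2) (fun i _ => by positivity)
      (Finset.mem_univ i)
  have h2 : Real.exp (2 * ‖ν‖ * |σ|) = Real.exp (‖ν‖ * |σ|) ^ 2 := by
    rw [← Real.exp_nat_mul]; congr 1; push_cast; ring
  rw [h2] at hNle
  exact (pow_le_pow_iff_left₀ (norm_nonneg _) (Real.exp_pos _).le two_ne_zero).1 (h1.trans hNle)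

/-- Continuous amplitudes of rapid decay. -/
structure IsAmplitude (g : Space → ℂ) : Prop where
  continuous : Continuous g
  integrable : ∀ n : ℕ, Integrable fun k => ‖k‖ ^ n * ‖g k‖

/-- The amplitude of the derivative in the direction `j`. -/
def derivAmplitude (g : Space → ℂ) (j : Fin 3) (k : Space) : ℂ :=
  2 * Real.pi * Complex.I * k j * g k

lemma IsAmplitude.deriv {g : Space → ℂ} (hg : IsAmplitude g) (j : Fin 3) :
    IsAmplitude (derivAmplitude g j) := by
  have hc : Continuous (derivAmplitude g j) := by
    have := hg.continuous
    unfold derivAmplitude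
    fun_prop
  refine ⟨hc, fun n => ?_⟩
  refine Integrable.mono' ((hg.integrable (n + 1)).const_mul (2 * Real.pi))
    (((continuous_norm.pow n).mul hc.norm).aestronglyMeasurable)
    (Eventually.of_forall fun k => ?_)
  have hkj : |k j| ≤ ‖k‖ := by
    simpa using PiLp.norm_apply_le k j
  rw [Real.norm_of_nonneg (by positivity), derivAmplitude]
  simp only [norm_mul, Complex.norm_real, Complex.norm_I, Complex.norm_ofNat, mul_one,
    Real.norm_eq_abs, abs_of_pos Real.pi_pos]
  calc ‖k‖ ^ n * (2 * Real.pi * |k j| * ‖g k‖) ≤ ‖k‖ ^ n * (2 * Real.pi * ‖k‖ * ‖g k‖) := by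
        gcongr
    _ = 2 * Real.pi * (‖k‖ ^ (n + 1) * ‖g k‖) := by ring

/-- The plane wave `exp (2 π i ⟨k, x⟩)`. -/
def planeWave (k x : Space) : ℂ := Complex.exp (((2 * Real.pi * inner ℝ k x : ℝ) : ℂ) * Complex.I)

lemma norm_planeWave (k x : Space) : ‖planeWave k x‖ = 1 := Complex.norm_exp_ofReal_mul_I _

lemma continuous_planeWave : Continuous fun q : Space × Space => planeWave q.1 q.2 := by
  unfold planeWave
  fun_prop

/-- The mode with wave vector `k` of a superposition of solutions. -/
def modeTerm (Y : Space → ℝ → Spinor) (g : Space → ℂ) (p : Space × ℝ) (k : Space) : Spinor :=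
  (g k * planeWave k p.1) • Y k p.2

/-- Superposition of solutions with amplitude `g`. -/
def superposition (Y : Space → ℝ → Spinor) (g : Space → ℂ) (p : Space × ℝ) : Spinor :=
  ∫ k, modeTerm Y g p k

/-- The space component of the derivative of a superposition in the direction `j`. -/
def spacePart (j : Fin 3) : Spinor →L[ℝ] (Space × ℝ →L[ℝ] Spinor) :=
  ContinuousLinearMap.smulRightL ℝ (Space × ℝ) Spinor
    ((EuclideanSpace.proj (𝕜 := ℝ) j).comp (ContinuousLinearMap.fst ℝ Space ℝ))

/-- The contribution of the derivative in the direction `j` to the time derivative. -/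
def timePart (j : Fin 3) : Spinor →L[ℝ] (Space × ℝ →L[ℝ] Spinor) :=
  (ContinuousLinearMap.smulRightL ℝ (Space × ℝ) Spinor
    (ContinuousLinearMap.snd ℝ Space ℝ)).comp (mulCLM (alpha j))

/-- The part of the derivative of a superposition coming from its derivative amplitudes. -/
def derivPart (τ₀ : ℝ) (j : Fin 3) (σ : ℝ) (u : Spinor) : Space × ℝ →L[ℝ] Spinor :=
  spacePart j u - (Real.exp σ * τ₀) • timePart j u

/-- The part of the derivative of a superposition coming from the zeroth-order term. -/
def massPart (ν : ℂ) : Spinor →L[ℝ] (Space × ℝ →L[ℝ] Spinor) :=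
  (ContinuousLinearMap.smulRightL ℝ (Space × ℝ) Spinor
    (ContinuousLinearMap.snd ℝ Space ℝ)).comp (mulCLM (ν • gamma 0))

lemma continuous_modeTerm {Y : Space → ℝ → Spinor}
    (hYc : Continuous fun q : Space × ℝ => Y q.1 q.2)
    {g : Space → ℂ} (hg : IsAmplitude g) (p : Space × ℝ) :
    Continuous (modeTerm Y g p) := by
  have h1 : Continuous fun k => planeWave k p.1 :=
    continuous_planeWave.comp (by fun_prop : Continuous fun k : Space => (k, p.1))
  have h2 : Continuous fun k => Y k p.2 :=
    hYc.comp (by fun_prop : Continuous fun k : Space => (k, p.2))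
  exact (hg.continuous.mul h1).smul h2

lemma norm_modeTerm_le {ν : ℂ} {τ₀ : ℝ} {Y : Space → ℝ → Spinor}
    (hY0 : ∀ k, Y k 0 = Pi.single 0 1)
    (hY : ∀ k σ, HasDerivAt (Y k) (symbol ν τ₀ k σ (Y k σ)) σ)
    (g : Space → ℂ) (p : Space × ℝ) (k : Space) :
    ‖modeTerm Y g p k‖ ≤ Real.exp (‖ν‖ * |p.2|) * ‖g k‖ := by
  rw [modeTerm, norm_smul, norm_mul, norm_planeWave, mul_one, mul_comm]
  gcongr
  exact norm_le_of_symbol (hY k) (hY0 k) p.2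

lemma integrable_modeTerm {ν : ℂ} {τ₀ : ℝ} {Y : Space → ℝ → Spinor}
    (hYc : Continuous fun q : Space × ℝ => Y q.1 q.2)
    (hY0 : ∀ k, Y k 0 = Pi.single 0 1)
    (hY : ∀ k σ, HasDerivAt (Y k) (symbol ν τ₀ k σ (Y k σ)) σ)
    {g : Space → ℂ} (hg : IsAmplitude g) (p : Space × ℝ) :
    Integrable (modeTerm Y g p) := by
  refine Integrable.mono' ((hg.integrable 0).const_mul (Real.exp (‖ν‖ * |p.2|)))
    (continuous_modeTerm hYc hg p).aestronglyMeasurable (Eventually.of_forall fun k => ?_)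
  simpa using norm_modeTerm_le hY0 hY g p k

/-- Every factor `kⱼ` produced by differentiation, from the plane wave or from the symbol, is
absorbed into `derivAmplitude`. The derivative of a mode is therefore again a combination of modes,
now with other amplitudes. -/
lemma hasFDerivAt_modeTerm {ν : ℂ} {τ₀ : ℝ} {Y : Space → ℝ → Spinor}
    (hY : ∀ k σ, HasDerivAt (Y k) (symbol ν τ₀ k σ (Y k σ)) σ)
    (g : Space → ℂ) (p : Space × ℝ) (k : Space) :
    HasFDerivAt (fun q => modeTerm Y g q k)
      (∑ j, derivPart τ₀ j p.2 (modeTerm Y (derivAmplitude g j) p k) +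
        massPart ν (modeTerm Y g p k)) p := by
  have h1 : HasFDerivAt (fun q : Space × ℝ => ((2 * Real.pi * inner ℝ k q.1 : ℝ) : ℂ) * Complex.I)
      ((Complex.ofRealCLM.comp ((2 * Real.pi) • (innerSL ℝ k).comp
        (ContinuousLinearMap.fst ℝ Space ℝ))).smulRight Complex.I) p := by
    have h := (((innerSL ℝ k).comp (ContinuousLinearMap.fst ℝ Space ℝ)).hasFDerivAt
      (x := p)).const_mul (2 * Real.pi)
    exact (Complex.ofRealCLM.hasFDerivAt.comp p h).mul_const Complex.I |>.congr_fderiv (by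
      ext <;> simp [mul_comm])
  have h2 := (h1.cexp.const_mul (g k))
  have h3 : HasFDerivAt (fun q : Space × ℝ => Y k q.2)
      ((ContinuousLinearMap.snd ℝ Space ℝ).smulRight (symbol ν τ₀ k p.2 (Y k p.2))) p := by
    refine ((hY k p.2).hasFDerivAt.comp p hasFDerivAt_snd).congr_fderiv ?_
    ext <;> simp
  refine (h2.smul h3).congr_fderiv (ContinuousLinearMap.ext fun w => ?_)
  have hin : inner ℝ k w.1 = ∑ j, k j * w.1 j := by
    simp [PiLp.inner_apply, mul_comm]
  funext i
  simp only [modeTerm, planeWave, derivPart, spacePart, timePart, massPart, derivAmplitude,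
    symbol]
  simp [hin, Matrix.neg_mulVec, Fin.sum_univ_three, Matrix.mulVec_smul, Matrix.smul_mulVec]
  ring

lemma integral_sum_add {E ι : Type*} [Fintype ι] [NormedAddCommGroup E] [NormedSpace ℝ E]
    {f : ι → Space → E} {g : Space → E} (hf : ∀ j, Integrable (f j)) (hg : Integrable g) :
    ∫ k, (∑ j, f j k + g k) = (∑ j, ∫ k, f j k) + ∫ k, g k := by
  rw [integral_add (integrable_finsetSum _ fun j _ => hf j) hg,
    integral_finsetSum _ fun j _ => hf j]

/-- The derivative of a mode. -/
def modeDeriv (ν : ℂ) (τ₀ : ℝ) (Y : Space → ℝ → Spinor) (g : Space → ℂ) (p : Space × ℝ)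
    (k : Space) : Space × ℝ →L[ℝ] Spinor :=
  ∑ j, derivPart τ₀ j p.2 (modeTerm Y (derivAmplitude g j) p k) + massPart ν (modeTerm Y g p k)

lemma integrable_derivPart {ν : ℂ} {τ₀ : ℝ} {Y : Space → ℝ → Spinor}
    (hYc : Continuous fun q : Space × ℝ => Y q.1 q.2)
    (hY0 : ∀ k, Y k 0 = Pi.single 0 1)
    (hY : ∀ k σ, HasDerivAt (Y k) (symbol ν τ₀ k σ (Y k σ)) σ)
    {g : Space → ℂ} (hg : IsAmplitude g) (p : Space × ℝ) (j : Fin 3) :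
    Integrable fun k => derivPart τ₀ j p.2 (modeTerm Y (derivAmplitude g j) p k) := by
  have h := integrable_modeTerm hYc hY0 hY (hg.deriv j) p
  exact ((spacePart j).integrable_comp h).sub (((timePart j).integrable_comp h).smul
      (Real.exp p.2 * τ₀))

lemma integral_derivPart {ν : ℂ} {τ₀ : ℝ} {Y : Space → ℝ → Spinor}
    (hYc : Continuous fun q : Space × ℝ => Y q.1 q.2)
    (hY0 : ∀ k, Y k 0 = Pi.single 0 1)
    (hY : ∀ k σ, HasDerivAt (Y k) (symbol ν τ₀ k σ (Y k σ)) σ)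
    {g : Space → ℂ} (hg : IsAmplitude g) (p : Space × ℝ) (j : Fin 3) :
    ∫ k, derivPart τ₀ j p.2 (modeTerm Y (derivAmplitude g j) p k) =
      derivPart τ₀ j p.2 (superposition Y (derivAmplitude g j) p) := by
  have h := integrable_modeTerm hYc hY0 hY (hg.deriv j) p
  simp only [derivPart]
  have h2 : Integrable fun k =>
      (Real.exp p.2 * τ₀) • timePart j (modeTerm Y (derivAmplitude g j) p k) :=
    ((timePart j).integrable_comp h).smul (Real.exp p.2 * τ₀)
  rw [integral_sub ((spacePart j).integrable_comp h) h2, integral_smul,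
    (spacePart j).integral_comp_comm h,
    (timePart j).integral_comp_comm h]
  rfl

lemma integrable_modeDeriv {ν : ℂ} {τ₀ : ℝ} {Y : Space → ℝ → Spinor}
    (hYc : Continuous fun q : Space × ℝ => Y q.1 q.2)
    (hY0 : ∀ k, Y k 0 = Pi.single 0 1)
    (hY : ∀ k σ, HasDerivAt (Y k) (symbol ν τ₀ k σ (Y k σ)) σ)
    {g : Space → ℂ} (hg : IsAmplitude g) (p : Space × ℝ) :
    Integrable (modeDeriv ν τ₀ Y g p) :=
  (integrable_finsetSum Finset.univ fun j _ => integrable_derivPart hYc hY0 hY hg p j).add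
    ((massPart ν).integrable_comp (integrable_modeTerm hYc hY0 hY hg p))

lemma integral_modeDeriv {ν : ℂ} {τ₀ : ℝ} {Y : Space → ℝ → Spinor}
    (hYc : Continuous fun q : Space × ℝ => Y q.1 q.2)
    (hY0 : ∀ k, Y k 0 = Pi.single 0 1)
    (hY : ∀ k σ, HasDerivAt (Y k) (symbol ν τ₀ k σ (Y k σ)) σ)
    {g : Space → ℂ} (hg : IsAmplitude g) (p : Space × ℝ) :
    ∫ k, modeDeriv ν τ₀ Y g p k = ∑ j, derivPart τ₀ j p.2 (superposition Y (derivAmplitude g j) p) +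
        massPart ν (superposition Y g p) := by
  have h := integral_sum_add (fun j => integrable_derivPart hYc hY0 hY hg p j)
    ((massPart ν).integrable_comp (integrable_modeTerm hYc hY0 hY hg p))
  refine h.trans ?_
  rw [(massPart ν).integral_comp_comm (integrable_modeTerm hYc hY0 hY hg p)]
  simp only [integral_derivPart hYc hY0 hY hg p, superposition]

lemma hasFDerivAt_superposition {ν : ℂ} {τ₀ : ℝ} {Y : Space → ℝ → Spinor}
    (hYc : Continuous fun q : Space × ℝ => Y q.1 q.2)
    (hY0 : ∀ k, Y k 0 = Pi.single 0 1)
    (hY : ∀ k σ, HasDerivAt (Y k) (symbol ν τ₀ k σ (Y k σ)) σ)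
    {g : Space → ℂ} (hg : IsAmplitude g) (p : Space × ℝ) :
    HasFDerivAt (superposition Y g)
      (∑ j, derivPart τ₀ j p.2 (superposition Y (derivAmplitude g j) p) +
        massPart ν (superposition Y g p)) p := by
  rw [← integral_modeDeriv hYc hY0 hY hg p]
  set C : Fin 3 → ℝ := fun j =>
    ‖spacePart j‖ + Real.exp (p.2 + 1) * |τ₀| * ‖timePart j‖ with hCdef
  have hC : ∀ j, ∀ σ ∈ Metric.closedBall p.2 1, ∀ u, ‖derivPart τ₀ j σ u‖ ≤ C j * ‖u‖ := by
    intro j σ hσ u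
    have hσ' : σ ≤ p.2 + 1 := by
      rw [Real.closedBall_eq_Icc] at hσ
      exact hσ.2
    rw [derivPart, hCdef, add_mul]
    refine (norm_sub_le _ _).trans (add_le_add ((spacePart j).le_opNorm u) ?_)
    rw [norm_smul, norm_mul, Real.norm_eq_abs, Real.norm_eq_abs, Real.abs_exp, mul_assoc _ _ ‖u‖]
    gcongr
    exact (timePart j).le_opNorm u
  set E := Real.exp (‖ν‖ * (|p.2| + 1)) with hE
  have hterm : ∀ g : Space → ℂ, ∀ q ∈ Metric.closedBall p 1, ∀ k,
      ‖modeTerm Y g q k‖ ≤ E * ‖g k‖ := fun g q hq k => by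
    refine (norm_modeTerm_le hY0 hY g q k).trans ?_
    have h1 : |q.2 - p.2| ≤ 1 := by
      have := (norm_snd_le (q - p)).trans (mem_closedBall_iff_norm.1 hq)
      simpa using this
    have h2 : |q.2| ≤ |p.2| + 1 := by
      have := abs_sub_abs_le_abs_sub q.2 p.2
      linarith
    rw [hE]
    gcongr
  have hq2 : ∀ q ∈ Metric.closedBall p 1, q.2 ∈ Metric.closedBall p.2 1 := fun q hq => by
    rw [mem_closedBall_iff_norm] at hq ⊢
    exact (norm_snd_le (q - p)).trans hq
  refine hasFDerivAt_integral_of_dominated_of_fderiv_le (𝕜 := ℝ) (μ := volume)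
    (F := modeTerm Y g) (F' := modeDeriv ν τ₀ Y g)
    (bound := fun k => ∑ j, C j * (E * ‖derivAmplitude g j k‖) + ‖massPart ν‖ * (E * ‖g k‖))
    (Metric.closedBall_mem_nhds p one_pos) ?_ (integrable_modeTerm hYc hY0 hY hg p) ?_ ?_ ?_ ?_
  · exact Eventually.of_forall fun q => (continuous_modeTerm hYc hg q).aestronglyMeasurable
  · exact (integrable_modeDeriv hYc hY0 hY hg p).aestronglyMeasurable
  · refine Eventually.of_forall fun k q hq => (norm_add_le _ _).trans (add_le_add
      ((norm_sum_le _ _).trans (Finset.sum_le_sum fun j _ => ?_)) ?_)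
    · refine (hC j q.2 (hq2 q hq) _).trans ?_
      exact mul_le_mul_of_nonneg_left (hterm _ q hq k) (by positivity)
    · exact ((massPart ν).le_opNorm _).trans
        (mul_le_mul_of_nonneg_left (hterm _ q hq k) (norm_nonneg _))
  · have h0 : ∀ {g : Space → ℂ}, IsAmplitude g → Integrable fun k => ‖g k‖ := fun hg => by
      simpa using hg.integrable 0
    exact (integrable_finsetSum _ fun j _ => ((h0 (hg.deriv j)).const_mul E).const_mul (C j)).add
      (((h0 hg).const_mul E).const_mul _)
  · exact Eventually.of_forall fun k q _ => hasFDerivAt_modeTerm hY g q k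

lemma contDiff_superposition {ν : ℂ} {τ₀ : ℝ} {Y : Space → ℝ → Spinor}
    (hYc : Continuous fun q : Space × ℝ => Y q.1 q.2)
    (hY0 : ∀ k, Y k 0 = Pi.single 0 1)
    (hY : ∀ k σ, HasDerivAt (Y k) (symbol ν τ₀ k σ (Y k σ)) σ)
    {g : Space → ℂ} (hg : IsAmplitude g) :
    ContDiff ℝ ∞ (superposition Y g) := by
  rw [contDiff_infty]
  intro n
  -- The derivative consists of superpositions with new amplitudes, so the amplitude must vary in
  -- the induction.
  induction n generalizing g with
  | zero =>
    exact contDiff_zero.2 (continuous_iff_continuousAt.2 fun p =>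
      (hasFDerivAt_superposition hYc hY0 hY hg p).continuousAt)
  | succ n ih =>
    have hfd : fderiv ℝ (superposition Y g) = fun p =>
        ∑ j, derivPart τ₀ j p.2 (superposition Y (derivAmplitude g j) p) +
        massPart ν (superposition Y g p) :=
      funext fun p => (hasFDerivAt_superposition hYc hY0 hY hg p).fderiv
    push_cast
    rw [contDiff_succ_iff_fderiv]
    refine ⟨fun p => (hasFDerivAt_superposition hYc hY0 hY hg p).differentiableAt,
      fun h => absurd h (by simp), ?_⟩
    rw [hfd]
    refine (ContDiff.sum fun j _ => ?_).add ((massPart ν).contDiff.comp (ih hg))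
    exact ((spacePart j).contDiff.comp (ih (hg.deriv j))).sub
      (((Real.contDiff_exp.comp contDiff_snd).mul contDiff_const).smul
        ((timePart j).contDiff.comp (ih (hg.deriv j))))

/-- Smooth solutions of the Dirac equation in logarithmic conformal time `σ = log (τ / τ₀)`, with
initial values `h e₀`. -/
theorem exists_log_solution (ν : ℂ) (τ₀ : ℝ) {h : Space → ℂ} (hh : ContDiff ℝ ∞ h)
    (hhc : HasCompactSupport h) : ∃ ψ : Space × ℝ → Spinor, ContDiff ℝ ∞ ψ ∧
      (∀ x, ψ (x, 0) = h x • Pi.single 0 1) ∧ ∀ p : Space × ℝ,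
        timeDeriv ψ p = -((Real.exp p.2 * τ₀) • ∑ j, alpha j *ᵥ spaceDeriv j ψ p) +
          ν • (gamma 0 *ᵥ ψ p) := by
  obtain ⟨Y, hYc, hY0, hY⟩ := exists_linear_ode (continuous_symbol ν τ₀) (Pi.single 0 1 : Spinor)
  set f := hhc.toSchwartzMap hh with hf
  -- The Fourier transform of `h` decays rapidly, and Fourier inversion at `σ = 0` returns the
  -- initial values.
  set g : Space → ℂ := fun k => (FourierTransform.fourier f : SchwartzMap Space ℂ) k with hgdef
  have hg : IsAmplitude g := ⟨(FourierTransform.fourier f).continuous,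
    fun n => (FourierTransform.fourier f).integrable_pow_mul volume n⟩
  refine ⟨superposition Y g, contDiff_superposition hYc hY0 hY hg, fun x => ?_, fun p => ?_⟩
  · have h1 : FourierTransformInv.fourierInv g x = h x := by
      have h2 : (FourierTransformInv.fourierInv (FourierTransform.fourier f) :
        SchwartzMap Space ℂ) x = f x := by simp
      rw [SchwartzMap.fourierInv_coe] at h2
      exact h2
    rw [← h1, Real.fourierInv_eq', superposition, ← integral_smul_const]
    refine integral_congr_ae (Eventually.of_forall fun k => ?_)
    simp only [modeTerm, hY0, planeWave, smul_eq_mul]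
    rw [mul_comm (g k)]
  · simp only [timeDeriv, spaceDeriv, (hasFDerivAt_superposition hYc hY0 hY hg p).fderiv]
    funext i
    simp [derivPart, spacePart, timePart, massPart, Matrix.smul_mulVec, Fin.sum_univ_three]

end FLRW

/-! ### Necessity: moments of sharply propagating waves -/

namespace FLRW

open MeasureTheory Set Filter Topology Matrix

/-! ### The moment system -/

/-- Grönwall's inequality is applied from an interior point `η`, and then `η` tends to `a`, where no
derivative is assumed. -/
lemma norm_le_exp_of_hasDerivAt {E : Type*} [NormedAddCommGroup E] [NormedSpace ℝ E]
    {a b K : ℝ} {f f' : ℝ → E} (hc : ContinuousOn f (Icc a b))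
    (hd : ∀ s ∈ Ioo a b, HasDerivAt f (f' s) s) (hK : ∀ s ∈ Ioo a b, ‖f' s‖ ≤ K * ‖f s‖)
    {t : ℝ} (ht : t ∈ Ico a b) : ‖f t‖ ≤ ‖f a‖ * Real.exp (K * (t - a)) := by
  rcases eq_or_lt_of_le ht.1 with rfl | hat
  · simp
  have h1 : ∀ η ∈ Ioo a t, ‖f t‖ ≤ ‖f η‖ * Real.exp (K * (t - η)) := fun η hη => by
    have := norm_le_gronwallBound_of_norm_deriv_right_le (a := η) (b := t) (δ := ‖f η‖) (K := K)
      (ε := 0) (f := f) (f' := f') (hc.mono (Icc_subset_Icc hη.1.le ht.2.le))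
      (fun s hs => (hd s ⟨hη.1.trans_le hs.1, hs.2.trans ht.2⟩).hasDerivWithinAt) le_rfl
      (fun s hs => by simpa using hK s ⟨hη.1.trans_le hs.1, hs.2.trans ht.2⟩) t
      (right_mem_Icc.2 hη.2.le)
    rwa [gronwallBound_ε0] at this
  have hc' : ContinuousWithinAt (fun η => ‖f η‖ * Real.exp (K * (t - η))) (Ioo a t) a := by
    have h2 : ContinuousWithinAt f (Ioo a t) a :=
      (hc a (left_mem_Icc.2 (hat.trans ht.2).le)).mono fun η hη => ⟨hη.1.le, (hη.2.trans ht.2).le⟩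
    exact h2.norm.mul (by fun_prop : Continuous fun η => Real.exp (K * (t - η))).continuousWithinAt
  have : (𝓝[Ioo a t] a).NeBot := left_nhdsWithin_Ioo_neBot hat
  exact ge_of_tendsto hc' (eventually_nhdsWithin_of_forall h1)

lemma hasDerivAt_unique_of_eqOn {E : Type*} [NormedAddCommGroup E] [NormedSpace ℝ E]
    {a b s : ℝ} {f g : ℝ → E} {f' g' : E} (h : EqOn f g (Ioo a b)) (hs : s ∈ Ioo a b)
    (hf : HasDerivAt f f' s) (hg : HasDerivAt g g' s) : f' = g' :=
  hf.unique (hg.congr_of_eventuallyEq (h.eventuallyEq_of_mem (isOpen_Ioo.mem_nhds hs)))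

/-- The moment system `X' = M X` for `X = (U₀, V₀, U₁, V₁, U₂)`. -/
def momentCLM (q T : ℂ) : (Fin 5 → ℂ) →L[ℝ] (Fin 5 → ℂ) :=
  LinearMap.toContinuousLinearMap
    { toFun := fun X => ![q * X 0, 3 * X 0 - q * X 1, q * X 2 + 2 * X 1 - 2 * T * X 0,
        5 * X 2 - q * X 3 + 2 * T ^ 2 * X 0 - 2 * T * X 1, q * X 4 + 4 * X 3 - 4 * T * X 2]
      map_add' := fun X Y => by
        ext i
        fin_cases i <;> simp <;> ring
      map_smul' := fun r X => by
        ext i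
        fin_cases i <;> simp <;> ring }

lemma momentCLM_apply (q T : ℂ) (X : Fin 5 → ℂ) : momentCLM q T X =
    ![q * X 0, 3 * X 0 - q * X 1, q * X 2 + 2 * X 1 - 2 * T * X 0,
        5 * X 2 - q * X 3 + 2 * T ^ 2 * X 0 - 2 * T * X 1, q * X 4 + 4 * X 3 - 4 * T * X 2] := rfl

lemma continuous_momentCLM : Continuous fun p : ℂ × ℂ => momentCLM p.1 p.2 := by
  rw [continuous_clm_apply]
  intro X
  simp only [momentCLM_apply]
  refine continuous_pi fun i => ?_
  fin_cases i <;> simp <;> fun_prop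

/-- A solution of the moment system, with `U₀ = 1` initially, whose last component vanishes
forces `ν ∈ {0, 1, -1}`. -/
lemma eq_of_moment_system {ν : ℂ} {τ₀ b : ℝ} (hb : 0 < b) (hne : ∀ s ∈ Ioo 0 b, τ₀ + s ≠ 0)
    {X : ℝ → Fin 5 → ℂ} (hc : ContinuousAt X 0) (h0 : X 0 0 = 1)
    (hX : ∀ s ∈ Ioo 0 b, HasDerivAt X (momentCLM (ν / (τ₀ + s : ℝ)) s (X s)) s)
    (h4 : ∀ s ∈ Ioo 0 b, X s 4 = 0) : ν = 0 ∨ ν = 1 ∨ ν = -1 := by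
  by_contra hν
  push Not at hν
  have hX' : ∀ s ∈ Ioo 0 b, ∀ i, HasDerivAt (fun s => X s i)
      (momentCLM (ν / (τ₀ + s : ℝ)) s (X s) i) s := fun s hs => hasDerivAt_pi.1 (hX s hs)
  simp only [momentCLM_apply] at hX'
  have d0 := fun s hs => hX' s hs 0
  have d1 := fun s hs => hX' s hs 1
  have d2 := fun s hs => hX' s hs 2
  have d3 := fun s hs => hX' s hs 3
  have d4 := fun s hs => hX' s hs 4
  simp only [Matrix.cons_val] at d0 d1 d2 d3 d4
  have hs0 : ∀ s ∈ Ioo 0 b, (s : ℂ) ≠ 0 := fun s hs => by exact_mod_cast hs.1.ne'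
  have hτ0 : ∀ s ∈ Ioo 0 b, ((τ₀ : ℂ) + s) ≠ 0 := fun s hs => by exact_mod_cast hne s hs
  have hds : ∀ s : ℝ, HasDerivAt (fun s : ℝ => (s : ℂ)) 1 s := fun s =>
    Complex.ofRealCLM.hasDerivAt
  have hdτ : ∀ s : ℝ, HasDerivAt (fun s : ℝ => (τ₀ : ℂ) + s) 1 s := fun s => (hds s).const_add _
  have hdx : ∀ s ∈ Ioo 0 b, HasDerivAt (fun s : ℝ => (s : ℂ) / ((τ₀ : ℂ) + s))
      ((τ₀ : ℂ) / ((τ₀ : ℂ) + s) ^ 2) s := fun s hs => by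
    refine ((hds s).div (hdτ s) (hτ0 s hs)).congr_deriv ?_
    ring
  simp only [Complex.ofReal_add] at d0 d1 d2 d3 d4
  -- With `U₂ = 0` the equation for `U₂'` becomes algebraic.
  have e3 : ∀ s ∈ Ioo 0 b, X s 3 = s * X s 2 := fun s hs => by
    have := hasDerivAt_unique_of_eqOn (g := fun _ => 0) h4 hs (d4 s hs) (hasDerivAt_const _ _)
    rw [h4 s hs] at this
    linear_combination this / 4
  -- This is the derivative of the relation `V₁ = s U₁`.
  have e2 : ∀ s ∈ Ioo 0 b, (2 - ν / (τ₀ + s) * s) * X s 2 = 2 * s * (X s 1 - s * X s 0) :=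
    fun s hs => by
      have := hasDerivAt_unique_of_eqOn e3 hs (d3 s hs) ((hds s).mul (d2 s hs))
      rw [e3 s hs] at this
      linear_combination this / 2
  -- Inserting `e2` into the equation for `U₁'` leaves `s U₁' = 2 U₁`.
  obtain ⟨c, hc2⟩ : ∃ c : ℂ, ∀ s ∈ Ioo 0 b, X s 2 = c * s ^ 2 := by
    have hd : ∀ s ∈ Ioo 0 b, HasDerivAt (fun s => X s 2 / (s : ℂ) ^ 2) 0 s := fun s hs => by
      refine ((d2 s hs).div ((hds s).fun_pow 2) (pow_ne_zero 2 (hs0 s hs))).congr_deriv ?_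
      rw [div_eq_zero_iff]
      left
      push_cast
      linear_combination (-s : ℂ) * e2 s hs
    have hm : b / 2 ∈ Ioo 0 b := ⟨by linarith, by linarith⟩
    refine ⟨X (b / 2) 2 / ((b / 2 : ℝ) : ℂ) ^ 2, fun s hs => ?_⟩
    have := (convex_Ioo 0 b).norm_image_sub_le_of_norm_hasDerivWithin_le (C := 0)
      (fun u hu => (hd u hu).hasDerivWithinAt) (by simp) hm hs
    rw [zero_mul, norm_le_zero_iff, sub_eq_zero] at this
    rw [← this, div_mul_cancel₀ _ (pow_ne_zero 2 (hs0 s hs))]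
  have e1 : ∀ s ∈ Ioo 0 b, X s 1 - s * X s 0 = c / 2 * (s * (2 - ν * (s / (τ₀ + s)))) :=
    fun s hs => by
      have h1 := e2 s hs
      rw [hc2 s hs] at h1
      refine mul_left_cancel₀ (mul_ne_zero two_ne_zero (hs0 s hs)) ?_
      rw [← h1]
      ring
  -- Differentiating `e1` eliminates `V₀` and determines `U₀` up to `c`.
  have f0 : ∀ s ∈ Ioo 0 b, (1 - ν * (s / (τ₀ + s))) * X s 0 =
      c / 2 + ν * (1 - ν) * c / 4 * (s / (τ₀ + s)) ^ 2 := fun s hs => by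
    have h1 := hasDerivAt_unique_of_eqOn e1 hs ((d1 s hs).sub ((hds s).mul (d0 s hs)))
      (((hds s).mul (((hdx s hs).const_mul ν).const_sub 2)).const_mul (c / 2))
    have h2 : X s 1 = s * X s 0 + c / 2 * (s * (2 - ν * (s / (τ₀ + s)))) := by
      linear_combination e1 s hs
    rw [h2] at h1
    have h3 := hτ0 s hs
    field_simp at h1 ⊢
    linear_combination 2 * h1
  -- A second formula for `U₀`, from differentiating `f0`; cancelling `ν (1 - ν)` uses `ν ≠ 0` and
  -- `ν ≠ 1`.
  have g0 : ∀ s ∈ Ioo 0 b, X s 0 = c / 2 * (1 - s / (τ₀ + s)) := fun s hs => by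
    have h1 := hasDerivAt_unique_of_eqOn f0 hs
      ((((hdx s hs).const_mul ν).const_sub 1).mul (d0 s hs))
      ((((hdx s hs).fun_pow 2).const_mul (ν * (1 - ν) * c / 4)).const_add (c / 2))
    have h3 := hτ0 s hs
    have h4 : ν * (1 - ν) ≠ 0 := mul_ne_zero hν.1 (sub_ne_zero.2 (Ne.symm hν.2.1))
    refine mul_left_cancel₀ (mul_ne_zero h4 (hs0 s hs)) ?_
    push_cast at h1
    simp only [pow_one] at h1
    field_simp at h1 ⊢
    linear_combination h1 / 2
  -- By `g0`, `U₀` is a multiple of `1/(τ₀ + s)`, while its equation reads `U₀' = ν U₀ / (τ₀ + s)`;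
  -- hence `(ν + 1) U₀ = 0`.
  have k0 : ∀ s ∈ Ioo 0 b, X s 0 = 0 := fun s hs => by
    have h1 := hasDerivAt_unique_of_eqOn g0 hs (d0 s hs)
      (((hdx s hs).const_sub 1).const_mul (c / 2))
    have h3 := hτ0 s hs
    have h4 : ν + 1 ≠ 0 := fun h => hν.2.2 (eq_neg_of_add_eq_zero_left h)
    refine mul_left_cancel₀ (mul_ne_zero h4 h3) ?_
    have h5 := g0 s hs
    field_simp at h1 h5
    linear_combination (h1 + h5) / 2
  have hlim : Tendsto (fun s => X s 0) (𝓝[Ioo 0 b] 0) (𝓝 (X 0 0)) :=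
    (((continuous_apply 0).continuousAt.comp hc).tendsto).mono_left nhdsWithin_le_nhds
  have : (𝓝[Ioo 0 b] (0 : ℝ)).NeBot := left_nhdsWithin_Ioo_neBot hb
  have h1 : X 0 0 = 0 := tendsto_nhds_unique hlim
    (tendsto_const_nhds.congr' (eventually_nhdsWithin_of_forall fun s hs => (k0 s hs).symm))
  simp [h0] at h1

end FLRW

namespace FLRW

open MeasureTheory Set Filter Topology Matrix

/-! ### Moments of solutions with respect to powers of `|x|² - (τ - τ₀)²` -/

/-- The weight `(|x|² - (τ - τ₀)²) ^ N`. -/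
def coneWeight (τ₀ : ℝ) (N : ℕ) (p : Space × ℝ) : ℝ := (‖p.1‖ ^ 2 - (p.2 - τ₀) ^ 2) ^ N

lemma contDiff_coneWeight (τ₀ : ℝ) (N : ℕ) : ContDiff ℝ 1 (coneWeight τ₀ N) :=
  ((contDiff_fst.norm_sq ℝ).sub ((contDiff_snd.sub contDiff_const).pow 2)).pow N

/-- The truncated exponent `N - 1` is harmless at `N = 0`, where its coefficient is zero. -/
lemma hasRadialDerivAt_coneWeight (τ₀ : ℝ) (N : ℕ) (p : Space × ℝ) :
    HasRadialDerivAt (coneWeight τ₀ N) (2 * N * coneWeight τ₀ (N - 1) p)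
      (-(2 * N * (p.2 - τ₀) * coneWeight τ₀ (N - 1) p)) p := by
  have h1 : HasFDerivAt (fun p : Space × ℝ => ‖p.1‖ ^ 2)
      (2 • (innerSL ℝ p.1).comp (ContinuousLinearMap.fst ℝ Space ℝ)) p :=
    (hasFDerivAt_fst (𝕜 := ℝ) (p := p)).norm_sq
  have h2 : HasFDerivAt (fun p : Space × ℝ => (p.2 - τ₀) ^ 2)
      ((2 * (p.2 - τ₀)) • ContinuousLinearMap.snd ℝ Space ℝ) p := by
    have h := (((hasDerivAt_id p.2).sub_const τ₀).fun_pow 2).hasFDerivAt.comp p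
      (hasFDerivAt_snd (𝕜 := ℝ) (p := p))
    refine h.congr_fderiv ?_
    ext <;> simp
  refine ((h1.sub h2).pow N).congr_fderiv (ContinuousLinearMap.ext fun w => ?_)
  simp [coneWeight]
  ring

/-- The moment `∫ (|x|² - (τ - τ₀)²) ^ N ψ₀`. -/
def scalarMoment (ψ : Space × ℝ → Spinor) (τ₀ : ℝ) (N : ℕ) (τ : ℝ) : ℂ :=
  ∫ x, (coneWeight τ₀ N (x, τ) : ℂ) * ψ (x, τ) 0

/-- The moment `∫ (|x|² - (τ - τ₀)²) ^ N (∑ⱼ xⱼ αⱼ ψ)₀`. -/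
def vectorMoment (ψ : Space × ℝ → Spinor) (τ₀ : ℝ) (N : ℕ) (τ : ℝ) : ℂ :=
  ∫ x, (coneWeight τ₀ N (x, τ) : ℂ) * xAlpha x (ψ (x, τ)) 0

lemma continuousOn_scalarDensity {s : Set (Space × ℝ)} {ψ : Space × ℝ → Spinor}
    (hψ : ContinuousOn ψ s) (τ₀ : ℝ) (N : ℕ) :
    ContinuousOn (fun p => (coneWeight τ₀ N p : ℂ) * ψ p 0) s :=
  (Complex.continuous_ofReal.comp (contDiff_coneWeight τ₀ N).continuous).continuousOn.mul
    ((continuous_apply 0).comp_continuousOn hψ)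

lemma continuousOn_vectorDensity {s : Set (Space × ℝ)} {ψ : Space × ℝ → Spinor}
    (hψ : ContinuousOn ψ s) (τ₀ : ℝ) (N : ℕ) :
    ContinuousOn (fun p => (coneWeight τ₀ N p : ℂ) * xAlpha p.1 (ψ p) 0) s := by
  refine (Complex.continuous_ofReal.comp (contDiff_coneWeight τ₀ N).continuous).continuousOn.mul ?_
  simp only [xAlpha_apply]
  exact continuousOn_finsetSum _ fun j _ =>
    ((contDiff_coord (n := 0) j).continuous.continuousOn).smul
      ((rowCLM (alpha j) 0).continuous.comp_continuousOn hψ)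

section Moments

variable {ν : ℂ} {τ₀ τ₁ R : ℝ} {ψ : Space × ℝ → Spinor}

lemma continuousOn_scalarMoment (hψ : IsConformalSolution ν τ₀ τ₁ ψ)
    (h0 : ∀ x, ∀ τ ∈ Icc τ₀ τ₁, R < ‖x‖ → ψ (x, τ) = 0) (N : ℕ) :
    ContinuousOn (scalarMoment ψ τ₀ N) (Icc τ₀ τ₁) :=
  continuousOn_integral_slab (R := R) (continuousOn_scalarDensity hψ.continuousOn τ₀ N)
    fun x τ hτ hx => by simp [h0 x τ hτ hx]

lemma continuousOn_vectorMoment (hψ : IsConformalSolution ν τ₀ τ₁ ψ)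
    (h0 : ∀ x, ∀ τ ∈ Icc τ₀ τ₁, R < ‖x‖ → ψ (x, τ) = 0) (N : ℕ) :
    ContinuousOn (vectorMoment ψ τ₀ N) (Icc τ₀ τ₁) :=
  continuousOn_integral_slab (R := R) (continuousOn_vectorDensity hψ.continuousOn τ₀ N)
    fun x τ hτ hx => by simp [h0 x τ hτ hx, xAlpha]

lemma integrable_scalarDensity (hψ : IsConformalSolution ν τ₀ τ₁ ψ)
    (h0 : ∀ x, ∀ τ ∈ Icc τ₀ τ₁, R < ‖x‖ → ψ (x, τ) = 0) (N : ℕ) {τ : ℝ} (hτ : τ ∈ Icc τ₀ τ₁) :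
    Integrable fun x => (coneWeight τ₀ N (x, τ) : ℂ) * ψ (x, τ) 0 :=
  (continuous_slice (continuousOn_scalarDensity hψ.continuousOn τ₀ N)
    hτ).integrable_of_hasCompactSupport (hasCompactSupport_of_norm (R := R) fun x hx => by
      simp [h0 x τ hτ hx])

lemma integrable_vectorDensity (hψ : IsConformalSolution ν τ₀ τ₁ ψ)
    (h0 : ∀ x, ∀ τ ∈ Icc τ₀ τ₁, R < ‖x‖ → ψ (x, τ) = 0) (N : ℕ) {τ : ℝ} (hτ : τ ∈ Icc τ₀ τ₁) :
    Integrable fun x => (coneWeight τ₀ N (x, τ) : ℂ) * xAlpha x (ψ (x, τ)) 0 :=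
  (continuous_slice (continuousOn_vectorDensity hψ.continuousOn τ₀ N)
    hτ).integrable_of_hasCompactSupport (hasCompactSupport_of_norm (R := R) fun x hx => by
      simp [h0 x τ hτ hx, xAlpha])

lemma hasDerivAt_scalarMoment (hψ : IsConformalSolution ν τ₀ τ₁ ψ)
    (h0 : ∀ x, ∀ τ ∈ Icc τ₀ τ₁, R < ‖x‖ → ψ (x, τ) = 0) (N : ℕ) {τ : ℝ} (hτ : τ ∈ Ioo τ₀ τ₁) :
    HasDerivAt (scalarMoment ψ τ₀ N) (ν / τ * scalarMoment ψ τ₀ N τ +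
      2 * N * vectorMoment ψ τ₀ (N - 1) τ -
      2 * N * ((τ - τ₀ : ℝ) : ℂ) * scalarMoment ψ τ₀ (N - 1) τ) τ := by
  have hτ' := Ioo_subset_Icc_self hτ
  have h := hasDerivAt_integral_pairDensity (R := R) hψ 0 (A := coneWeight τ₀ N) (L := fun _ => 0)
    (Ar := fun p => 2 * N * coneWeight τ₀ (N - 1) p)
    (At := fun p => -(2 * N * (p.2 - τ₀) * coneWeight τ₀ (N - 1) p))
    (Lr := fun _ => 0) (Lt := fun _ => 0) (contDiff_coneWeight τ₀ N).contDiffOn contDiffOn_const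
    (fun x τ _ => hasRadialDerivAt_coneWeight τ₀ N (x, τ))
    (fun x τ _ => by simpa [HasRadialDerivAt] using hasFDerivAt_const (0 : ℝ) (x, τ))
    (fun x τ hτ hx => Or.inl (h0 x τ (Ioo_subset_Icc_self hτ) hx)) hτ
  have e : (fun s => ∫ x, pairDensity ψ 0 (coneWeight τ₀ N) (fun _ => 0) (x, s)) =
      scalarMoment ψ τ₀ N := by
    funext s
    simp [pairDensity, scalarMoment]
  rw [e] at h
  refine h.congr_deriv ?_
  simp only [scalarMoment, vectorMoment, ← integral_const_mul]
  have i1 := (integrable_scalarDensity hψ h0 N hτ').const_mul (ν / τ)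
  have i2 := (integrable_vectorDensity hψ h0 (N - 1) hτ').const_mul (2 * N : ℂ)
  have i3 := (integrable_scalarDensity hψ h0 (N - 1) hτ').const_mul
    (2 * N * ((τ - τ₀ : ℝ) : ℂ))
  rw [← integral_add i1 i2, ← integral_sub (i1.fun_add i2) i3]
  refine integral_congr_ae (Eventually.of_forall fun x => ?_)
  simp [sgn]
  ring

lemma hasDerivAt_vectorMoment (hψ : IsConformalSolution ν τ₀ τ₁ ψ)
    (h0 : ∀ x, ∀ τ ∈ Icc τ₀ τ₁, R < ‖x‖ → ψ (x, τ) = 0) (N : ℕ) {τ : ℝ} (hτ : τ ∈ Ioo τ₀ τ₁) :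
    HasDerivAt (vectorMoment ψ τ₀ N) ((3 + 2 * N) * scalarMoment ψ τ₀ N τ -
      ν / τ * vectorMoment ψ τ₀ N τ +
      2 * N * ((τ - τ₀ : ℝ) : ℂ) ^ 2 * scalarMoment ψ τ₀ (N - 1) τ -
      2 * N * ((τ - τ₀ : ℝ) : ℂ) * vectorMoment ψ τ₀ (N - 1) τ) τ := by
  have hτ' := Ioo_subset_Icc_self hτ
  have h := hasDerivAt_integral_pairDensity (R := R) hψ 0 (L := coneWeight τ₀ N) (A := fun _ => 0)
    (Lr := fun p => 2 * N * coneWeight τ₀ (N - 1) p)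
    (Lt := fun p => -(2 * N * (p.2 - τ₀) * coneWeight τ₀ (N - 1) p))
    (Ar := fun _ => 0) (At := fun _ => 0) contDiffOn_const (contDiff_coneWeight τ₀ N).contDiffOn
    (fun x τ _ => by simpa [HasRadialDerivAt] using hasFDerivAt_const (0 : ℝ) (x, τ))
    (fun x τ _ => hasRadialDerivAt_coneWeight τ₀ N (x, τ))
    (fun x τ hτ hx => Or.inl (h0 x τ (Ioo_subset_Icc_self hτ) hx)) hτ
  have e : (fun s => ∫ x, pairDensity ψ 0 (fun _ => 0) (coneWeight τ₀ N) (x, s)) =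
      vectorMoment ψ τ₀ N := by
    funext s
    simp [pairDensity, vectorMoment]
  rw [e] at h
  refine h.congr_deriv ?_
  simp only [scalarMoment, vectorMoment, ← integral_const_mul]
  have i1 := (integrable_scalarDensity hψ h0 N hτ').const_mul (3 + 2 * N : ℂ)
  have i2 := (integrable_vectorDensity hψ h0 N hτ').const_mul (ν / τ)
  have i3 := (integrable_scalarDensity hψ h0 (N - 1) hτ').const_mul
    (2 * N * ((τ - τ₀ : ℝ) : ℂ) ^ 2)
  have i4 := (integrable_vectorDensity hψ h0 (N - 1) hτ').const_mul
    (2 * N * ((τ - τ₀ : ℝ) : ℂ))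
  rw [← integral_sub i1 i2, ← integral_add (i1.sub' i2) i3,
    ← integral_sub ((i1.sub' i2).fun_add i3) i4]
  refine integral_congr_ae (Eventually.of_forall fun x => ?_)
  -- Splitting `‖x‖²` as the cone function plus `(τ - τ₀)²` turns the radial term into moments and
  -- raises the coefficient from `3` to `3 + 2N`.
  have hw : (N : ℂ) * (‖x‖ ^ 2 : ℂ) * coneWeight τ₀ (N - 1) (x, τ) =
      N * coneWeight τ₀ N (x, τ) + N * (τ - τ₀) ^ 2 * coneWeight τ₀ (N - 1) (x, τ) := by
    rcases N with _ | n
    · simp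
    · simp only [coneWeight, Nat.add_sub_cancel, pow_succ]
      push_cast
      ring
  simp [sgn]
  linear_combination (2 * ψ (x, τ) 0) * hw

/-- The first five moments, as a function of `τ - τ₀`. -/
def moments (ψ : Space × ℝ → Spinor) (τ₀ s : ℝ) : Fin 5 → ℂ :=
  ![scalarMoment ψ τ₀ 0 (τ₀ + s), vectorMoment ψ τ₀ 0 (τ₀ + s), scalarMoment ψ τ₀ 1 (τ₀ + s),
    vectorMoment ψ τ₀ 1 (τ₀ + s), scalarMoment ψ τ₀ 2 (τ₀ + s)]

lemma continuousOn_moments (hψ : IsConformalSolution ν τ₀ τ₁ ψ)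
    (h0 : ∀ x, ∀ τ ∈ Icc τ₀ τ₁, R < ‖x‖ → ψ (x, τ) = 0) :
    ContinuousOn (moments ψ τ₀) (Icc 0 (τ₁ - τ₀)) := by
  have hm : MapsTo (fun s => τ₀ + s) (Icc 0 (τ₁ - τ₀)) (Icc τ₀ τ₁) := fun s hs =>
    ⟨by linarith [hs.1], by linarith [hs.2]⟩
  have hu := fun N => (continuousOn_scalarMoment hψ h0 N).comp (by fun_prop) hm
  have hv := fun N => (continuousOn_vectorMoment hψ h0 N).comp (by fun_prop) hm
  refine continuousOn_pi.2 fun i => ?_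
  fin_cases i
  exacts [hu 0, hv 0, hu 1, hv 1, hu 2]

lemma hasDerivAt_moments (hψ : IsConformalSolution ν τ₀ τ₁ ψ)
    (h0 : ∀ x, ∀ τ ∈ Icc τ₀ τ₁, R < ‖x‖ → ψ (x, τ) = 0) {s : ℝ} (hs : s ∈ Ioo 0 (τ₁ - τ₀)) :
    HasDerivAt (moments ψ τ₀) (momentCLM (ν / (τ₀ + s : ℝ)) s (moments ψ τ₀ s)) s := by
  have hm : τ₀ + s ∈ Ioo τ₀ τ₁ := ⟨by linarith [hs.1], by linarith [hs.2]⟩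
  have hu := fun N => (hasDerivAt_scalarMoment hψ h0 N hm).comp_const_add τ₀ s
  have hv := fun N => (hasDerivAt_vectorMoment hψ h0 N hm).comp_const_add τ₀ s
  rw [momentCLM_apply]
  refine hasDerivAt_pi.2 fun i => ?_
  fin_cases i
  · refine (hu 0).congr_deriv ?_
    simp [moments]
  · refine (hv 0).congr_deriv ?_
    simp [moments]
  · refine (hu 1).congr_deriv ?_
    simp [moments]
  · refine (hv 1).congr_deriv ?_
    simp [moments]
    norm_num
  · refine (hu 2).congr_deriv ?_
    simp [moments]
    ring

end Moments

end FLRW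

namespace FLRW

open MeasureTheory Set Filter Topology Matrix

/-! ### Failure of Huygens' principle in conformal time -/

/-- The inequality `u ≤ η u² + η⁻¹` replaces Cauchy–Schwarz; the free parameter `η` is balanced
later against the width of the bump. -/
lemma norm_integral_le_of_energy {R a η : ℝ} {φ : Space → Spinor} {f : Space → ℂ}
    (hφ : Continuous φ) (hφ0 : ∀ x, R < ‖x‖ → φ x = 0) (ha : 0 ≤ a) (hη : 0 < η)
    (hf : ∀ x, ‖f x‖ ≤ a * ‖φ x‖) :
    ‖∫ x, f x‖ ≤ a * (η * (∫ x, ∑ i, ‖φ x i‖ ^ 2) +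
      η⁻¹ * (volume (Metric.closedBall (0 : Space) R)).toReal) := by
  have hi1 : Integrable fun x => ∑ i, ‖φ x i‖ ^ 2 :=
    (continuous_energy.comp hφ).integrable_of_hasCompactSupport
      (hasCompactSupport_of_norm (R := R) fun x hx => by simp [hφ0 x hx])
  have hi2 : Integrable ((Metric.closedBall (0 : Space) R).indicator fun _ => (1 : ℝ)) :=
    (integrable_indicator_iff Metric.isClosed_closedBall.measurableSet).2
      (integrableOn_const (by exact measure_closedBall_lt_top.ne))
  have hi := ((hi1.const_mul η).fun_add (hi2.const_mul η⁻¹)).const_mul a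
  have hle := norm_integral_le_of_norm_le (f := f) hi (Eventually.of_forall fun x => ?_)
  · rw [integral_const_mul, integral_add (hi1.const_mul η) (hi2.const_mul η⁻¹),
      integral_const_mul, integral_const_mul,
      integral_indicator Metric.isClosed_closedBall.measurableSet] at hle
    simpa [Measure.real] using hle
  · refine (hf x).trans (mul_le_mul_of_nonneg_left ?_ ha)
    by_cases hx : ‖x‖ ≤ R
    · rw [indicator_of_mem (by simpa using hx)]
      have h1 : ‖φ x‖ ^ 2 ≤ ∑ i, ‖φ x i‖ ^ 2 := by
        refine (Real.le_sqrt (norm_nonneg _)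
          (Finset.sum_nonneg fun i _ => by positivity)).1
          ((pi_norm_le_iff_of_nonneg (Real.sqrt_nonneg _)).2 fun i => Real.le_sqrt_of_sq_le ?_)
        exact Finset.single_le_sum (f := fun i => ‖φ x i‖ ^ 2) (fun i _ => by positivity)
          (Finset.mem_univ i)
      have h2 : ‖φ x‖ ≤ η * ‖φ x‖ ^ 2 + η⁻¹ * 1 := by
        have h3 : 0 ≤ η⁻¹ * ((η * ‖φ x‖ - 1) ^ 2 + η * ‖φ x‖) := by positivity
        have h4 : η⁻¹ * ((η * ‖φ x‖ - 1) ^ 2 + η * ‖φ x‖) =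
            η * ‖φ x‖ ^ 2 + η⁻¹ * 1 - ‖φ x‖ := by
          field_simp
          ring
        linarith
      exact h2.trans (by gcongr)
    · rw [hφ0 x (not_le.1 hx)]
      simp only [norm_zero, Pi.zero_apply]
      have : 0 ≤ (Metric.closedBall (0 : Space) R).indicator (fun _ => (1 : ℝ)) x :=
        indicator_nonneg (fun _ _ => zero_le_one) x
      positivity

lemma integral_sq_le {g : Space → ℝ} {M : ℝ} (hc : Continuous g) (hs : HasCompactSupport g)
    (h0 : ∀ x, 0 ≤ g x) (h1 : ∫ x, g x = 1) (hle : ∀ x, g x ≤ M) : ∫ x, g x ^ 2 ≤ M := by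
  have hi : Integrable g := hc.integrable_of_hasCompactSupport hs
  have hi2 : Integrable fun x => g x * g x :=
    (hc.mul hc).integrable_of_hasCompactSupport hs.mul_left
  have hmono : ∫ x, g x * g x ≤ ∫ x, M * g x :=
    integral_mono hi2 (hi.const_mul M) fun x => mul_le_mul_of_nonneg_right (hle x) (h0 x)
  simp only [sq]
  rwa [integral_const_mul, h1, mul_one] at hmono

/-- For a nonnegative function of mass one, `∫ h²` is at most its maximum. A normalized bump is
bounded by the inverse volume of its inner ball, here of radius `δ/2`, which gives the factor `8`.
-/
lemma exists_bump : ∃ C : ℝ, 0 ≤ C ∧ ∀ δ : ℝ, 0 < δ → ∃ h : Space → ℝ, ContDiff ℝ ∞ h ∧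
    HasCompactSupport h ∧ (∀ x, δ < ‖x‖ → h x = 0) ∧ (∀ x, 0 ≤ h x) ∧ ∫ x, h x = 1 ∧
    ∫ x, h x ^ 2 ≤ C / δ ^ 3 := by
  obtain ⟨v, hv⟩ : ∃ v : ℝ, v = (volume : Measure Space).real (Metric.ball 0 1) := ⟨_, rfl⟩
  have hvpos : 0 < v := hv ▸
    ENNReal.toReal_pos (Metric.measure_ball_pos _ _ one_pos).ne' measure_ball_lt_top.ne
  refine ⟨8 / v, by positivity, fun δ hδ => ?_⟩
  obtain ⟨f, hf1, hf2⟩ : ∃ f : ContDiffBump (0 : Space), f.rIn = δ / 2 ∧ f.rOut = δ :=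
    ⟨⟨δ / 2, δ, by positivity, by linarith⟩, rfl, rfl⟩
  have hball : (volume : Measure Space).real (Metric.closedBall 0 f.rIn) = (δ / 2) ^ 3 * v := by
    rw [Measure.addHaar_real_closedBall _ _ f.rIn_pos.le, hf1, hv, finrank_euclideanSpace_fin]
  refine ⟨f.normed volume, f.contDiff_normed, f.hasCompactSupport_normed, fun x hx => ?_,
    f.nonneg_normed, f.integral_normed, integral_sq_le f.continuous_normed
      f.hasCompactSupport_normed f.nonneg_normed f.integral_normed fun x => ?_⟩
  · rw [← Function.notMem_support, f.support_normed_eq, hf2]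
    simpa using hx.le
  · have := f.normed_le_div_measure_closedBall_rIn volume x
    rw [hball] at this
    refine this.trans (le_of_eq ?_)
    field_simp
    norm_num

/-- The vector moments vanish because the first diagonal entry of each `αⱼ` is zero. The higher
scalar moments are small because their weight is at most `δ²` on the support. -/
lemma norm_moments_initial_sub_le {τ₀ δ : ℝ} {ψ : Space × ℝ → Spinor} {h : Space → ℝ}
    (hδ1 : δ ≤ 1) (hc : Continuous h) (hs : HasCompactSupport h)
    (hδ : ∀ x, δ < ‖x‖ → h x = 0) (h0 : ∀ x, 0 ≤ h x) (h1 : ∫ x, h x = 1)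
    (hψ : ∀ x, ψ (x, τ₀) = (h x : ℂ) • Pi.single 0 1) (hδ0 : 0 ≤ δ) :
    ‖moments ψ τ₀ 0 - Pi.single 0 1‖ ≤ δ := by
  have hv : ∀ N, vectorMoment ψ τ₀ N τ₀ = 0 := fun N => by
    simp [vectorMoment, hψ, xAlpha, Fin.sum_univ_three, Matrix.mulVec_smul, alpha_zero, alpha_one,
      alpha_two]
  have hu : ∀ N, ‖scalarMoment ψ τ₀ (N + 1) τ₀‖ ≤ δ := fun N => by
    have hle := norm_integral_le_of_norm_le (μ := volume)
      (f := fun x => (coneWeight τ₀ (N + 1) (x, τ₀) : ℂ) * ψ (x, τ₀) 0)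
      ((hc.integrable_of_hasCompactSupport hs).const_mul δ) (Eventually.of_forall fun x => ?_)
    · rwa [integral_const_mul, h1, mul_one] at hle
    · by_cases hx : ‖x‖ ≤ δ
      · simp [hψ, coneWeight, abs_of_nonneg (h0 x)]
        refine mul_le_mul_of_nonneg_right ?_ (h0 x)
        calc (‖x‖ ^ 2) ^ (N + 1) ≤ (δ ^ 2) ^ (N + 1) := by gcongr
          _ = δ ^ (2 * N + 1) * δ := by ring
          _ ≤ 1 * δ := by gcongr; exact pow_le_one₀ hδ0 hδ1
          _ = δ := one_mul δ
      · simp [hψ, hδ x (not_le.1 hx)]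
  have hu0 : scalarMoment ψ τ₀ 0 τ₀ = 1 := by
    simp only [scalarMoment, hψ, coneWeight]
    simp only [pow_zero, Complex.ofReal_one, one_mul, Pi.smul_apply, Pi.single_eq_same,
      smul_eq_mul, mul_one]
    rw [integral_complex_ofReal, h1, Complex.ofReal_one]
  refine (pi_norm_le_iff_of_nonneg hδ0).2 fun i => ?_
  fin_cases i
  · simpa [moments, hu0] using hδ0
  · simpa [moments, hv] using hδ0
  · simpa [moments] using hu 0
  · simpa [moments, hv] using hδ0
  · simpa [moments] using hu 1

/-- On the shell `|‖x‖² - (τ-τ₀)²|` factors into a difference at most `δ` and a sum at most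
`2(τ₁-τ₀) + 1`. The energy controls what remains of `ψ`. -/
lemma norm_scalarMoment_two_le {ν : ℂ} {τ₀ τ₁ c δ η E : ℝ} {ψ : Space × ℝ → Spinor} {h : Space → ℝ}
    (hψ : IsConformalSolution ν τ₀ τ₁ ψ) (hc : 0 < c) (hcτ : ∀ τ ∈ Icc τ₀ τ₁, c ≤ |τ|)
    (hδ0 : 0 ≤ δ) (hδ1 : δ ≤ 1) (hη : 0 < η)
    (hshell : ∀ x, ∀ τ ∈ Icc τ₀ τ₁, ψ (x, τ) ≠ 0 → |‖x‖ - (τ - τ₀)| ≤ δ)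
    (hini : ∀ x, ψ (x, τ₀) = (h x : ℂ) • Pi.single 0 1) (hE : ∫ x, h x ^ 2 ≤ E)
    {τ : ℝ} (hτ : τ ∈ Icc τ₀ τ₁) :
    ‖scalarMoment ψ τ₀ 2 τ‖ ≤ (δ * (2 * (τ₁ - τ₀) + 1)) ^ 2 *
      (η * (Real.exp (2 * ‖ν‖ / c * (τ - τ₀)) * E) +
        η⁻¹ * (volume (Metric.closedBall (0 : Space) (τ₁ - τ₀ + 1))).toReal) := by
  have hR : ∀ x, ∀ τ ∈ Icc τ₀ τ₁, τ₁ - τ₀ + 1 < ‖x‖ → ψ (x, τ) = 0 := fun x τ hτ hx => by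
    by_contra hne
    have := (abs_le.1 (hshell x τ hτ hne)).2
    linarith [hτ.2]
  have hen := energy_le hψ hc hcτ hR hτ
  have hen0 : ∫ x, energyDensity ψ (x, τ₀) ≤ E := by
    refine le_trans (le_of_eq (integral_congr_ae (Eventually.of_forall fun x => ?_))) hE
    simp [energyDensity, hini, Fin.sum_univ_four]
  refine (norm_integral_le_of_energy (φ := fun x => ψ (x, τ)) (R := τ₁ - τ₀ + 1)
    (a := (δ * (2 * (τ₁ - τ₀) + 1)) ^ 2) (η := η) (continuous_slice hψ.continuousOn hτ)
    (fun x hx => hR x τ hτ hx) (by positivity) hη fun x => ?_).trans ?_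
  · by_cases hx : ψ (x, τ) = 0
    · simp [hx]
    rw [norm_mul, Complex.norm_real, coneWeight, norm_pow, Real.norm_eq_abs]
    have h1 := hshell x τ hτ hx
    have h2 := abs_le.1 h1
    have h3 : |‖x‖ ^ 2 - (τ - τ₀) ^ 2| ≤ δ * (2 * (τ₁ - τ₀) + 1) := by
      rw [sq_sub_sq, abs_mul, mul_comm]
      refine mul_le_mul h1 ?_ (abs_nonneg _) hδ0
      rw [abs_of_nonneg (by linarith [norm_nonneg x, hτ.1])]
      linarith [hτ.2]
    gcongr
    exact norm_le_pi_norm _ 0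
  · have h2 : ∫ x, ∑ i, ‖ψ (x, τ) i‖ ^ 2 ≤ Real.exp (2 * ‖ν‖ / c * (τ - τ₀)) * E :=
      hen.trans (mul_le_mul_of_nonneg_left hen0 (Real.exp_pos _).le)
    gcongr

/-- Propagation on thin shells from all small balls is possible for `ν ∈ {0, 1, -1}` only. -/
theorem eq_of_shell {ν : ℂ} {τ₀ τ₁ : ℝ} (h01 : τ₀ < τ₁) (hne : ∀ τ ∈ Icc τ₀ τ₁, τ ≠ 0)
    (H : ∀ δ : ℝ, 0 < δ → ∀ h : Space → ℝ, ContDiff ℝ ∞ h → HasCompactSupport h →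
      (∀ x, δ < ‖x‖ → h x = 0) → ∃ ψ : Space × ℝ → Spinor, IsConformalSolution ν τ₀ τ₁ ψ ∧
        (∀ x, ψ (x, τ₀) = (h x : ℂ) • Pi.single 0 1) ∧
        ∀ x, ∀ τ ∈ Icc τ₀ τ₁, ψ (x, τ) ≠ 0 → |‖x‖ - (τ - τ₀)| ≤ δ) :
    ν = 0 ∨ ν = 1 ∨ ν = -1 := by
  obtain ⟨c, hc, hcτ⟩ : ∃ c : ℝ, 0 < c ∧ ∀ τ ∈ Icc τ₀ τ₁, c ≤ |τ| := by
    obtain ⟨τ, hτ, hmin⟩ := isCompact_Icc.exists_isMinOn (nonempty_Icc.2 h01.le)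
      (continuous_abs.continuousOn (s := Icc τ₀ τ₁))
    exact ⟨|τ|, abs_pos.2 (hne τ hτ), fun s hs => hmin hs⟩
  -- Clamping time to `[τ₀, τ₁]` extends the coefficient `ν/τ` continuously to all real times, as
  -- `exists_linear_ode` requires; its parameter space is trivial here.
  set clamp : ℝ → ℝ := fun s => max τ₀ (min τ₁ (τ₀ + s)) with hclamp
  have hclampc : Continuous clamp := by fun_prop
  have hclamp0 : ∀ s, clamp s ≠ 0 := fun s =>
    hne _ ⟨le_max_left _ _, max_le h01.le (min_le_left _ _)⟩
  have hclampI : ∀ s ∈ Ioo 0 (τ₁ - τ₀), clamp s = τ₀ + s := fun s hs => by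
    rw [hclamp]
    simp only
    rw [min_eq_right (by linarith [hs.2]), max_eq_right (by linarith [hs.1])]
  set A : Unit → ℝ → (Fin 5 → ℂ) →L[ℝ] (Fin 5 → ℂ) := fun _ s => momentCLM (ν / (clamp s : ℝ)) s
    with hA
  have hAc : Continuous fun q : Unit × ℝ => A q.1 q.2 := by
    refine continuous_momentCLM.comp (Continuous.prodMk ?_
      (Complex.continuous_ofReal.comp continuous_snd))
    exact continuous_const.div (Complex.continuous_ofReal.comp (hclampc.comp continuous_snd))
      fun q => by exact_mod_cast hclamp0 q.2
  obtain ⟨Y, hYc, hY0, hY⟩ := exists_linear_ode hAc (Pi.single 0 1 : Fin 5 → ℂ)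
  set X := Y () with hX
  have hXd : ∀ s ∈ Ioo 0 (τ₁ - τ₀), HasDerivAt X (momentCLM (ν / (τ₀ + s : ℝ)) s (X s)) s :=
    fun s hs => by
      have := hY () s
      simp only [hA] at this
      rwa [hclampI s hs] at this
  obtain ⟨K, hK⟩ := (isCompact_Icc (a := (0 : ℝ)) (b := τ₁ - τ₀)).exists_bound_of_continuousOn
    ((hAc.comp (by fun_prop : Continuous fun s : ℝ => ((), s))).continuousOn)
  obtain ⟨C, hC, hbump⟩ := exists_bump
  refine eq_of_moment_system (b := τ₁ - τ₀) (by linarith)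
    (fun s hs => hne _ ⟨by linarith [hs.1], by linarith [hs.2]⟩)
    (hY () 0).continuousAt (by rw [hY0]; simp) hXd fun s hs => ?_
  set B := 2 * (τ₁ - τ₀) + 1 with hB
  set V := (volume (Metric.closedBall (0 : Space) (τ₁ - τ₀ + 1))).toReal with hV
  set G := Real.exp (2 * ‖ν‖ / c * (τ₀ + s - τ₀)) with hG
  -- With `δ = κ²` and `η = κ³` the squared weight contributes `κ⁴` and both terms of the `L¹` bound
  -- are of order `κ⁻³`, leaving `κ`. The first power of the weight would only give `κ⁻¹`, which is
  -- why the second moment is used.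
  have key : ∀ κ ∈ Ioc (0 : ℝ) 1,
      ‖X s 4‖ ≤ (B ^ 2 * (G * C + V) + Real.exp (K * (s - 0))) * κ := by
    intro κ hκ
    have hκ0 := hκ.1
    obtain ⟨h, hh, hhc, hhδ, hh0, hh1, hh2⟩ := hbump (κ ^ 2) (by positivity)
    obtain ⟨ψ, hψ, hini, hshell⟩ := H (κ ^ 2) (by positivity) h hh hhc hhδ
    have hδ1 : κ ^ 2 ≤ 1 := pow_le_one₀ hκ0.le hκ.2
    have hR : ∀ x, ∀ τ ∈ Icc τ₀ τ₁, τ₁ - τ₀ + 1 < ‖x‖ → ψ (x, τ) = 0 := fun x τ hτ hx => by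
      by_contra hne
      have := (abs_le.1 (hshell x τ hτ hne)).2
      linarith [hτ.2]
    have hτs : τ₀ + s ∈ Icc τ₀ τ₁ := ⟨by linarith [hs.1], by linarith [hs.2]⟩
    have m2 := norm_scalarMoment_two_le hψ hc hcτ (by positivity) hδ1 (η := κ ^ 3)
      (by positivity) hshell hini hh2 hτs
    have hm0 := norm_moments_initial_sub_le hδ1 hh.continuous hhc hhδ hh0 hh1 hini (by positivity)
    -- The moments and `X` solve the same linear system, so their difference is controlled by its
    -- initial size.
    have hD := norm_le_exp_of_hasDerivAt (K := K) (f := fun s => moments ψ τ₀ s - X s)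
      (f' := fun s => momentCLM (ν / (τ₀ + s : ℝ)) s (moments ψ τ₀ s - X s))
      ((continuousOn_moments hψ hR).sub fun s _ => (hY () s).continuousAt.continuousWithinAt)
      (fun s hs => by
        rw [map_sub]
        exact (hasDerivAt_moments hψ hR hs).sub (hXd s hs))
      (fun s hs => by
        have h1 := hK s (Ioo_subset_Icc_self hs)
        simp only [Function.comp, hA] at h1
        rw [hclampI s hs] at h1
        exact (ContinuousLinearMap.le_opNorm _ _).trans
          (mul_le_mul_of_nonneg_right h1 (norm_nonneg _)))
      (Ioo_subset_Ico_self hs)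
    have hX0 : X 0 = Pi.single 0 1 := hY0 ()
    simp only [hX0] at hD
    have h4 : ‖X s 4‖ ≤ ‖scalarMoment ψ τ₀ 2 (τ₀ + s)‖ + ‖moments ψ τ₀ s - X s‖ := by
      have h5 := norm_le_pi_norm (moments ψ τ₀ s - X s) 4
      have h6 : X s 4 = scalarMoment ψ τ₀ 2 (τ₀ + s) - (moments ψ τ₀ s - X s) 4 := by
        simp [moments]
      rw [h6]
      exact (norm_sub_le _ _).trans (add_le_add_right h5 _)
    have hκ2 : κ ^ 2 ≤ κ := by nlinarith [hκ.2]
    calc ‖X s 4‖ ≤ (κ ^ 2 * B) ^ 2 * (κ ^ 3 * (G * (C / (κ ^ 2) ^ 3)) + (κ ^ 3)⁻¹ * V) +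
          κ * Real.exp (K * (s - 0)) := by
          refine h4.trans (add_le_add m2 (hD.trans ?_))
          gcongr
          exact hm0.trans hκ2
      _ = _ := by
          field_simp
  have hlim : Tendsto (fun κ : ℝ => (B ^ 2 * (G * C + V) + Real.exp (K * (s - 0))) * κ)
      (𝓝[Ioc 0 1] 0) (𝓝 0) := by
    have h1 : Continuous fun κ : ℝ => (B ^ 2 * (G * C + V) + Real.exp (K * (s - 0))) * κ := by
      fun_prop
    simpa using (h1.tendsto 0).mono_left nhdsWithin_le_nhds
  have : (𝓝[Ioc 0 1] (0 : ℝ)).NeBot := left_nhdsWithin_Ioc_neBot one_pos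
  exact norm_le_zero_iff.1 (ge_of_tendsto hlim (eventually_nhdsWithin_of_forall key))

end FLRW

/-! ### Transfer between cosmic and conformal time -/

namespace FLRW

open MeasureTheory Set Filter Topology Matrix

/-! ### Change of the time variable -/

/-- The field `ρ(τ) Ψ(x + y, θ(τ))`. -/
def pullback (ρ θ : ℝ → ℝ) (y : Space) (Ψ : Space × ℝ → Spinor) (p : Space × ℝ) : Spinor :=
  ρ p.2 • Ψ (p.1 + y, θ p.2)

section Pullback

variable {ρ θ : ℝ → ℝ} {y : Space} {Ψ : Space × ℝ → Spinor}

lemma contDiffOn_pullback {n : WithTop ℕ∞} {s : Set ℝ} {S : Set (Space × ℝ)}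
    (hΨ : ContDiffOn ℝ n Ψ S) (hρ : ContDiffOn ℝ n ρ s) (hθ : ContDiffOn ℝ n θ s)
    (hS : ∀ x, ∀ τ ∈ s, (x + y, θ τ) ∈ S) : ContDiffOn ℝ n (pullback ρ θ y Ψ) (univ ×ˢ s) := by
  have hs : MapsTo Prod.snd ((univ : Set Space) ×ˢ s) s := fun p hp => hp.2
  exact (hρ.comp contDiffOn_snd hs).smul (hΨ.comp ((contDiffOn_fst.add contDiffOn_const).prodMk
    (hθ.comp contDiffOn_snd hs)) fun p hp => hS p.1 p.2 hp.2)

lemma hasFDerivAt_pullback {x : Space} {τ ρ' θ' : ℝ}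
    (hΨ : DifferentiableAt ℝ Ψ (x + y, θ τ)) (hρ : HasDerivAt ρ ρ' τ) (hθ : HasDerivAt θ θ' τ) :
    HasFDerivAt (pullback ρ θ y Ψ)
      (ρ τ • (fderiv ℝ Ψ (x + y, θ τ)).comp ((ContinuousLinearMap.fst ℝ Space ℝ).prod
        (θ' • ContinuousLinearMap.snd ℝ Space ℝ)) +
        (ρ' • ContinuousLinearMap.snd ℝ Space ℝ).smulRight (Ψ (x + y, θ τ))) (x, τ) := by
  have h2 : HasFDerivAt (Prod.snd : Space × ℝ → ℝ) (ContinuousLinearMap.snd ℝ Space ℝ) (x, τ) :=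
    hasFDerivAt_snd
  have h1 : HasFDerivAt (fun p : Space × ℝ => p.1 + y) (ContinuousLinearMap.fst ℝ Space ℝ)
      (x, τ) := hasFDerivAt_fst.add_const y
  have hg := h1.prodMk (hθ.comp_hasFDerivAt (x, τ) h2)
  exact (hρ.comp_hasFDerivAt (x, τ) h2).smul
    (HasFDerivAt.comp (x, τ) (g := Ψ) hΨ.hasFDerivAt hg)

lemma timeDeriv_pullback {x : Space} {τ ρ' θ' : ℝ}
    (hΨ : DifferentiableAt ℝ Ψ (x + y, θ τ)) (hρ : HasDerivAt ρ ρ' τ) (hθ : HasDerivAt θ θ' τ) :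
    timeDeriv (pullback ρ θ y Ψ) (x, τ) =
      (ρ τ * θ') • timeDeriv Ψ (x + y, θ τ) + ρ' • Ψ (x + y, θ τ) := by
  rw [timeDeriv, (hasFDerivAt_pullback hΨ hρ hθ).fderiv]
  have h : fderiv ℝ Ψ (x + y, θ τ) (0, θ') = θ' • fderiv ℝ Ψ (x + y, θ τ) (0, 1) := by
    rw [← map_smul]
    simp
  simp [timeDeriv, h, mul_smul]

lemma spaceDeriv_pullback {x : Space} {τ ρ' θ' : ℝ}
    (hΨ : DifferentiableAt ℝ Ψ (x + y, θ τ)) (hρ : HasDerivAt ρ ρ' τ) (hθ : HasDerivAt θ θ' τ)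
    (j : Fin 3) :
    spaceDeriv j (pullback ρ θ y Ψ) (x, τ) = ρ τ • spaceDeriv j Ψ (x + y, θ τ) := by
  rw [spaceDeriv, (hasFDerivAt_pullback hΨ hρ hθ).fderiv]
  simp [spaceDeriv]

end Pullback

lemma diracOp_eq {a₀ ℓ : ℝ} (ha₀ : 0 < a₀) (m : ℂ) (Ψ : Space × ℝ → Spinor) (x : Space) {t : ℝ}
    (ht : 0 < t) : diracOp (scaleFactor a₀ ℓ) m Ψ (x, t) = Complex.I • (gamma 0 *ᵥ
      (timeDeriv Ψ (x, t) + (1 / scaleFactor a₀ ℓ t) • ∑ j, alpha j *ᵥ spaceDeriv j Ψ (x, t) +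
        (3 * ℓ / (2 * t)) • Ψ (x, t) + (Complex.I * m / t) • (gamma 0 *ᵥ Ψ (x, t)))) := by
  have ha := (scaleFactor_pos (ℓ := ℓ) ha₀ ht).ne'
  have hac : (scaleFactor a₀ ℓ t : ℂ) ≠ 0 := by exact_mod_cast ha
  have htc : (t : ℂ) ≠ 0 := by exact_mod_cast ht.ne'
  have hα : ∀ j (v : Spinor), gamma 0 *ᵥ (alpha j *ᵥ v) = gamma j.succ *ᵥ v := fun j v => by
    rw [Matrix.mulVec_mulVec, alpha, ← Matrix.mul_assoc, gamma_zero_mul_self, Matrix.one_mul]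
  have hγ : gamma 0 *ᵥ (gamma 0 *ᵥ Ψ (x, t)) = Ψ (x, t) := by
    rw [Matrix.mulVec_mulVec, gamma_zero_mul_self, Matrix.one_mulVec]
  simp only [diracOp, (hasDerivAt_scaleFactor a₀ ℓ ht).deriv, Matrix.mulVec_add,
    Matrix.mulVec_smul, Matrix.mulVec_sum, hα, hγ]
  funext i
  simp only [Pi.sub_apply, Pi.add_apply, Pi.smul_apply, Finset.sum_apply, smul_eq_mul,
    Complex.real_smul, Finset.mul_sum, mul_add]
  push_cast
  have h1 : Complex.I * (3 * (ℓ * (scaleFactor a₀ ℓ t : ℂ) / t) / (2 * (scaleFactor a₀ ℓ t : ℂ))) =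
      Complex.I * (3 * ℓ / (2 * t)) := by
    field_simp
  have h2 : m * (t : ℂ)⁻¹ = -(Complex.I * (Complex.I * m / t)) := by
    rw [← mul_div_assoc, ← mul_assoc, Complex.I_mul_I]
    ring
  rw [h1, h2]
  have h3 : ∀ z : ℂ, Complex.I / (scaleFactor a₀ ℓ t : ℂ) * z =
      Complex.I * (1 / (scaleFactor a₀ ℓ t : ℂ) * z) := fun z => by ring
  simp only [h3]
  ring

lemma diracOp_eq_zero_iff {a₀ ℓ : ℝ} (ha₀ : 0 < a₀) (m : ℂ) (Ψ : Space × ℝ → Spinor) (x : Space)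
    {t : ℝ} (ht : 0 < t) : diracOp (scaleFactor a₀ ℓ) m Ψ (x, t) = 0 ↔
      timeDeriv Ψ (x, t) + (1 / scaleFactor a₀ ℓ t) • ∑ j, alpha j *ᵥ spaceDeriv j Ψ (x, t) +
        (3 * ℓ / (2 * t)) • Ψ (x, t) + (Complex.I * m / t) • (gamma 0 *ᵥ Ψ (x, t)) = 0 := by
  rw [diracOp_eq ha₀ m Ψ x ht, smul_eq_zero_iff_right Complex.I_ne_zero]
  refine ⟨fun h => ?_, fun h => by rw [h, Matrix.mulVec_zero]⟩
  have := congrArg (fun v => gamma 0 *ᵥ v) h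
  simpa only [Matrix.mulVec_mulVec, gamma_zero_mul_self, Matrix.one_mulVec,
    Matrix.mulVec_zero] using this

/-- The inverse of the conformal time. -/
def cosmicTime (a₀ ℓ τ : ℝ) : ℝ := (a₀ * ((1 - ℓ) * τ)) ^ (1 - ℓ)⁻¹

section CosmicTime

variable {a₀ ℓ : ℝ}

lemma conformalTime_eq (hℓ : ℓ ≠ 1) {t : ℝ} (ht : 0 < t) :
    conformalTime a₀ ℓ t = t / (scaleFactor a₀ ℓ t * (1 - ℓ)) := by
  have := (Real.rpow_pos_of_pos ht ℓ).ne'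
  have h1 : 1 - ℓ ≠ 0 := sub_ne_zero.2 hℓ.symm
  rw [conformalTime, scaleFactor, Real.rpow_sub ht, Real.rpow_one]
  rcases eq_or_ne a₀ 0 with rfl | ha
  · simp
  field_simp

lemma mul_conformalTime_pos (ha₀ : 0 < a₀) (hℓ : ℓ ≠ 1) {t : ℝ} (ht : 0 < t) :
    0 < (1 - ℓ) * conformalTime a₀ ℓ t := by
  have h1 : 1 - ℓ ≠ 0 := sub_ne_zero.2 hℓ.symm
  have : (1 - ℓ) * conformalTime a₀ ℓ t = t ^ (1 - ℓ) / a₀ := by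
    rw [conformalTime]
    field_simp
  rw [this]
  exact div_pos (Real.rpow_pos_of_pos ht _) ha₀

/-- Conformal time is positive for `ℓ < 1` and negative for `ℓ > 1`. The product with `1 - ℓ` is
positive in both cases, which keeps intervals away from `τ = 0` and the base of the power in
`cosmicTime` positive. -/
lemma mul_pos_of_mem_Icc (ha₀ : 0 < a₀) (hℓ : ℓ ≠ 1) {s t τ : ℝ} (hs : 0 < s) (ht : 0 < t)
    (hτ : τ ∈ Icc (conformalTime a₀ ℓ s) (conformalTime a₀ ℓ t)) : 0 < (1 - ℓ) * τ := by
  have h1 := mul_conformalTime_pos ha₀ hℓ hs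
  have h2 := mul_conformalTime_pos ha₀ hℓ ht
  rcases lt_or_gt_of_ne hℓ with h | h
  · nlinarith [hτ.1]
  · nlinarith [hτ.2]

lemma cosmicTime_pos (ha₀ : 0 < a₀) {τ : ℝ} (hτ : 0 < (1 - ℓ) * τ) : 0 < cosmicTime a₀ ℓ τ :=
  Real.rpow_pos_of_pos (mul_pos ha₀ hτ) _

lemma conformalTime_cosmicTime (ha₀ : 0 < a₀) (hℓ : ℓ ≠ 1) {τ : ℝ} (hτ : 0 < (1 - ℓ) * τ) :
    conformalTime a₀ ℓ (cosmicTime a₀ ℓ τ) = τ := by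
  have h1 : 1 - ℓ ≠ 0 := sub_ne_zero.2 hℓ.symm
  rw [conformalTime, cosmicTime, Real.rpow_inv_rpow (mul_pos ha₀ hτ).le h1]
  field_simp

lemma cosmicTime_conformalTime (ha₀ : 0 < a₀) (hℓ : ℓ ≠ 1) {t : ℝ} (ht : 0 < t) :
    cosmicTime a₀ ℓ (conformalTime a₀ ℓ t) = t := by
  have h1 : 1 - ℓ ≠ 0 := sub_ne_zero.2 hℓ.symm
  have h2 : a₀ * ((1 - ℓ) * conformalTime a₀ ℓ t) = t ^ (1 - ℓ) := by
    rw [conformalTime]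
    field_simp
  rw [cosmicTime, h2, Real.rpow_rpow_inv ht.le h1]

lemma lt_cosmicTime (ha₀ : 0 < a₀) (hℓ : ℓ ≠ 1) {ε τ : ℝ} (hτ : 0 < (1 - ℓ) * τ)
    (h : conformalTime a₀ ℓ ε < τ) : ε < cosmicTime a₀ ℓ τ := by
  by_contra hlt
  rcases eq_or_lt_of_le (not_lt.1 hlt) with heq | hlt
  · rw [← heq, conformalTime_cosmicTime ha₀ hℓ hτ] at h
    exact lt_irrefl _ h
  · have := conformalTime_lt ha₀ hℓ (cosmicTime_pos ha₀ hτ) hlt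
    rw [conformalTime_cosmicTime ha₀ hℓ hτ] at this
    exact lt_asymm h this

lemma hasDerivAt_cosmicTime (ha₀ : 0 < a₀) (hℓ : ℓ ≠ 1) {τ : ℝ} (hτ : 0 < (1 - ℓ) * τ) :
    HasDerivAt (cosmicTime a₀ ℓ) (scaleFactor a₀ ℓ (cosmicTime a₀ ℓ τ)) τ := by
  have h1 : 1 - ℓ ≠ 0 := sub_ne_zero.2 hℓ.symm
  have hb := mul_pos ha₀ hτ
  have h := (((hasDerivAt_id τ).const_mul (1 - ℓ)).const_mul a₀).rpow_const (p := (1 - ℓ)⁻¹)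
    (Or.inl hb.ne')
  refine h.congr_deriv ?_
  have h2 := conformalTime_cosmicTime ha₀ hℓ hτ
  have hp := cosmicTime_pos ha₀ hτ
  have ha := (scaleFactor_pos (ℓ := ℓ) ha₀ hp).ne'
  rw [conformalTime_eq hℓ hp, div_eq_iff (mul_ne_zero ha h1)] at h2
  have hτ0 : τ ≠ 0 := fun h => by simp [h] at hτ
  generalize scaleFactor a₀ ℓ (cosmicTime a₀ ℓ τ) = A at h2 ha ⊢
  simp only [id]
  rw [Real.rpow_sub_one hb.ne', ← cosmicTime, h2]
  field_simp

lemma contDiffAt_cosmicTime {n : WithTop ℕ∞} (ha₀ : 0 < a₀) {τ : ℝ} (hτ : 0 < (1 - ℓ) * τ) :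
    ContDiffAt ℝ n (cosmicTime a₀ ℓ) τ :=
  ContDiffAt.rpow_const_of_ne (by fun_prop) (mul_pos ha₀ hτ).ne'

end CosmicTime

end FLRW

namespace FLRW

open MeasureTheory Set Filter Topology Matrix

/-! ### Huygens' principle -/

section Transfer

variable {a₀ ℓ ε : ℝ} {m : ℂ}

lemma mass_div_conformalTime (ha₀ : 0 < a₀) (hℓ : ℓ ≠ 1) (m : ℂ) {t : ℝ} (ht : 0 < t) :
    Complex.I * m / (ℓ - 1) / conformalTime a₀ ℓ t =
      -(scaleFactor a₀ ℓ t * (Complex.I * m / t)) := by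
  have h1 : (1 - ℓ : ℂ) ≠ 0 := by exact_mod_cast sub_ne_zero.2 hℓ.symm
  have h2 : (ℓ - 1 : ℂ) ≠ 0 := by exact_mod_cast sub_ne_zero.2 hℓ
  have ha : (scaleFactor a₀ ℓ t : ℂ) ≠ 0 := by exact_mod_cast (scaleFactor_pos ha₀ ht).ne'
  have htc : (t : ℂ) ≠ 0 := by exact_mod_cast ht.ne'
  rw [conformalTime_eq hℓ ht]
  push_cast
  rw [show (1 - ℓ : ℂ) = -(ℓ - 1) by ring]
  field_simp

/-- Up to a constant the factor `t^(3ℓ/2)` is `a^(3/2)`, which absorbs the term `3a'/(2a)`, and `dt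
= a dτ` removes `1/a` from the spatial part. The shift by `y` moves a chosen point to the origin. -/
lemma isConformalSolution_of_isCauchySolution (ha₀ : 0 < a₀) (hℓ : ℓ ≠ 1) (hε : 0 < ε) {t : ℝ}
    (ht : ε < t) {Φ : Space → Spinor} {Ψ : Space × ℝ → Spinor}
    (hΨ : IsCauchySolution (scaleFactor a₀ ℓ) m ε Φ Ψ) (y : Space) :
    IsConformalSolution (Complex.I * m / (ℓ - 1)) (conformalTime a₀ ℓ ε) (conformalTime a₀ ℓ t)
      (pullback (fun τ => cosmicTime a₀ ℓ τ ^ (3 * ℓ / 2)) (cosmicTime a₀ ℓ) y Ψ) := by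
  have hpos : ∀ τ ∈ Icc (conformalTime a₀ ℓ ε) (conformalTime a₀ ℓ t), 0 < (1 - ℓ) * τ :=
    fun τ hτ => mul_pos_of_mem_Icc ha₀ hℓ hε (hε.trans ht) hτ
  have hθ : ContDiffOn ℝ 1 (cosmicTime a₀ ℓ) (Icc (conformalTime a₀ ℓ ε) (conformalTime a₀ ℓ t)) :=
    fun τ hτ => (contDiffAt_cosmicTime ha₀ (hpos τ hτ)).contDiffWithinAt
  have hρ : ContDiffOn ℝ 1 (fun τ => cosmicTime a₀ ℓ τ ^ (3 * ℓ / 2))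
      (Icc (conformalTime a₀ ℓ ε) (conformalTime a₀ ℓ t)) :=
    hθ.rpow_const_of_ne fun τ hτ => (cosmicTime_pos ha₀ (hpos τ hτ)).ne'
  have hle : ∀ τ ∈ Icc (conformalTime a₀ ℓ ε) (conformalTime a₀ ℓ t), ε ≤ cosmicTime a₀ ℓ τ := by
    intro τ hτ
    rcases eq_or_lt_of_le hτ.1 with h | h
    · rw [← h, cosmicTime_conformalTime ha₀ hℓ hε]
    · exact (lt_cosmicTime ha₀ hℓ (hpos τ hτ) h).le
  have hsmooth : ContDiffOn ℝ 1 Ψ {p | ε ≤ p.2} := hΨ.smooth.of_le (by exact_mod_cast le_top)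
  have hC := contDiffOn_pullback (y := y) hsmooth hρ hθ fun x τ hτ => hle τ hτ
  refine ⟨hC.continuousOn, hC.mono (prod_mono subset_rfl Ioo_subset_Icc_self), fun x τ hτ => ?_⟩
  have hτ' := Ioo_subset_Icc_self hτ
  have hlt := lt_cosmicTime ha₀ hℓ (hpos τ hτ') hτ.1
  have hct := cosmicTime_pos ha₀ (hpos τ hτ')
  have hdiff : DifferentiableAt ℝ Ψ (x + y, cosmicTime a₀ ℓ τ) :=
    (hsmooth.differentiableOn one_ne_zero).differentiableAt
      (Filter.mem_of_superset ((isOpen_lt continuous_const continuous_snd).mem_nhds hlt)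
        fun p (hp : ε < p.2) => hp.le)
  have hθd := hasDerivAt_cosmicTime ha₀ hℓ (hpos τ hτ')
  have hρd := hθd.rpow_const (p := 3 * ℓ / 2) (Or.inl hct.ne')
  rw [timeDeriv_pullback hdiff hρd hθd]
  simp only [spaceDeriv_pullback hdiff hρd hθd]
  have hZ := (diracOp_eq_zero_iff ha₀ m Ψ (x + y) hct).1 (hΨ.dirac (x + y) _ hlt)
  have hν := mass_div_conformalTime ha₀ hℓ m hct
  rw [conformalTime_cosmicTime ha₀ hℓ (hpos τ hτ')] at hν
  rw [hν]
  have ha : (scaleFactor a₀ ℓ (cosmicTime a₀ ℓ τ) : ℂ) ≠ 0 := by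
    exact_mod_cast (scaleFactor_pos ha₀ hct).ne'
  have htc : (cosmicTime a₀ ℓ τ : ℂ) ≠ 0 := by exact_mod_cast hct.ne'
  simp only [pullback, Matrix.mulVec_smul, Real.rpow_sub_one hct.ne']
  funext i
  have hZi := congrFun hZ i
  simp only [Pi.add_apply, Pi.smul_apply, Finset.sum_apply, Complex.real_smul, smul_eq_mul,
    ← Finset.mul_sum, Pi.zero_apply] at hZi ⊢
  push_cast at hZi ⊢
  generalize (∑ j, (alpha j *ᵥ spaceDeriv j Ψ (x + y, cosmicTime a₀ ℓ τ)) i) = S at hZi ⊢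
  field_simp at hZi ⊢
  linear_combination ((cosmicTime a₀ ℓ τ ^ (3 * ℓ / 2) : ℝ) : ℂ) * hZi

lemma huygensPrinciple_of_eq (ha₀ : 0 < a₀) (hℓ : ℓ ≠ 1) (hε : 0 < ε)
    (hν : Complex.I * m / (ℓ - 1) = 0 ∨ Complex.I * m / (ℓ - 1) = 1 ∨
      Complex.I * m / (ℓ - 1) = -1) : HuygensPrinciple (scaleFactor a₀ ℓ) m ε := by
  intro Φ _ hΦc Ψ hΨ x t ht hreach
  set τ₀ := conformalTime a₀ ℓ ε with hτ₀
  set τ₁ := conformalTime a₀ ℓ t with hτ₁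
  have h01 : τ₀ < τ₁ := conformalTime_lt ha₀ hℓ hε ht
  have hne : ∀ τ ∈ Icc τ₀ τ₁, τ ≠ 0 := fun τ hτ h => by
    have := mul_pos_of_mem_Icc ha₀ hℓ hε (hε.trans ht) hτ
    simp [h] at this
  -- The compact support misses the sphere of radius `τ₁ - τ₀` around `x`; half of the minimal gap
  -- gives a strict inequality.
  obtain ⟨δ, hδ, hfar⟩ : ∃ δ : ℝ, 0 < δ ∧ ∀ z ∈ tsupport Φ, δ < |‖z - x‖ - (τ₁ - τ₀)| := by
    rcases (tsupport Φ).eq_empty_or_nonempty with he | hn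
    · exact ⟨1, one_pos, by simp [he]⟩
    obtain ⟨z, hz, hmin⟩ := hΦc.isCompact.exists_isMinOn hn
      (f := fun z => |‖z - x‖ - (τ₁ - τ₀)|) (by fun_prop)
    have hpos : 0 < |‖z - x‖ - (τ₁ - τ₀)| := by
      refine abs_pos.2 (sub_ne_zero.2 fun h => hreach z hz ?_)
      rw [norm_sub_rev] at h
      exact nullReachable_of_norm_sub_eq ha₀ hℓ hε ht h
    refine ⟨|‖z - x‖ - (τ₁ - τ₀)| / 2, by positivity, fun w hw => ?_⟩
    have : |‖z - x‖ - (τ₁ - τ₀)| ≤ |‖w - x‖ - (τ₁ - τ₀)| := hmin hw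
    linarith
  have h := eq_zero_of_cone h01 hne (isConformalSolution_of_isCauchySolution ha₀ hℓ hε ht hΨ x)
    hν hδ fun z hz => by
      have hΦ : Φ (z + x) = 0 := by
        by_contra hne
        have := hfar _ (subset_tsupport _ hne)
        rw [add_sub_cancel_right] at this
        linarith
      simp only [pullback, hτ₀]
      rw [cosmicTime_conformalTime ha₀ hℓ hε, hΨ.initial, hΦ, smul_zero]
  have ht0 := hε.trans ht
  simp only [pullback, hτ₁, zero_add] at h
  rw [cosmicTime_conformalTime ha₀ hℓ ht0] at h
  exact (smul_eq_zero.1 h).resolve_left (Real.rpow_pos_of_pos ht0 _).ne'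

lemma isConformalSolution_log {ν : ℂ} {τ₀ τ₁ : ℝ} {ψ : Space × ℝ → Spinor}
    (hψ : ContDiff ℝ ∞ ψ)
    (heq : ∀ p : Space × ℝ, timeDeriv ψ p =
      -((Real.exp p.2 * τ₀) • ∑ j, alpha j *ᵥ spaceDeriv j ψ p) + ν • (gamma 0 *ᵥ ψ p))
    (hpos : ∀ τ ∈ Icc τ₀ τ₁, 0 < τ / τ₀) :
    IsConformalSolution ν τ₀ τ₁ (pullback (fun _ => 1) (fun τ => Real.log (τ / τ₀)) 0 ψ) := by
  have hlog : ContDiffOn ℝ 1 (fun τ => Real.log (τ / τ₀)) (Icc τ₀ τ₁) :=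
    ContDiffOn.log (contDiff_id.div_const τ₀).contDiffOn fun τ hτ => (hpos τ hτ).ne'
  have hC := contDiffOn_pullback (y := 0) (S := univ)
    ((hψ.of_le (by exact_mod_cast le_top)).contDiffOn (n := 1)) (contDiffOn_const (c := (1 : ℝ)))
    hlog fun _ _ _ => mem_univ _
  refine ⟨hC.continuousOn, hC.mono (prod_mono subset_rfl Ioo_subset_Icc_self), fun x τ hτ => ?_⟩
  have hp := hpos τ (Ioo_subset_Icc_self hτ)
  have hτ0 : τ ≠ 0 := fun h => by simp [h] at hp
  have hτ₀ : τ₀ ≠ 0 := fun h => by simp [h] at hp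
  have hθd : HasDerivAt (fun τ => Real.log (τ / τ₀)) τ⁻¹ τ := by
    refine (((hasDerivAt_id τ).div_const τ₀).log hp.ne').congr_deriv ?_
    simp only [id]
    field_simp
  have hd : DifferentiableAt ℝ ψ (x + 0, Real.log (τ / τ₀)) :=
    (hψ.differentiable (by simp)).differentiableAt
  rw [timeDeriv_pullback (ρ := fun _ => 1) (θ := fun τ => Real.log (τ / τ₀)) hd
    (hasDerivAt_const τ (1 : ℝ)) hθd, heq]
  simp only [spaceDeriv_pullback (ρ := fun _ => 1) (θ := fun τ => Real.log (τ / τ₀)) hd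
    (hasDerivAt_const τ (1 : ℝ)) hθd, Real.exp_log hp, pullback]
  have hτc : (τ : ℂ) ≠ 0 := by exact_mod_cast hτ0
  rw [div_mul_cancel₀ _ hτ₀]
  funext i
  simp only [Pi.add_apply, Pi.neg_apply, Pi.smul_apply, Finset.sum_apply, Complex.real_smul,
    smul_eq_mul, one_smul]
  push_cast
  field_simp
  ring

/-- Since `τ/τ₀ = (t/ε)^(1-ℓ)`, logarithmic conformal time is `(1-ℓ) log (t/ε)`. The power of `t/ε`
undoes the rescaling by `t^(3ℓ/2)` and is normalized to `1` at `t = ε`. -/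
lemma isCauchySolution_log (ha₀ : 0 < a₀) (hℓ : ℓ ≠ 1) (hε : 0 < ε) {ψ : Space × ℝ → Spinor}
    (hψ : ContDiff ℝ ∞ ψ)
    (heq : ∀ p : Space × ℝ, timeDeriv ψ p =
      -((Real.exp p.2 * conformalTime a₀ ℓ ε) • ∑ j, alpha j *ᵥ spaceDeriv j ψ p) +
        (Complex.I * m / (ℓ - 1)) • (gamma 0 *ᵥ ψ p)) :
    IsCauchySolution (scaleFactor a₀ ℓ) m ε (fun x => ψ (x, 0))
      (pullback (fun t => (t / ε) ^ (-(3 * ℓ / 2))) (fun t => (1 - ℓ) * Real.log (t / ε)) 0 ψ) := by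
  have hdiv : ContDiffOn ℝ ∞ (fun t => t / ε) (Ici ε) := (contDiff_id.div_const ε).contDiffOn
  have hdiv0 : ∀ t ∈ Ici ε, t / ε ≠ 0 := fun t ht => (div_pos (hε.trans_le ht) hε).ne'
  have hC := contDiffOn_pullback (y := 0) (S := univ) (hψ.contDiffOn)
    (hdiv.rpow_const_of_ne (p := -(3 * ℓ / 2)) hdiv0)
    ((contDiffOn_const (c := 1 - ℓ)).mul (hdiv.log hdiv0)) fun _ _ _ => mem_univ _
  refine ⟨hC.mono fun p hp => ⟨mem_univ _, hp⟩, fun x t ht => ?_, fun x => ?_⟩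
  · have ht0 := hε.trans ht
    have hte := div_pos ht0 hε
    have hd0 : HasDerivAt (fun t => t / ε) (1 / ε) t := (hasDerivAt_id t).div_const ε
    have hθd : HasDerivAt (fun t => (1 - ℓ) * Real.log (t / ε)) ((1 - ℓ) / t) t := by
      refine ((hd0.log hte.ne').const_mul (1 - ℓ)).congr_deriv ?_
      field_simp
    have hρd : HasDerivAt (fun t => (t / ε) ^ (-(3 * ℓ / 2)))
        (-(3 * ℓ / 2) / t * (t / ε) ^ (-(3 * ℓ / 2))) t := by
      refine (hd0.rpow_const (p := -(3 * ℓ / 2)) (Or.inl hte.ne')).congr_deriv ?_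
      rw [Real.rpow_sub_one hte.ne']
      field_simp
    have hd : DifferentiableAt ℝ ψ (x + 0, (1 - ℓ) * Real.log (t / ε)) :=
      (hψ.differentiable (by simp)).differentiableAt
    have hexp : Real.exp ((1 - ℓ) * Real.log (t / ε)) * conformalTime a₀ ℓ ε =
        t / (scaleFactor a₀ ℓ t * (1 - ℓ)) := by
      rw [← conformalTime_eq hℓ ht0, mul_comm (1 - ℓ), ← Real.rpow_def_of_pos hte,
        Real.div_rpow ht0.le hε.le, conformalTime, conformalTime]
      have := (Real.rpow_pos_of_pos hε (1 - ℓ)).ne'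
      field_simp
    have htd := timeDeriv_pullback (θ := fun t => (1 - ℓ) * Real.log (t / ε)) hd hρd hθd
    have hsd := spaceDeriv_pullback (θ := fun t => (1 - ℓ) * Real.log (t / ε)) hd hρd hθd
    rw [diracOp_eq_zero_iff ha₀ m _ x ht0, htd, heq]
    simp only [hsd, hexp, pullback, Matrix.mulVec_smul]
    have h1 : (1 - ℓ : ℂ) ≠ 0 := by exact_mod_cast sub_ne_zero.2 hℓ.symm
    have ha : (scaleFactor a₀ ℓ t : ℂ) ≠ 0 := by exact_mod_cast (scaleFactor_pos ha₀ ht0).ne'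
    have htc : (t : ℂ) ≠ 0 := by exact_mod_cast ht0.ne'
    rw [show (ℓ - 1 : ℂ) = -(1 - ℓ) by ring]
    funext i
    simp only [Pi.add_apply, Pi.neg_apply, Pi.smul_apply, Finset.sum_apply, Complex.real_smul,
      smul_eq_mul, ← Finset.mul_sum, Pi.zero_apply]
    push_cast
    field_simp
    ring
  · simp only [pullback]
    rw [div_self hε.ne', Real.one_rpow, one_smul, Real.log_one, mul_zero, add_zero]

lemma eq_of_huygensPrinciple (ha₀ : 0 < a₀) (hℓ : ℓ ≠ 1) (hε : 0 < ε)
    (H : HuygensPrinciple (scaleFactor a₀ ℓ) m ε) :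
    Complex.I * m / (ℓ - 1) = 0 ∨ Complex.I * m / (ℓ - 1) = 1 ∨
      Complex.I * m / (ℓ - 1) = -1 := by
  -- Any final time later than `ε` would serve.
  have h2ε : ε < 2 * ε := by linarith
  set τ₀ := conformalTime a₀ ℓ ε with hτ₀
  set τ₁ := conformalTime a₀ ℓ (2 * ε) with hτ₁
  have h01 : τ₀ < τ₁ := conformalTime_lt ha₀ hℓ hε h2ε
  have hpos : ∀ τ ∈ Icc τ₀ τ₁, 0 < (1 - ℓ) * τ := fun τ hτ =>
    mul_pos_of_mem_Icc ha₀ hℓ hε (hε.trans h2ε) hτ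
  have hne : ∀ τ ∈ Icc τ₀ τ₁, τ ≠ 0 := fun τ hτ h => by
    have := hpos τ hτ
    simp [h] at this
  have h1 : 1 - ℓ ≠ 0 := sub_ne_zero.2 hℓ.symm
  have hpos0 := hpos τ₀ (left_mem_Icc.2 h01.le)
  have hdiv : ∀ τ ∈ Icc τ₀ τ₁, 0 < τ / τ₀ := fun τ hτ => by
    rw [← mul_div_mul_left τ τ₀ h1]
    exact div_pos (hpos τ hτ) hpos0
  refine eq_of_shell h01 hne fun δ hδ h hh hhc hhδ => ?_
  obtain ⟨ψ, hψ, hini, heq⟩ := exists_log_solution (Complex.I * m / (ℓ - 1)) τ₀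
    (h := fun x => (h x : ℂ)) (Complex.ofRealCLM.contDiff.comp hh)
    (hhc.comp_left (g := fun r : ℝ => (r : ℂ)) Complex.ofReal_zero)
  have hτ₀ini : ∀ x, pullback (fun _ => 1) (fun τ => Real.log (τ / τ₀)) 0 ψ (x, τ₀) =
      (h x : ℂ) • Pi.single 0 1 := fun x => by
    rw [pullback, one_smul, div_self (hne τ₀ (left_mem_Icc.2 h01.le)), Real.log_one, add_zero]
    exact hini x
  refine ⟨_, isConformalSolution_log hψ heq hdiv, hτ₀ini, fun x τ hτ hx => ?_⟩
  -- Huygens' principle speaks only of times after `ε`; at the initial time the shell is the ball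
  -- containing the support of `h`.
  rcases eq_or_lt_of_le hτ.1 with rfl | hlt
  · rw [hτ₀ini] at hx
    rw [sub_self, sub_zero, abs_norm]
    by_contra hlt
    exact hx (by rw [hhδ x (not_le.1 hlt)]; simp)
  set t := cosmicTime a₀ ℓ τ with ht
  have htτ : conformalTime a₀ ℓ t = τ := conformalTime_cosmicTime ha₀ hℓ (hpos τ hτ)
  have hεt : ε < t := lt_cosmicTime ha₀ hℓ (hpos τ hτ) hlt
  have ht0 := hε.trans hεt
  have hlog : Real.log (τ / τ₀) = (1 - ℓ) * Real.log (t / ε) := by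
    have : τ / τ₀ = (t / ε) ^ (1 - ℓ) := by
      rw [← htτ, hτ₀, Real.div_rpow ht0.le hε.le, conformalTime, conformalTime]
      field_simp
    rw [this, Real.log_rpow (div_pos ht0 hε)]
  have hΦ : ContDiff ℝ ∞ fun x => ψ (x, 0) := hψ.comp (contDiff_id.prodMk contDiff_const)
  have hsupp : tsupport (fun x => ψ (x, 0)) ⊆ Metric.closedBall 0 δ := by
    refine closure_minimal (fun z hz => ?_) Metric.isClosed_closedBall
    rw [mem_closedBall_zero_iff]
    by_contra hlt
    exact hz (by simp [hini, hhδ z (not_le.1 hlt)])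
  have hΦc : HasCompactSupport fun x => ψ (x, 0) :=
    (isCompact_closedBall (0 : Space) δ).of_isClosed_subset (isClosed_tsupport _) hsupp
  -- Otherwise the principle would make the solution vanish at an event where it is nonzero.
  have hreach : ∃ y ∈ tsupport (fun x => ψ (x, 0)),
      NullReachable (metric (scaleFactor a₀ ℓ)) (event ε y) (event t x) := by
    by_contra hno
    push Not at hno
    have h0 := H _ hΦ hΦc _ (isCauchySolution_log ha₀ hℓ hε hψ heq) x t hεt hno
    simp only [pullback] at h0 hx
    rw [hlog, one_smul] at hx
    exact hx ((smul_eq_zero.1 h0).resolve_left (Real.rpow_pos_of_pos (div_pos ht0 hε) _).ne')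
  obtain ⟨y, hy, hyr⟩ := hreach
  have hd := hyr.norm_sub_eq ha₀ hℓ hε hεt
  rw [htτ] at hd
  rw [← hd]
  have hyδ : ‖y‖ ≤ δ := mem_closedBall_zero_iff.1 (hsupp hy)
  -- Reverse triangle inequality: `‖x - y‖ = τ - τ₀` with `‖y‖ ≤ δ` places `x` in the shell.
  refine (abs_norm_sub_norm_le _ _).trans ?_
  rwa [sub_sub_cancel]

end Transfer

end FLRW

end

theorem theorem1p1 (a₀ ℓ : ℝ) (ha₀ : 0 < a₀) (hℓ : ℓ ≠ 1) (m : ℂ) (ε : ℝ) (hε : 0 < ε) :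
    FLRW.HuygensPrinciple (FLRW.scaleFactor a₀ ℓ) m ε ↔
      m = 0 ∨ m = Complex.I * ((ℓ : ℂ) - 1) ∨ m = -(Complex.I * ((ℓ : ℂ) - 1)) := by
  have h1 : (ℓ - 1 : ℂ) ≠ 0 := by exact_mod_cast sub_ne_zero.2 hℓ
  have hI := Complex.I_mul_I
  -- The last two alternatives are exchanged: `ν = 1` means `m = -i(ℓ-1)` because `1/i = -i`.
  have hν : (Complex.I * m / (ℓ - 1) = 0 ∨ Complex.I * m / (ℓ - 1) = 1 ∨
      Complex.I * m / (ℓ - 1) = -1) ↔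
      m = 0 ∨ m = Complex.I * ((ℓ : ℂ) - 1) ∨ m = -(Complex.I * ((ℓ : ℂ) - 1)) := by
    rw [div_eq_iff h1, div_eq_iff h1, div_eq_iff h1]
    constructor
    · rintro (h | h | h)
      · exact Or.inl (by linear_combination (-Complex.I) * h + m * hI)
      · exact Or.inr (Or.inr (by linear_combination (-Complex.I) * h + m * hI))
      · exact Or.inr (Or.inl (by linear_combination (-Complex.I) * h + m * hI))
    · rintro (h | h | h)
      · exact Or.inl (by rw [h]; ring)
      · exact Or.inr (Or.inr (by rw [h]; linear_combination (ℓ - 1 : ℂ) * hI))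
      · exact Or.inr (Or.inl (by rw [h]; linear_combination (-(ℓ - 1) : ℂ) * hI))
  rw [← hν]
  exact ⟨FLRW.eq_of_huygensPrinciple ha₀ hℓ hε, FLRW.huygensPrinciple_of_eq ha₀ hℓ hε⟩
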